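/- Let $X$ be a real separable Hilbert space and $T>0$. Let $\{U(t,s)\}_{0\le s\le t\le T}\subset\mathcal L(X)$ be a strongly continuous evolution operator (that is, $(s,t)\mapsto U(t,s)x$ is continuous on $\{0\le s\le t\le T\}$ for each $x\in X$, $U(t,t)=I$, and $U(t,s)U(s,r)=U(t,r)$ for $0\le r\le s\le t\le T$). Let $B:[0,T]\to\mathcal L(X)$ be bounded with $t\mapsto B(t)x$ measurable for each $x\in X$, and let $f:[0,T]\to X$ be bounded and measurable. For $0\le s\le t\le T$ put $$Q(t,s)x=\int_s^tU(t,r)B(r)B^*(r)U^*(t,r)x\,dr,\qquad m^x(t,s)=U(t,s)x+\int_s^tU(t,r)f(r)\,dr ,\qquad x\in X.$$ Assume that every $Q(t,s)$ is nonnegative, symmetric and of finite trace; that $U(t,s)(X)\subseteq Q(t,s)^{1/2}(X)$ for $0\le s<t\le T$; and that there are $c$ and $\theta>0$ such that the operators $\Lambda(t,s)=Q(t,s)^{-1/2}U(t,s)$, where $Q(t,s)^{-1/2}$ is the pseudo-inverse of $Q(t,s)^{1/2}$, satisfy $\|\Lambda(t,s)\|_{\mathcal L(X)}\le c\,(t-s)^{-\theta}$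 for $0\le s<t\le T$. For bounded Borel $\varphi:X\to\mathbb R$ let $$P_{s,t}\varphi(x)=\int_X\varphi(y)\,\mathcal N_{m^x(t,s),Q(t,s)}(dy)\qquad(0\le s\le t\le T),$$ where $\mathcal N_{m,Q}$ is the Gaussian measure with mean $m$ and covariance operator $Q$ (so $P_{t,t}=I$). For $t\in[0,T]$, let $u$ be the mild solution $$u(s,x)=P_{s,t}\varphi(x)-\int_s^tP_{s,\sigma}\psi(\sigma,\cdot)(x)\,d\sigma,\qquad 0\le s\le t,\ x\in X .$$ Function spaces. $C_b$ denotes the bounded continuous functions, with the sup norm. $C^n_b(X)$ is the set of $\varphi\in C_b(X)$ that are $n$ times Fréchet differentiable with bounded derivatives up to order $n$; its norm is $\|\varphi\|_\infty+\sum_{j=1}^n\sup_x\|D^j\varphi(x)\|$ (and $C^0_b(X)=C_b(X)$, $D^0\varphi=\varphi$). For $\alpha\in(0,1)$, $\|\varphi\|_{C^\alpha_b(X)}=\|\varphi\|_\infty+\sup_{x,\,h\ne0}|\varphi(x+h)-\varphi(x)|/\|h\|^\alpha$. For an integer $k\ge1$, $Z^k_b(X)$ is the set of $\varphi\in C^{k-1}_b(X)$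 such that $F=D^{k-1}\varphi$ is bounded and continuous with values in the bounded $(k-1)$-linear forms and $[F]_{Z^1}=\sup_{x,\,h\neq0}\|F(x+2h)-2F(x+h)+F(x)\|/\|h\|<\infty$; its norm is $\|\varphi\|_{Z^k_b(X)}=\|\varphi\|_{C^{k-1}_b(X)}+[D^{k-1}\varphi]_{Z^1}$. $C^{0,\alpha}_b([0,t]\times X)$ is the set of $\psi\in C_b([0,t]\times X)$ with $\|\psi\|_{C^{0,\alpha}_b}=\sup_{s\in[0,t]}\|\psi(s,\cdot)\|_{C^\alpha_b(X)}<\infty$. $Z^{0,k}_b([0,t]\times X)$ is the set of $v\in C_b([0,t]\times X)$ with $v(s,\cdot)\in Z^k_b(X)$ for all $s\in[0,t]$, with $\|v\|_{Z^{0,k}_b}=\sup_{s\in[0,t]}\|v(s,\cdot)\|_{Z^k_b(X)}<\infty$ and, if $k\ge2$, such that $(s,x)\mapsto D^jv(s,\cdot)(x)(h_1,\dots,h_j)$ is continuous on $[0,t]\times X$ for all $j\le k-1$ and $h_1,\dots,h_j\in X$. **Theorem.** (i) If $1/\theta=k\in\mathbb N$, there is a constant $C$, independent of $t$, $\varphi$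 and $\psi$, such that for every $t\in[0,T]$, $\varphi\in Z^k_b(X)$ and $\psi\in C_b([0,t]\times X)$, the function $u$ belongs to $Z^{0,k}_b([0,t]\times X)$ and $$\|u\|_{Z^{0,k}_b([0,t]\times X)}\le C\big(\|\varphi\|_{Z^k_b(X)}+\|\psi\|_\infty\big).$$ (ii) If $\alpha\in(0,1)$ and $\alpha+1/\theta=k\in\mathbb N$, there is a constant $C$, independent of $t$, $\varphi$ and $\psi$, such that for every $t\in[0,T]$, $\varphi\in Z^k_b(X)$ and $\psi\in C^{0,\alpha}_b([0,t]\times X)$, the function $u$ belongs to $Z^{0,k}_b([0,t]\times X)$ and $$\|u\|_{Z^{0,k}_b([0,t]\times X)}\le C\big(\|\varphi\|_{Z^k_b(X)}+\|\psi\|_{C^{0,\alpha}_b([0,t]\times X)}\big).$$ -/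

import Mathlib

open MeasureTheory Set
open scoped ENNReal NNReal InnerProductSpace

noncomputable section

namespace OU

section FunctionSpaces

variable {X Y : Type*} [NormedAddCommGroup X] [NormedSpace ℝ X]
  [NormedAddCommGroup Y] [NormedSpace ℝ Y]

/-! All norms take values in `ℝ≥0∞`, so a supremum is never a junk value. -/

/-- The sup norm of `F : X → Y`. -/
def supNorm (F : X → Y) : ℝ≥0∞ := ⨆ x, ‖F x‖ₑ

/-- The space `C_b(X; Y)` of bounded continuous functions. -/
def MemCb (F : X → Y) : Prop := Continuous F ∧ supNorm F < ∞

/-- The Hölder seminorm `[F]_{C^α(X, Y)}`. -/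
def holderSeminorm (α : ℝ) (F : X → Y) : ℝ≥0∞ :=
  ⨆ (x : X) (h : X) (_ : h ≠ 0), ‖F (x + h) - F x‖ₑ / ENNReal.ofReal (‖h‖ ^ α)

/-- The norm of `C^α_b(X; Y)`, for `0 < α < 1`. -/
def holderNorm (α : ℝ) (F : X → Y) : ℝ≥0∞ := supNorm F + holderSeminorm α F

/-- The space `C^α_b(X; Y)`, for `0 < α < 1`. -/
def MemHolder (α : ℝ) (F : X → Y) : Prop := MemCb F ∧ holderSeminorm α F < ∞

/-- The Zygmund seminorm `[F]_{Z^1(X, Y)}`. -/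
def zygmundSeminorm (F : X → Y) : ℝ≥0∞ :=
  ⨆ (x : X) (h : X) (_ : h ≠ 0),
    ‖F (x + (2 : ℝ) • h) - (2 : ℝ) • F (x + h) + F x‖ₑ / ‖h‖ₑ

/-- The norm of `C^n_b(X)`: the sum of the sup norms of `f, D f, …, D^n f`. -/
def cnNorm (n : ℕ) (f : X → ℝ) : ℝ≥0∞ :=
  supNorm f + ∑ j ∈ Finset.Icc 1 n, supNorm (iteratedFDeriv ℝ j f)

/-- The space `C^n_b(X)`: functions in `C_b(X)` which are `n` times Fréchet differentiable, with
bounded Fréchet derivatives up to the order `n`. -/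
def MemCn (n : ℕ) (f : X → ℝ) : Prop :=
  MemCb f ∧ (∀ j < n, Differentiable ℝ (iteratedFDeriv ℝ j f)) ∧
    ∀ j ≤ n, supNorm (iteratedFDeriv ℝ j f) < ∞

/-- The norm of the Zygmund space `Z^k_b(X)`, for `k ≥ 1`. For `k = 1` it is
`‖f‖_∞ + [f]_{Z^1}`, since `iteratedFDeriv ℝ 0 f` is `f` up to the canonical isometry between `ℝ`
and the `0`-linear forms on `X`. -/
def zygmundNorm (k : ℕ) (f : X → ℝ) : ℝ≥0∞ :=
  cnNorm (k - 1) f + zygmundSeminorm (iteratedFDeriv ℝ (k - 1) f)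

/-- The Zygmund space `Z^k_b(X)`, for `k ≥ 1`: the functions `f ∈ C^{k-1}_b(X)` such that
`D^{k-1} f` belongs to `Z^1_b(X; L^{k-1}(X))`. -/
def MemZygmund (k : ℕ) (f : X → ℝ) : Prop :=
  MemCn (k - 1) f ∧ MemCb (iteratedFDeriv ℝ (k - 1) f) ∧
    zygmundSeminorm (iteratedFDeriv ℝ (k - 1) f) < ∞

/-! Functions `v = v(s, x)` of time `s ∈ [a, b]` and space `x ∈ X`. -/

/-- The sup norm over `[a, b] × X`. -/
def supNormTime (a b : ℝ) (v : ℝ → X → ℝ) : ℝ≥0∞ := ⨆ s ∈ Icc a b, supNorm (v s)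

/-- The space `C_b([a, b] × X)`. -/
def MemCbTime (a b : ℝ) (v : ℝ → X → ℝ) : Prop :=
  ContinuousOn (fun p : ℝ × X => v p.1 p.2) (Icc a b ×ˢ univ) ∧ supNormTime a b v < ∞

/-- The norm of `C^{0,α}_b([a, b] × X)`, for `0 < α < 1`. -/
def holderNormTime (a b α : ℝ) (v : ℝ → X → ℝ) : ℝ≥0∞ := ⨆ s ∈ Icc a b, holderNorm α (v s)

/-- The space `C^{0,α}_b([a, b] × X)`, for `0 < α < 1`. -/
def MemHolderTime (a b α : ℝ) (v : ℝ → X → ℝ) : Prop :=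
  MemCbTime a b v ∧ (∀ s ∈ Icc a b, MemHolder α (v s)) ∧ holderNormTime a b α v < ∞

/-- The space `C^{0,n}_b([a, b] × X)`, for integer `n ≥ 1`; the last clause is the continuity of
`(s, x) ↦ (∂^j v / ∂h₁ … ∂h_j)(s, x)` on `[a, b] × X` for all directions and all `j ≤ n`. -/
def MemCnTime (a b : ℝ) (n : ℕ) (v : ℝ → X → ℝ) : Prop :=
  MemCbTime a b v ∧ (∀ s ∈ Icc a b, MemCn n (v s)) ∧ (⨆ s ∈ Icc a b, cnNorm n (v s)) < ∞ ∧
    ∀ j ≤ n, ∀ h : Fin j → X,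
      ContinuousOn (fun p : ℝ × X => iteratedFDeriv ℝ j (v p.1) p.2 h) (Icc a b ×ˢ univ)

/-- The norm of `Z^{0,k}_b([a, b] × X)`, for `k ≥ 1`. -/
def zygmundNormTime (a b : ℝ) (k : ℕ) (v : ℝ → X → ℝ) : ℝ≥0∞ :=
  ⨆ s ∈ Icc a b, zygmundNorm k (v s)

/-- The space `Z^{0,k}_b([a, b] × X)`, for `k ≥ 1`. -/
def MemZygmundTime (a b : ℝ) (k : ℕ) (v : ℝ → X → ℝ) : Prop :=
  MemCbTime a b v ∧ (∀ s ∈ Icc a b, MemZygmund k (v s)) ∧ zygmundNormTime a b k v < ∞ ∧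
    (2 ≤ k → MemCnTime a b (k - 1) v)

end FunctionSpaces

section Operators

variable {X : Type*} [NormedAddCommGroup X] [InnerProductSpace ℝ X]

/-- The operator `x ↦ ∫_a^b G(r) x dr` for a strongly integrable family `G` of bounded operators
(`0` if there is no such bounded operator). The family need not be measurable with respect to the
operator norm. -/
def strongIntegral (G : ℝ → X →L[ℝ] X) (a b : ℝ) : X →L[ℝ] X :=
  open Classical in
  if h : ∃ S : X →L[ℝ] X, ∀ x, IntervalIntegrable (fun r => G r x) volume a b ∧
      S x = ∫ r in a..b, G r x
  then h.choose else 0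

/-- `L₁⁺(X)`: nonnegative symmetric operators with finite trace. For nonnegative operators the
trace does not depend on the orthonormal basis used to compute it. -/
def IsPositiveTraceClass (Q : X →L[ℝ] X) : Prop :=
  Q.IsPositive ∧ ∃ (w : Set X) (b : HilbertBasis w ℝ X), Summable fun i => ⟪Q (b i), b i⟫_ℝ

/-- The nonnegative square root `Q^{1/2}` of a nonnegative symmetric operator. -/
def opSqrt (Q : X →L[ℝ] X) : X →L[ℝ] X :=
  open Classical in
  if h : ∃ S : X →L[ℝ] X, S.IsPositive ∧ S ∘L S = Q then h.choose else 0

/-- The pseudo-inverse of `S`, defined on the range of `S` (and extended by `0`): it maps `y` to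
the unique preimage of `y` which is orthogonal to the kernel of `S`. -/
def pseudoInverse (S : X →L[ℝ] X) (y : X) : X :=
  open Classical in
  if h : ∃ x, x ∈ (LinearMap.ker (S : X →ₗ[ℝ] X))ᗮ ∧ S x = y then h.choose else 0

variable [CompleteSpace X] [MeasurableSpace X] [BorelSpace X]

/-- `μ` is the Gaussian measure on `X` with mean `m` and covariance operator `Q`. -/
def IsGaussianWith (m : X) (Q : X →L[ℝ] X) (μ : Measure X) : Prop :=
  ProbabilityTheory.IsGaussian μ ∧ ∫ y, y ∂μ = m ∧
    ∀ x y : X, ProbabilityTheory.covarianceBilin μ x y = ⟪Q x, y⟫_ℝ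

/-- The Gaussian measure `N_{m,Q}` with mean `m` and covariance operator `Q` (which exists and is
unique for `Q ∈ L₁⁺(X)` and separable `X`). -/
def gaussian (m : X) (Q : X →L[ℝ] X) : Measure X :=
  open Classical in
  if h : ∃ μ : Measure X, IsGaussianWith m Q μ then h.choose else 0

/-- `Q(t,s) = ∫_s^t U(t,r) B(r) B*(r) U*(t,r) dr`. -/
def covOp (U : ℝ → ℝ → X →L[ℝ] X) (B : ℝ → X →L[ℝ] X) (t s : ℝ) : X →L[ℝ] X :=
  strongIntegral (fun r => U t r ∘L B r ∘L ContinuousLinearMap.adjoint (B r) ∘L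
    ContinuousLinearMap.adjoint (U t r)) s t

/-- `m^x(t,s) = U(t,s) x + g(t,s)`, where `g(t,s) = ∫_s^t U(t,r) f(r) dr`. -/
def meanVec (U : ℝ → ℝ → X →L[ℝ] X) (f : ℝ → X) (t s : ℝ) (x : X) : X :=
  U t s x + ∫ r in s..t, U t r (f r)

/-- `Λ(t,s) = Q(t,s)^{-1/2} U(t,s)`. -/
def Lam (U : ℝ → ℝ → X →L[ℝ] X) (B : ℝ → X →L[ℝ] X) (t s : ℝ) (x : X) : X :=
  pseudoInverse (opSqrt (covOp U B t s)) (U t s x)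

/-- The evolution family `P_{s,t} φ (x) = ∫ φ(y) N_{m^x(t,s), Q(t,s)}(dy)`. For `s = t` this is
`φ(x)`, the measure being then the Dirac measure `N_{x,0}` at `x`. -/
def evol (U : ℝ → ℝ → X →L[ℝ] X) (B : ℝ → X →L[ℝ] X) (f : ℝ → X) (s t : ℝ) (φ : X → ℝ)
    (x : X) : ℝ :=
  ∫ y, φ y ∂(gaussian (meanVec U f t s x) (covOp U B t s))

/-- The mild solution `u(s,x) = P_{s,t} φ (x) - ∫_s^t P_{s,σ} ψ(σ,·) (x) dσ`, `0 ≤ s ≤ t`. -/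
def mildSolution (U : ℝ → ℝ → X →L[ℝ] X) (B : ℝ → X →L[ℝ] X) (f : ℝ → X) (t : ℝ)
    (φ : X → ℝ) (ψ : ℝ → X → ℝ) (s : ℝ) (x : X) : ℝ :=
  evol U B f s t φ x - ∫ σ in s..t, evol U B f s σ (ψ σ) x

/-- The standing assumptions on `U`, `B`, `f`: `U` is a strongly continuous evolution operator on
`0 ≤ s ≤ t ≤ T`, `B` is bounded and strongly measurable, `f` is bounded and measurable, and
`Q(t,s)` is nonnegative, symmetric and of finite trace. -/
structure Standing (T : ℝ) (U : ℝ → ℝ → X →L[ℝ] X) (B : ℝ → X →L[ℝ] X) (f : ℝ → X) :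
    Prop where
  continuousOn_U : ∀ x, ContinuousOn (fun p : ℝ × ℝ => U p.2 p.1 x)
    {p | 0 ≤ p.1 ∧ p.1 ≤ p.2 ∧ p.2 ≤ T}
  U_self : ∀ t ∈ Icc 0 T, U t t = ContinuousLinearMap.id ℝ X
  U_comp : ∀ r s t, 0 ≤ r → r ≤ s → s ≤ t → t ≤ T → U t s ∘L U s r = U t r
  bounded_B : ∃ K : ℝ, ∀ t ∈ Icc 0 T, ‖B t‖ ≤ K
  measurable_B : ∀ x, AEStronglyMeasurable (fun t => B t x) (volume.restrict (Icc 0 T))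
  bounded_f : ∃ K : ℝ, ∀ t ∈ Icc 0 T, ‖f t‖ ≤ K
  measurable_f : AEStronglyMeasurable f (volume.restrict (Icc 0 T))
  traceClass : ∀ s t, 0 ≤ s → s ≤ t → t ≤ T → IsPositiveTraceClass (covOp U B t s)

/-- `U(t,s)(X) ⊆ Q(t,s)^{1/2}(X)` for `0 ≤ s < t ≤ T`. -/
def RangeCondition (T : ℝ) (U : ℝ → ℝ → X →L[ℝ] X) (B : ℝ → X →L[ℝ] X) : Prop :=
  ∀ s t, 0 ≤ s → s < t → t ≤ T → range (U t s) ⊆ range (opSqrt (covOp U B t s))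

/-- `‖Λ(t,s)‖_{L(X)} ≤ c (t - s)^{-θ}` for `0 ≤ s < t ≤ T`, with some constant `c`. -/
def LamBound (T θ : ℝ) (U : ℝ → ℝ → X →L[ℝ] X) (B : ℝ → X →L[ℝ] X) : Prop :=
  ∃ c : ℝ, ∀ s t, 0 ≤ s → s < t → t ≤ T → ∀ x, ‖Lam U B t s x‖ ≤ c * (t - s) ^ (-θ) * ‖x‖

end Operators

end OU

end

set_option linter.unusedSectionVars false

/-! The proof replaces derivatives by iterated finite differences. A function lies in the Zygmund
space of order `n + 1` exactly when its differences of order `j ≤ n` are bounded by a constant times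
the product of the step lengths, and `n` steps followed by two equal steps `b` gain one more factor
`‖b‖`; this is `ZygBounds`, with `ZygBounds.memZygmund` and `MemZygmund.zygBounds`. Differences
commute with integrals and with affine changes of variable, so nothing is differentiated under an
integral sign.

Since the mean is affine in `x` with linear part `U(t,s)`, a difference of `P_{s,t} φ` along given
steps is `P_{s,t}` of the difference of `φ` along their images under `U(t,s)`. This settles the term
with `φ`. For smoothing, `U(t,s) h = Q^{1/2} Λ h`, and a shift of `N_{0,Q}` by `Q^{1/2} a`, `a ⊥ ker
Q^{1/2}`, changes the integral of a function bounded by `A` by at most `2 ‖a‖ A`. To treat `j`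
steps, `N_{0,Q}` is written as the convolution of `j` copies of itself scaled by `j^{-1/2}`, and
each copy absorbs one step. The result is a bound of order `(t - s)^{-θ j}` for differences of order
`j` (`HasGaussCharFun.abs_iterDiff_smear_le`, `Standing.exists_smoothing_const`).

In the time integral put `k = n + 1` and `r = σ - s`. As `θ n < 1`, differences of order at most `n`
have an integrable singularity. The Zygmund difference obeys two bounds, `‖b‖^a r^{-p}` with `p < 1`
and `‖b‖^e r^{-q}` with `q > 1`. Using the first below `r = ‖b‖^{1/θ}` and the second above it, both
parts are multiples of `‖b‖`, without a logarithm; this is where `1/θ = k` or `α + 1/θ = k` enters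
(`abs_integral_le_of_two_bounds`).

It remains to justify the integrals and the joint continuity of `u`. Continuity in `(s, x)` is weak
convergence of Gaussian measures, tight because `Q(t,s) ≤ Q(t,0)`. Measurability in `σ` comes from
expressing Gaussian integrals as limits of finite-dimensional ones built from a measurable square
root of `Q`. -/

namespace OU

open Filter Topology

/-! ### Iterated forward differences -/

section IterDiff

variable {X Y Z : Type*}

/-- The iterated forward difference of `F` along the steps in the list `l`. -/
def iterDiff [AddCommMonoid X] [AddCommGroup Y] (l : List X) (F : X → Y) : X → Y := l.foldr fwdDiff F

section Algebra

variable [AddCommGroup X] [AddCommGroup Y] [AddCommGroup Z]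

@[simp] lemma iterDiff_nil (F : X → Y) : iterDiff [] F = F := rfl

lemma iterDiff_cons (a : X) (l : List X) (F : X → Y) :
    iterDiff (a :: l) F = fwdDiff a (iterDiff l F) := rfl

lemma fwdDiff_fwdDiff_comm (a b : X) (F : X → Y) :
    fwdDiff a (fwdDiff b F) = fwdDiff b (fwdDiff a F) := by
  funext x; simp only [fwdDiff, add_right_comm]; abel

/-- Forward differences commute, so an innermost step may be moved to the front of the list. -/
lemma iterDiff_fwdDiff (l : List X) (a : X) (F : X → Y) :
    iterDiff l (fwdDiff a F) = iterDiff (a :: l) F := by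
  induction l with
  | nil => rfl
  | cons b l ih => rw [iterDiff_cons, ih, iterDiff_cons, fwdDiff_fwdDiff_comm]; rfl

lemma iterDiff_append (l m : List X) (F : X → Y) :
    iterDiff (l ++ m) F = iterDiff l (iterDiff m F) := List.foldr_append

lemma iterDiff_sub (l : List X) (F G : X → Y) :
    iterDiff l (fun x => F x - G x) = fun x => iterDiff l F x - iterDiff l G x := by
  induction l with
  | nil => rfl
  | cons a l ih => funext x; simp only [iterDiff_cons, ih, fwdDiff]; abel

lemma iterDiff_map (l : List X) (F : X → Y) (T : Y →+ Z) :
    iterDiff l (fun x => T (F x)) = fun x => T (iterDiff l F x) := by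
  induction l with
  | nil => rfl
  | cons a l ih => funext x; simp only [iterDiff_cons, ih, fwdDiff, map_sub]

/-- An affine change of variable acts on steps through its linear part only; this is how `U(t,s)`
reaches the steps. -/
lemma iterDiff_comp_add (l : List X) (A : X →+ Z) (c : Z) (F : Z → Y) :
    iterDiff l (fun x => F (A x + c)) = fun x => iterDiff (l.map A) F (A x + c) := by
  induction l with
  | nil => rfl
  | cons a l ih =>
    funext x
    simp only [iterDiff_cons, ih, fwdDiff, List.map_cons, map_add, add_right_comm]

lemma fwdDiff_add_step (a b : X) (F : X → Y) (x : X) :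
    fwdDiff (a + b) F x = fwdDiff a F x + fwdDiff b F x + fwdDiff a (fwdDiff b F) x := by
  simp only [fwdDiff, ← add_assoc]; abel

lemma fwdDiff_fwdDiff_self (b : X) (F : X → Y) (x : X) :
    fwdDiff b (fwdDiff b F) x = fwdDiff (b + b) F x - (2 : ℕ) • fwdDiff b F x := by
  simp only [fwdDiff, ← add_assoc]; abel

end Algebra

section Normed

variable [NormedAddCommGroup X] [NormedAddCommGroup Y]

/-- The product of the norms of the entries of a list. -/
def normProd (l : List X) : ℝ := (l.map (‖·‖)).prod

@[simp] lemma normProd_nil : normProd ([] : List X) = 1 := rfl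

@[simp] lemma normProd_cons (a : X) (l : List X) : normProd (a :: l) = ‖a‖ * normProd l := by
  simp [normProd]

lemma normProd_nonneg (l : List X) : 0 ≤ normProd l := by
  induction l with
  | nil => simp
  | cons a l ih => rw [normProd_cons]; positivity

lemma norm_iterDiff_le {F : X → Y} {A : ℝ} (hF : ∀ x, ‖F x‖ ≤ A) (l : List X) (x : X) :
    ‖iterDiff l F x‖ ≤ 2 ^ l.length * A := by
  induction l generalizing x with
  | nil => simpa using hF x
  | cons a l ih =>
    have h1 := norm_sub_le (iterDiff l F (x + a)) (iterDiff l F x)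
    have h2 := ih (x + a)
    have h3 := ih x
    rw [iterDiff_cons, List.length_cons, pow_succ]
    simp only [fwdDiff]
    linarith

lemma continuous_iterDiff {F : X → Y} (hF : Continuous F) (l : List X) :
    Continuous (iterDiff l F) := by
  induction l with
  | nil => exact hF
  | cons a l ih =>
    rw [iterDiff_cons]
    exact (ih.comp (continuous_id.add continuous_const)).sub ih

lemma tendsto_iterDiff {ι : Type*} {p : Filter ι} {F : ι → X → Y} {G : X → Y}
    (h : ∀ x, Tendsto (fun i => F i x) p (𝓝 (G x))) (l : List X) (x : X) :
    Tendsto (fun i => iterDiff l (F i) x) p (𝓝 (iterDiff l G x)) := by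
  induction l generalizing x with
  | nil => exact h x
  | cons a l ih => exact (ih (x + a)).sub (ih x)

lemma iterDiff_integral [NormedSpace ℝ Y] {Ω : Type*} [MeasurableSpace Ω]
    {μ : Measure Ω} {F : Ω → X → Y}
    (hF : ∀ x, Integrable (fun ω => F ω x) μ) (l : List X) :
    (∀ x, Integrable (fun ω => iterDiff l (F ω) x) μ) ∧
      iterDiff l (fun x => ∫ ω, F ω x ∂μ) = fun x => ∫ ω, iterDiff l (F ω) x ∂μ := by
  induction l with
  | nil => exact ⟨hF, rfl⟩
  | cons a l ih =>
    refine ⟨fun x => (ih.1 (x + a)).sub (ih.1 x), ?_⟩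
    funext x
    simp only [iterDiff_cons, ih.2, fwdDiff]
    rw [integral_sub (ih.1 _) (ih.1 _)]

/-- `n`-fold differences of `F` are bounded by `M` times the product of the norms of the steps. -/
def DiffBound (n : ℕ) (M : ℝ) (F : X → Y) : Prop :=
  ∀ l : List X, l.length = n → ∀ x, ‖iterDiff l F x‖ ≤ M * normProd l

/-- `n`-fold differences of `F` are Hölder continuous of exponent `1/2`. -/
def HolderDiffBound (n : ℕ) (M : ℝ) (F : X → Y) : Prop :=
  ∀ l : List X, l.length = n → ∀ b x, ‖iterDiff (l ++ [b]) F x‖ ≤ M * normProd l * √‖b‖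

/-- `n`-fold differences of `F` satisfy a Zygmund condition. -/
def ZygDiffBound (n : ℕ) (M : ℝ) (F : X → Y) : Prop :=
  ∀ l : List X, l.length = n → ∀ b x, ‖iterDiff (l ++ [b, b]) F x‖ ≤ M * normProd l * ‖b‖

end Normed

end IterDiff

/-! ### Zygmund regularity from difference bounds -/

section Smoothness

variable {X : Type*} [NormedAddCommGroup X] [NormedSpace ℝ X]
variable {Y : Type*} [NormedAddCommGroup Y] [NormedSpace ℝ Y]

/-- The identity `2 Δ_b F = Δ_{2b} F - Δ_b Δ_b F` passes an estimate from the step `2b` to `b`.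
Boundedness covers `‖b‖ ≥ 1`, and smaller steps are reached by dyadic descent. The exponent `1/2` is
a convenient choice: any positive exponent is enough to produce derivatives. -/
lemma norm_fwdDiff_le_sqrt {F : X → Y} {M : ℝ} (hM : ∀ x, ‖F x‖ ≤ M)
    (hK : ∀ b x, ‖fwdDiff b (fwdDiff b F) x‖ ≤ M * ‖b‖) (b x : X) :
    ‖fwdDiff b F x‖ ≤ 4 * M * √‖b‖ := by
  have hM0 : 0 ≤ M := (norm_nonneg _).trans (hM 0)
  have big : ∀ b x : X, 1 ≤ ‖b‖ → ‖fwdDiff b F x‖ ≤ 4 * M * √‖b‖ := by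
    intro b x hb
    have h1 : ‖fwdDiff b F x‖ ≤ M + M := (norm_sub_le _ _).trans (add_le_add (hM _) (hM _))
    have h2 : 1 ≤ √‖b‖ := Real.one_le_sqrt.2 hb
    nlinarith
  have key : ∀ n : ℕ, ∀ b x : X, (2⁻¹ : ℝ) ^ n ≤ ‖b‖ → ‖fwdDiff b F x‖ ≤ 4 * M * √‖b‖ := by
    intro n
    induction n with
    | zero => intro b x hb; exact big b x (by simpa using hb)
    | succ n ih =>
      intro b x hb
      rcases le_or_gt 1 ‖b‖ with h1 | h1
      · exact big b x h1
      · have hbb : ‖b + b‖ = 2 * ‖b‖ := by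
          rw [← two_smul ℝ b, norm_smul]; simp
        have h2 := ih (b + b) x (by rw [hbb]; rw [pow_succ] at hb; linarith)
        have h3 := hK b x
        have h4 : (2 : ℝ) • fwdDiff b F x =
            fwdDiff (b + b) F x - fwdDiff b (fwdDiff b F) x := by
          rw [fwdDiff_fwdDiff_self, two_smul, two_nsmul]; abel
        have h5 : 2 * ‖fwdDiff b F x‖ ≤ 4 * M * √‖b + b‖ + M * ‖b‖ := by
          calc 2 * ‖fwdDiff b F x‖ = ‖(2 : ℝ) • fwdDiff b F x‖ := by rw [norm_smul]; simp
            _ ≤ _ := by rw [h4]; exact (norm_sub_le _ _).trans (add_le_add h2 h3)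
        rw [hbb, Real.sqrt_mul (by norm_num)] at h5
        -- The constant `4` reproduces itself because `4 · 3/2 + 1 ≤ 2 · 4`.
        have h6 : √2 ≤ 3 / 2 := by
          rw [Real.sqrt_le_left (by norm_num)]; norm_num
        have h7 : ‖b‖ ≤ √‖b‖ := by
          apply Real.le_sqrt_of_sq_le; nlinarith [norm_nonneg b]
        have h8 : M * ‖b‖ ≤ M * √‖b‖ := mul_le_mul_of_nonneg_left h7 hM0
        have h9 : √2 * (M * √‖b‖) ≤ 3 / 2 * (M * √‖b‖) :=
          mul_le_mul_of_nonneg_right h6 (by positivity)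
        have h10 : 4 * M * (√2 * √‖b‖) = 4 * (√2 * (M * √‖b‖)) := by ring
        have h11 : 0 ≤ M * √‖b‖ := by positivity
        linarith
  rcases eq_or_ne b 0 with rfl | hb
  · simp [fwdDiff]
  · obtain ⟨n, hn⟩ := exists_pow_lt_of_lt_one (norm_pos_iff.2 hb) (by norm_num : (2⁻¹ : ℝ) < 1)
    exact key n b x hn.le

/-- The Lipschitz bound is used for `‖b‖ < 1`, where `‖b‖ ≤ √‖b‖`, and the triangle inequality
otherwise. -/
lemma HolderDiffBound.of_succ {F : X → Y} {n : ℕ} {M : ℝ} (h0 : DiffBound n M F)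
    (h1 : DiffBound (n + 1) M F) (hM : 0 ≤ M) : HolderDiffBound n (4 * M) F := by
  intro l hl b x
  have hb : iterDiff (l ++ [b]) F = fwdDiff b (iterDiff l F) := by
    rw [iterDiff_append]; exact iterDiff_fwdDiff l b F
  have h2 : ‖iterDiff (l ++ [b]) F x‖ ≤ M * (‖b‖ * normProd l) := by
    rw [hb]; exact (h1 (b :: l) (by simp [hl]) x).trans_eq (by simp)
  have h3 : ‖iterDiff (l ++ [b]) F x‖ ≤ 2 * (M * normProd l) := by
    rw [hb, two_mul]
    exact (norm_sub_le _ _).trans (add_le_add (h0 l hl _) (h0 l hl _))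
  have h4 : 0 ≤ M * normProd l := mul_nonneg hM (normProd_nonneg l)
  rcases le_or_gt 1 ‖b‖ with hb1 | hb1
  · have : 1 ≤ √‖b‖ := Real.one_le_sqrt.2 hb1
    nlinarith
  · have : ‖b‖ ≤ √‖b‖ := Real.le_sqrt_of_sq_le (by nlinarith [norm_nonneg b])
    nlinarith [mul_le_mul_of_nonneg_left this h4, Real.sqrt_nonneg ‖b‖]

lemma HolderDiffBound.of_zyg {F : X → Y} {n : ℕ} {M : ℝ} (h0 : DiffBound n M F)
    (h1 : ZygDiffBound n M F) : HolderDiffBound n (4 * M) F := by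
  intro l hl b x
  have hb : iterDiff (l ++ [b]) F = fwdDiff b (iterDiff l F) := by
    rw [iterDiff_append]; exact iterDiff_fwdDiff l b F
  have hbb : ∀ b, iterDiff (l ++ [b, b]) F = fwdDiff b (fwdDiff b (iterDiff l F)) := by
    intro b
    rw [iterDiff_append]
    change iterDiff l (fwdDiff b (fwdDiff b F)) = _
    rw [iterDiff_fwdDiff, iterDiff_cons, iterDiff_fwdDiff]; rfl
  rw [hb]
  refine (norm_fwdDiff_le_sqrt (M := M * normProd l) (h0 l hl) (fun b x => ?_) b x).trans_eq
    (by ring)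
  rw [← hbb]
  exact h1 l hl b x

/-- A function with bounded first differences and Hölder continuous first differences is
differentiable, with a quantitative bound for the remainder. -/
lemma exists_hasFDerivAt_of_diff_bounds [CompleteSpace Y] {F : X → Y} {M K : ℝ}
    (hM : ∀ a x, ‖fwdDiff a F x‖ ≤ M * ‖a‖)
    (hK : ∀ a b x, ‖fwdDiff a (fwdDiff b F) x‖ ≤ K * ‖a‖ * √‖b‖) (hK0 : 0 ≤ K) (x : X) :
    ∃ L : X →L[ℝ] Y, HasFDerivAt F L x ∧
      ∀ a, ‖F (x + a) - F x - L a‖ ≤ 4 * K * ‖a‖ * √‖a‖ := by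
  -- The derivative in the direction `a` is constructed as the limit of dyadic difference quotients.
  let D : X → ℕ → Y := fun a n => (2 : ℝ) ^ n • fwdDiff ((2⁻¹ : ℝ) ^ n • a) F x
  set r : ℝ := √2⁻¹ with hr
  have hr1 : r ≤ 3 / 4 := by rw [hr, Real.sqrt_le_left (by norm_num)]; norm_num
  have hr0 : 0 ≤ r := Real.sqrt_nonneg _
  -- Consecutive quotients differ by `2^n` times a second difference with steps `c`, `‖c‖ = 2^{-n-1}
  -- ‖a‖`. The factor `‖c‖` compensates `2^n`, and `√‖c‖` leaves the ratio `r = 2^{-1/2}`.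
  have hstep : ∀ a n, dist (D a n) (D a (n + 1)) ≤ K * ‖a‖ * √‖a‖ * r ^ n := by
    intro a n
    set c : X := (2⁻¹ : ℝ) ^ (n + 1) • a with hc
    have hcc : (2⁻¹ : ℝ) ^ n • a = c + c := by
      rw [hc, ← two_smul ℝ, smul_smul, pow_succ]; congr 1; ring
    have hD : D a n - D a (n + 1) = (2 : ℝ) ^ n • fwdDiff c (fwdDiff c F) x := by
      simp only [D, hcc]
      rw [fwdDiff_fwdDiff_self, pow_succ, mul_smul, ← smul_sub, two_smul, two_nsmul]
    have hcn : ‖c‖ = 2⁻¹ ^ (n + 1) * ‖a‖ := by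
      rw [hc, norm_smul, Real.norm_of_nonneg (by positivity)]
    have hsq : √‖c‖ = r ^ (n + 1) * √‖a‖ := by
      rw [hcn, Real.sqrt_mul (by positivity), hr]
      congr 1
      rw [Real.sqrt_eq_iff_mul_self_eq (by positivity) (by positivity), ← mul_pow,
        Real.mul_self_sqrt (by norm_num)]
    rw [dist_eq_norm, hD, norm_smul, Real.norm_of_nonneg (by positivity)]
    calc (2 : ℝ) ^ n * ‖fwdDiff c (fwdDiff c F) x‖ ≤ 2 ^ n * (K * ‖c‖ * √‖c‖) := by
          gcongr; exact hK _ _ _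
      _ = (2 ^ n * 2⁻¹ ^ n) * 2⁻¹ * (K * ‖a‖ * √‖a‖ * r ^ n) * r := by
          rw [hsq, hcn, pow_succ, pow_succ]; ring
      _ = 2⁻¹ * r * (K * ‖a‖ * √‖a‖ * r ^ n) := by
          rw [← mul_pow]; norm_num; ring
      _ ≤ 1 * (K * ‖a‖ * √‖a‖ * r ^ n) := by gcongr; linarith
      _ = _ := one_mul _
  have hlim : ∀ a, ∃ y, Tendsto (D a) atTop (𝓝 y) := fun a =>
    cauchySeq_tendsto_of_complete (cauchySeq_of_le_geometric r _ (by linarith) (hstep a))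
  choose L hL using hlim
  have hLM : ∀ a, ‖L a‖ ≤ M * ‖a‖ := by
    intro a
    refine le_of_tendsto (hL a).norm (Eventually.of_forall fun n => ?_)
    simp only [D, norm_smul]
    rw [Real.norm_of_nonneg (by positivity)]
    calc (2 : ℝ) ^ n * ‖fwdDiff ((2⁻¹ : ℝ) ^ n • a) F x‖
        ≤ 2 ^ n * (M * ‖(2⁻¹ : ℝ) ^ n • a‖) := by gcongr; exact hM _ _
      _ = (2 ^ n * 2⁻¹ ^ n) * (M * ‖a‖) := by
          rw [norm_smul, Real.norm_of_nonneg (by positivity)]; ring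
      _ = _ := by rw [← mul_pow]; norm_num
  -- The defect of additivity of the quotients is a rescaled mixed second difference, which vanishes
  -- in the limit thanks to the factor `√‖b‖`.
  have hadd : ∀ a b, L (a + b) = L a + L b := by
    intro a b
    have h0 : Tendsto (fun n => D (a + b) n - (D a n + D b n)) atTop (𝓝 0) := by
      have hb : Tendsto (fun n : ℕ => K * ‖a‖ * (r ^ n * √‖b‖)) atTop (𝓝 0) := by
        have := (tendsto_pow_atTop_nhds_zero_of_lt_one hr0 (by linarith : r < 1)).mul_const √‖b‖
        simpa using this.const_mul (K * ‖a‖)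
      refine squeeze_zero_norm (fun n => ?_) hb
      have h1 : D (a + b) n - (D a n + D b n) = (2 : ℝ) ^ n •
          fwdDiff ((2⁻¹ : ℝ) ^ n • a) (fwdDiff ((2⁻¹ : ℝ) ^ n • b) F) x := by
        simp only [D]
        rw [smul_add, fwdDiff_add_step, smul_add, smul_add]; abel
      rw [h1, norm_smul, Real.norm_of_nonneg (by positivity)]
      have hsq : √‖(2⁻¹ : ℝ) ^ n • b‖ = r ^ n * √‖b‖ := by
        rw [norm_smul, Real.norm_of_nonneg (by positivity), Real.sqrt_mul (by positivity), hr]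
        congr 1
        rw [Real.sqrt_eq_iff_mul_self_eq (by positivity) (by positivity), ← mul_pow,
          Real.mul_self_sqrt (by norm_num)]
      calc (2 : ℝ) ^ n * ‖fwdDiff ((2⁻¹ : ℝ) ^ n • a) (fwdDiff ((2⁻¹ : ℝ) ^ n • b) F) x‖
          ≤ 2 ^ n * (K * ‖(2⁻¹ : ℝ) ^ n • a‖ * √‖(2⁻¹ : ℝ) ^ n • b‖) := by
            gcongr; exact hK _ _ _
        _ = (2 ^ n * 2⁻¹ ^ n) * (K * ‖a‖ * (r ^ n * √‖b‖)) := by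
            rw [hsq, norm_smul, Real.norm_of_nonneg (by positivity)]; ring
        _ = _ := by rw [← mul_pow]; norm_num
    have h1 := (hL (a + b)).sub ((hL a).add (hL b))
    exact sub_eq_zero.1 (tendsto_nhds_unique h1 h0)
  let A : X →+ Y := AddMonoidHom.mk' L hadd
  have hA : Continuous A := by
    refine AddMonoidHomClass.continuous_of_bound A M hLM
  -- The zeroth quotient is the increment itself, so the remainder is the full geometric tail; `1 /
  -- (1 - r) ≤ 4` since `r ≤ 3/4`.
  have hrem : ∀ a, ‖F (x + a) - F x - L a‖ ≤ 4 * K * ‖a‖ * √‖a‖ := by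
    intro a
    have h1 := dist_le_of_le_geometric_of_tendsto₀ r _ (by linarith) (hstep a) (hL a)
    have h2 : D a 0 = F (x + a) - F x := by simp [D, fwdDiff]
    rw [h2, dist_eq_norm] at h1
    refine h1.trans ?_
    rw [div_le_iff₀ (by linarith)]
    have : 0 ≤ K * ‖a‖ * √‖a‖ := by positivity
    nlinarith
  refine ⟨A.toRealLinearMap hA, ?_, hrem⟩
  rw [hasFDerivAt_iff_isLittleO_nhds_zero]
  rw [Asymptotics.isLittleO_iff]
  intro ε hε
  have hcont : Tendsto (fun a : X => 4 * K * √‖a‖) (𝓝 0) (𝓝 0) := by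
    have : Continuous fun a : X => 4 * K * √‖a‖ := by fun_prop
    simpa using this.tendsto 0
  filter_upwards [hcont.eventually (gt_mem_nhds hε)] with a ha
  refine (hrem a).trans ?_
  nlinarith [norm_nonneg a]

/-- The derivative in direction `a` is the limit of `c • Δ_{a/c} F`, so differences of the
derivative are limits of differences of `F` with one extra step, and bounds linear in that step
survive. -/
lemma norm_iterDiff_fderiv_le {F : X → Y} (hF : Differentiable ℝ F) {l : List X} {R : ℝ} {x : X}
    (hR : 0 ≤ R) (h : ∀ a, ‖iterDiff (a :: l) F x‖ ≤ R * ‖a‖) :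
    ‖iterDiff l (fderiv ℝ F) x‖ ≤ R := by
  refine ContinuousLinearMap.opNorm_le_bound _ hR fun a => ?_
  have h1 : ∀ x, Tendsto (fun c : ℝ => c • fwdDiff (c⁻¹ • a) F x) atTop (𝓝 (fderiv ℝ F x a)) :=
    fun x => (hF x).hasFDerivAt.lim_real a
  have h2 := tendsto_iterDiff h1 l x
  have h3 : iterDiff l (fun x => fderiv ℝ F x a) x = iterDiff l (fderiv ℝ F) x a :=
    congrFun (iterDiff_map l (fderiv ℝ F) (ContinuousLinearMap.apply ℝ Y a).toAddMonoidHom) x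
  rw [h3] at h2
  refine le_of_tendsto h2.norm ?_
  filter_upwards [eventually_gt_atTop 0] with c hc
  have h4 : iterDiff l (fun x => c • fwdDiff (c⁻¹ • a) F x) x =
      c • iterDiff (c⁻¹ • a :: l) F x := by
    rw [← iterDiff_fwdDiff]
    exact congrFun (iterDiff_map l (fwdDiff (c⁻¹ • a) F) (DistribSMul.toAddMonoidHom Y c)) x
  rw [h4, norm_smul, Real.norm_of_nonneg hc.le]
  calc c * ‖iterDiff (c⁻¹ • a :: l) F x‖ ≤ c * (R * ‖c⁻¹ • a‖) := by gcongr; exact h _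
    _ = R * ‖a‖ := by
      rw [norm_smul, Real.norm_of_nonneg (by positivity)]; field_simp

lemma hasFDerivAt_iterDiff {F : X → Y} (hF : Differentiable ℝ F) (l : List X) (x : X) :
    HasFDerivAt (iterDiff l F) (iterDiff l (fderiv ℝ F) x) x := by
  induction l generalizing x with
  | nil => exact (hF x).hasFDerivAt
  | cons a l ih => exact ((hasFDerivAt_comp_add_right a).2 (ih (x + a))).sub (ih x)

lemma norm_iterDiff_cons_le {F : X → Y} (hF : Differentiable ℝ F) {l : List X} {R : ℝ}
    (h : ∀ x, ‖iterDiff l (fderiv ℝ F) x‖ ≤ R) (a x : X) :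
    ‖iterDiff (a :: l) F x‖ ≤ R * ‖a‖ := by
  have := Convex.norm_image_sub_le_of_norm_hasFDerivWithin_le (s := univ) (f := iterDiff l F)
    (fun x _ => (hasFDerivAt_iterDiff hF l x).hasFDerivWithinAt) (fun x _ => h x) convex_univ
    (mem_univ x) (mem_univ (x + a))
  simpa [iterDiff_cons, fwdDiff] using this

/-- Currying is a linear isometry, hence commutes with differences and preserves norms. -/
lemma norm_iterDiff_iteratedFDeriv_succ (G : X → Y) (m : ℕ) (l : List X) (x : X) :
    ‖iterDiff l (iteratedFDeriv ℝ (m + 1) G) x‖ =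
      ‖iterDiff l (fderiv ℝ (iteratedFDeriv ℝ m G)) x‖ := by
  have h := congrFun (iterDiff_map l (fderiv ℝ (iteratedFDeriv ℝ m G))
    ((continuousMultilinearCurryLeftEquiv ℝ (fun _ : Fin (m + 1) => X) Y).symm).toAddEquiv.toAddMonoidHom) x
  rw [iteratedFDeriv_succ_eq_comp_left]
  refine (congrArg norm h).trans ?_
  exact (continuousMultilinearCurryLeftEquiv ℝ (fun _ : Fin (m + 1) => X) Y).symm.norm_map _

lemma norm_iterDiff_iteratedFDeriv_zero (G : X → Y) (l : List X) (x : X) :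
    ‖iterDiff l (iteratedFDeriv ℝ 0 G) x‖ = ‖iterDiff l G x‖ := by
  have h := congrFun (iterDiff_map l G
    (continuousMultilinearCurryFin0 ℝ X Y).symm.toAddEquiv.toAddMonoidHom) x
  rw [iteratedFDeriv_zero_eq_comp]
  refine (congrArg norm h).trans ?_
  exact (continuousMultilinearCurryFin0 ℝ X Y).symm.norm_map _

/-- Bounds for all differences of `G` up to a Zygmund bound for the differences of order `n`. -/
structure ZygBounds (n : ℕ) (M : ℝ) (G : X → Y) : Prop where
  diff : ∀ j ≤ n, DiffBound j M G
  zyg : ZygDiffBound n M G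

lemma ZygBounds.nonneg {n : ℕ} {M : ℝ} {G : X → Y} (h : ZygBounds n M G) : 0 ≤ M := by
  simpa using (norm_nonneg _).trans (h.diff 0 (Nat.zero_le _) [] rfl 0)

lemma ZygBounds.holder {n : ℕ} {M : ℝ} {G : X → Y} (h : ZygBounds n M G) {j : ℕ} (hj : j ≤ n) :
    HolderDiffBound j (4 * M) G := by
  rcases hj.lt_or_eq with hj | rfl
  · exact .of_succ (h.diff j hj.le) (h.diff (j + 1) hj) h.nonneg
  · exact .of_zyg (h.diff j le_rfl) h.zyg

lemma ZygBounds.continuous {n : ℕ} {M : ℝ} {G : X → Y} (h : ZygBounds n M G) : Continuous G := by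
  refine continuous_iff_continuousAt.2 fun x => ?_
  have h0 : Tendsto (fun y => 4 * M * √‖y - x‖) (𝓝 x) (𝓝 0) := by
    have : Continuous fun y => 4 * M * √‖y - x‖ := by fun_prop
    simpa using this.tendsto x
  refine tendsto_iff_norm_sub_tendsto_zero.2 (squeeze_zero (fun _ => norm_nonneg _) (fun y => ?_) h0)
  have := h.holder (Nat.zero_le n) [] rfl (y - x) x
  simpa [iterDiff_cons, fwdDiff] using this

lemma exists_hasFDerivAt_of_zygBounds [CompleteSpace Y] {n : ℕ} {M : ℝ} {G : X → Y}
    (h : ZygBounds (n + 1) M G) (x : X) : ∃ L : X →L[ℝ] Y, HasFDerivAt G L x ∧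
      ∀ a, ‖G (x + a) - G x - L a‖ ≤ 16 * M * ‖a‖ * √‖a‖ := by
  have hM := h.nonneg
  obtain ⟨L, h1, h2⟩ := exists_hasFDerivAt_of_diff_bounds (F := G) (M := M) (K := 4 * M)
    (fun a x => by simpa [iterDiff_cons] using h.diff 1 (by omega) [a] rfl x)
    (fun a b x => by
      simpa [iterDiff_cons] using h.holder (j := 1) (by omega) [a] rfl b x) (by positivity) x
  exact ⟨L, h1, fun a => (h2 a).trans_eq (by ring)⟩

/-- A derivative consumes one step and keeps the constant, so it can be iterated without loss. -/
lemma ZygBounds.fderivBounds [CompleteSpace Y] {n : ℕ} {M : ℝ} {G : X → Y}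
    (h : ZygBounds (n + 1) M G) : ZygBounds n M (fderiv ℝ G) := by
  have hM := h.nonneg
  have hd : Differentiable ℝ G := fun x =>
    (exists_hasFDerivAt_of_zygBounds h x).choose_spec.1.differentiableAt
  refine ⟨fun j hj l hl x => ?_, fun l hl b x => ?_⟩
  · have := normProd_nonneg l
    refine norm_iterDiff_fderiv_le hd (by positivity) fun a => ?_
    refine (h.diff (j + 1) (by omega) (a :: l) (by simp [hl]) x).trans_eq ?_
    rw [normProd_cons]; ring
  · have := normProd_nonneg l
    refine norm_iterDiff_fderiv_le hd (by positivity) fun a => ?_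
    refine (h.zyg (a :: l) (by simp [hl]) b x).trans_eq ?_
    rw [normProd_cons]; ring

lemma ZygBounds.iteratedBounds [CompleteSpace Y] {n : ℕ} {M : ℝ} {G : X → Y}
    (h : ZygBounds n M G) : ∀ {m j : ℕ}, m + j = n → ZygBounds j M (iteratedFDeriv ℝ m G) := by
  intro m
  induction m with
  | zero =>
    intro j hj
    obtain rfl : j = n := by omega
    refine ⟨fun i hi l hl x => ?_, fun l hl b x => ?_⟩
    · rw [norm_iterDiff_iteratedFDeriv_zero]; exact h.diff i hi l hl x
    · rw [norm_iterDiff_iteratedFDeriv_zero]; exact h.zyg l hl b x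
  | succ m ih =>
    intro j hj
    have h1 := (ih (j := j + 1) (by omega)).fderivBounds
    refine ⟨fun i hi l hl x => ?_, fun l hl b x => ?_⟩
    · rw [norm_iterDiff_iteratedFDeriv_succ]; exact h1.diff i hi l hl x
    · rw [norm_iterDiff_iteratedFDeriv_succ]; exact h1.zyg l hl b x

lemma supNorm_le_ofReal {F : X → Y} {M : ℝ} (h : ∀ x, ‖F x‖ ≤ M) :
    supNorm F ≤ ENNReal.ofReal M := iSup_le fun x => by
  rw [← ofReal_norm]; exact ENNReal.ofReal_le_ofReal (h x)

lemma norm_le_of_supNorm {F : X → Y} (h : supNorm F < ∞) (x : X) : ‖F x‖ ≤ (supNorm F).toReal := by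
  have h1 : ‖F x‖ₑ ≤ supNorm F := le_iSup (fun x => ‖F x‖ₑ) x
  simpa using ENNReal.toReal_mono h.ne h1

lemma zygmundSeminorm_le_ofReal {F : X → Y} {M : ℝ}
    (h : ∀ b x, ‖iterDiff [b, b] F x‖ ≤ M * ‖b‖) : zygmundSeminorm F ≤ ENNReal.ofReal M := by
  refine iSup_le fun x => iSup_le fun b => iSup_le fun hb => ?_
  have hb' : 0 < ‖b‖ := norm_pos_iff.2 hb
  refine ENNReal.div_le_of_le_mul ?_
  rw [← ofReal_norm, ← ofReal_norm, ← ENNReal.ofReal_mul' hb'.le]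
  refine ENNReal.ofReal_le_ofReal ((le_of_eq ?_).trans (h b x))
  congr 1
  simp only [iterDiff_cons, iterDiff_nil, fwdDiff, two_smul, ← add_assoc]
  abel

lemma norm_iterDiff_le_of_zygmundSeminorm {F : X → Y} (h : zygmundSeminorm F < ∞) (b x : X) :
    ‖iterDiff [b, b] F x‖ ≤ (zygmundSeminorm F).toReal * ‖b‖ := by
  rcases eq_or_ne b 0 with rfl | hb
  · simp [iterDiff_cons, fwdDiff]
  have h1 : ‖F (x + (2 : ℝ) • b) - (2 : ℝ) • F (x + b) + F x‖ₑ / ‖b‖ₑ ≤ zygmundSeminorm F :=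
    le_iSup_of_le x (le_iSup_of_le b (le_iSup_of_le hb le_rfl))
  have h2 := ENNReal.toReal_mono h.ne h1
  rw [ENNReal.toReal_div, toReal_enorm, toReal_enorm, div_le_iff₀ (norm_pos_iff.2 hb)] at h2
  refine (le_of_eq ?_).trans h2
  congr 1
  simp only [iterDiff_cons, iterDiff_nil, fwdDiff, two_smul, ← add_assoc]
  abel

/-- Difference bounds characterise the Zygmund spaces: the sufficient direction. -/
theorem ZygBounds.memZygmund {n : ℕ} {M : ℝ} {G : X → ℝ} (h : ZygBounds n M G) :
    MemZygmund (n + 1) G ∧ cnNorm n G ≤ ENNReal.ofReal ((n + 1) * M) ∧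
      zygmundNorm (n + 1) G ≤ ENNReal.ofReal ((n + 2) * M) := by
  have hM := h.nonneg
  have hb : ∀ j ≤ n, ∀ x, ‖iteratedFDeriv ℝ j G x‖ ≤ M := fun j hj x => by
    simpa using (h.iteratedBounds (m := j) (j := n - j) (by omega)).diff 0 (Nat.zero_le _) [] rfl x
  have hsup : ∀ j ≤ n, supNorm (iteratedFDeriv ℝ j G) ≤ ENNReal.ofReal M := fun j hj =>
    supNorm_le_ofReal (hb j hj)
  have hG : supNorm G ≤ ENNReal.ofReal M :=
    supNorm_le_ofReal fun x => by simpa using h.diff 0 (Nat.zero_le _) [] rfl x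
  have hn := h.iteratedBounds (m := n) (j := 0) (by omega)
  have hz : zygmundSeminorm (iteratedFDeriv ℝ n G) ≤ ENNReal.ofReal M :=
    zygmundSeminorm_le_ofReal fun b x => by simpa using hn.zyg [] rfl b x
  have hcn : cnNorm n G ≤ ENNReal.ofReal ((n + 1) * M) := by
    rw [cnNorm, add_mul, one_mul, ENNReal.ofReal_add (by positivity) hM, add_comm]
    refine add_le_add ?_ hG
    refine (Finset.sum_le_sum fun j hj => hsup j (Finset.mem_Icc.1 hj).2).trans_eq ?_
    rw [Finset.sum_const, Nat.card_Icc, Nat.add_sub_cancel, nsmul_eq_mul,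
      ENNReal.ofReal_mul (by positivity), ENNReal.ofReal_natCast]
  refine ⟨⟨⟨⟨h.continuous, hG.trans_lt ENNReal.ofReal_lt_top⟩, fun j hj => ?_, fun j hj => ?_⟩,
    ⟨hn.continuous, (hsup n le_rfl).trans_lt ENNReal.ofReal_lt_top⟩,
    hz.trans_lt ENNReal.ofReal_lt_top⟩, hcn, ?_⟩
  · have hj : j < n := hj
    -- The order `n - j` is displayed as a successor, because differentiability needs one spare
    -- step.
    have := h.iteratedBounds (m := j) (j := n - j - 1 + 1) (by omega)
    exact fun x => (exists_hasFDerivAt_of_zygBounds this x).choose_spec.1.differentiableAt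
  · exact (hsup j hj).trans_lt ENNReal.ofReal_lt_top
  · rw [zygmundNorm, Nat.add_sub_cancel]
    refine (add_le_add hcn hz).trans_eq ?_
    rw [← ENNReal.ofReal_add (by positivity) hM]
    congr 1; ring

/-- The mean value inequality trades derivatives back for steps, one at a time, while the steps `t`
ride along: `t = []` will give the plain bounds and `t = [b, b]` the Zygmund bound. -/
lemma norm_iterDiff_append_le {n : ℕ} {G : X → Y} {t : List X} {R : ℝ}
    (hd : ∀ j < n, Differentiable ℝ (iteratedFDeriv ℝ j G))
    (hR : ∀ x, ‖iterDiff t (iteratedFDeriv ℝ n G) x‖ ≤ R) :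
    ∀ (l : List X) (m : ℕ), m + l.length = n → ∀ x,
      ‖iterDiff (l ++ t) (iteratedFDeriv ℝ m G) x‖ ≤ R * normProd l := by
  intro l
  induction l with
  | nil =>
    intro m hm x
    obtain rfl : m = n := by simpa using hm
    simpa using hR x
  | cons a l ih =>
    intro m hm x
    rw [List.length_cons] at hm
    have h1 := norm_iterDiff_cons_le (hd m (by omega)) (l := l ++ t) (R := R * normProd l)
      (fun x => by rw [← norm_iterDiff_iteratedFDeriv_succ]; exact ih (m + 1) (by omega) x) a x
    rw [normProd_cons]
    exact h1.trans_eq (by ring)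

lemma supNorm_iteratedFDeriv_le_cnNorm {n j : ℕ} (hj : j ≤ n) (G : X → ℝ) :
    supNorm (iteratedFDeriv ℝ j G) ≤ cnNorm n G := by
  rcases Nat.eq_zero_or_pos j with rfl | h0
  · refine le_trans (le_of_eq ?_) le_self_add
    simp only [supNorm]
    congr 1; funext x
    rw [← ofReal_norm, norm_iteratedFDeriv_zero, ofReal_norm]
  · exact (Finset.single_le_sum (f := fun j => supNorm (iteratedFDeriv ℝ j G))
      (fun _ _ => zero_le) (Finset.mem_Icc.2 ⟨h0, hj⟩)).trans le_add_self

lemma MemZygmund.zygmundNorm_lt_top {n : ℕ} {G : X → ℝ} (h : MemZygmund (n + 1) G) :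
    zygmundNorm (n + 1) G < ∞ := by
  refine ENNReal.add_lt_top.2 ⟨ENNReal.add_lt_top.2 ⟨h.1.1.2, ?_⟩, h.2.2⟩
  exact ENNReal.sum_lt_top.2 fun j hj => h.1.2.2 j (Finset.mem_Icc.1 hj).2

/-- Difference bounds characterise the Zygmund spaces: the necessary direction. -/
theorem MemZygmund.zygBounds {n : ℕ} {G : X → ℝ} (h : MemZygmund (n + 1) G) :
    ZygBounds n (zygmundNorm (n + 1) G).toReal G := by
  have hfin := h.zygmundNorm_lt_top
  refine ⟨fun j hj l hl x => ?_, fun l hl b x => ?_⟩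
  · have := norm_iterDiff_append_le (n := j) (t := []) (G := G)
      (R := (zygmundNorm (n + 1) G).toReal) (fun i hi => h.1.2.1 i (lt_of_lt_of_le hi hj))
      (fun x => (norm_le_of_supNorm (h.1.2.2 j hj) x).trans (ENNReal.toReal_mono hfin.ne
        ((supNorm_iteratedFDeriv_le_cnNorm hj G).trans le_self_add))) l 0 (by simpa using hl) x
    rw [norm_iterDiff_iteratedFDeriv_zero] at this
    simpa using this
  · have := norm_iterDiff_append_le (n := n) (t := [b, b]) (G := G)
      (R := (zygmundNorm (n + 1) G).toReal * ‖b‖) (fun i hi => h.1.2.1 i hi)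
      (fun x => (norm_iterDiff_le_of_zygmundSeminorm h.2.2 b x).trans (mul_le_mul_of_nonneg_right
        (ENNReal.toReal_mono hfin.ne le_add_self) (norm_nonneg _))) l 0 (by simpa using hl) x
    rw [norm_iterDiff_iteratedFDeriv_zero] at this
    exact this.trans_eq (by ring)

end Smoothness

/-! ### Joint continuity of space derivatives -/

section Time

variable {X : Type*} [NormedAddCommGroup X] [NormedSpace ℝ X]

/-- Difference quotients of the derivative of order `j` are jointly continuous by induction. Their
remainder depends only on `M`, so they converge uniformly in `(s, x)` and the limit is continuous.
-/
lemma continuousOn_iteratedFDeriv_apply {n : ℕ} {M a b : ℝ} {v : ℝ → X → ℝ}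
    (hv : ContinuousOn (fun p : ℝ × X => v p.1 p.2) (Icc a b ×ˢ univ))
    (h : ∀ s ∈ Icc a b, ZygBounds n M (v s)) : ∀ {j : ℕ}, j ≤ n → ∀ w : Fin j → X,
      ContinuousOn (fun p : ℝ × X => iteratedFDeriv ℝ j (v p.1) p.2 w) (Icc a b ×ˢ univ) := by
  intro j
  induction j with
  | zero => intro _ w; simpa using hv
  | succ j ih =>
    intro hj w
    have hM : ∀ s ∈ Icc a b, 0 ≤ M := fun s hs => (h s hs).nonneg
    set D : ℝ × X → ℝ := fun p => iteratedFDeriv ℝ j (v p.1) p.2 (Fin.tail w)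
    have hD : ContinuousOn D (Icc a b ×ˢ univ) := ih (by omega) _
    refine TendstoUniformlyOn.continuousOn (p := atTop)
      (F := fun (c : ℝ) (p : ℝ × X) => c • (D (p.1, p.2 + c⁻¹ • w 0) - D p)) ?_
      (Eventually.frequently (Eventually.of_forall fun c => ?_))
    · rw [Metric.tendstoUniformlyOn_iff]
      intro ε hε
      have h0 : Tendsto (fun c : ℝ => 16 * M * (∏ i, ‖Fin.tail w i‖) * ‖w 0‖ * √(c⁻¹ * ‖w 0‖))
          atTop (𝓝 0) := by
        have : Tendsto (fun c : ℝ => √(c⁻¹ * ‖w 0‖)) atTop (𝓝 0) := by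
          have := (Real.continuous_sqrt.tendsto 0).comp
            (by simpa using (tendsto_inv_atTop_zero (𝕜 := ℝ)).mul_const ‖w 0‖)
          simpa [Function.comp_def] using this
        simpa using this.const_mul (16 * M * (∏ i, ‖Fin.tail w i‖) * ‖w 0‖)
      filter_upwards [h0.eventually (gt_mem_nhds hε), eventually_gt_atTop 0] with c hc hc0
      rintro ⟨s, x⟩ ⟨hs, -⟩
      obtain ⟨L, hL, hrem⟩ := exists_hasFDerivAt_of_zygBounds ((h s hs).iteratedBounds (m := j)
        (j := n - j - 1 + 1) (by omega)) x
      have hM0 := hM s hs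
      have h1 : iteratedFDeriv ℝ (j + 1) (v s) x w = L (w 0) (Fin.tail w) := by
        rw [iteratedFDeriv_succ_apply_left, hL.fderiv]
      rw [dist_comm, dist_eq_norm]
      simp only [D, h1]
      have h2 : c • (iteratedFDeriv ℝ j (v s) (x + c⁻¹ • w 0) (Fin.tail w) -
          iteratedFDeriv ℝ j (v s) x (Fin.tail w)) - L (w 0) (Fin.tail w) =
          c • ((iteratedFDeriv ℝ j (v s) (x + c⁻¹ • w 0) - iteratedFDeriv ℝ j (v s) x -
            L (c⁻¹ • w 0)) (Fin.tail w)) := by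
        simp only [sub_apply, map_smul,
          smul_apply, smul_eq_mul]
        field_simp
      rw [h2, norm_smul, Real.norm_of_nonneg hc0.le]
      refine lt_of_le_of_lt ?_ hc
      have hcw : ‖c⁻¹ • w 0‖ = c⁻¹ * ‖w 0‖ := by
        rw [norm_smul, Real.norm_of_nonneg (by positivity)]
      calc c * ‖(iteratedFDeriv ℝ j (v s) (x + c⁻¹ • w 0) - iteratedFDeriv ℝ j (v s) x -
            L (c⁻¹ • w 0)) (Fin.tail w)‖
          ≤ c * (16 * M * ‖c⁻¹ • w 0‖ * √‖c⁻¹ • w 0‖ * ∏ i, ‖Fin.tail w i‖) := by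
            gcongr
            exact (ContinuousMultilinearMap.le_opNorm _ _).trans (by gcongr; exact hrem _)
        _ = _ := by rw [hcw]; field_simp
    · refine (ContinuousOn.sub ?_ hD).const_smul c
      exact hD.comp (by fun_prop) fun p hp => ⟨hp.1, mem_univ _⟩

/-- Difference bounds, uniform in time, for a continuous function of time and space. -/
theorem memZygmundTime_of_zygBounds {n : ℕ} {M a b : ℝ} {v : ℝ → X → ℝ}
    (hv : ContinuousOn (fun p : ℝ × X => v p.1 p.2) (Icc a b ×ˢ univ))
    (h : ∀ s ∈ Icc a b, ZygBounds n M (v s)) :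
    MemZygmundTime a b (n + 1) v ∧
      zygmundNormTime a b (n + 1) v ≤ ENNReal.ofReal ((n + 2) * M) := by
  have hnorm : zygmundNormTime a b (n + 1) v ≤ ENNReal.ofReal ((n + 2) * M) :=
    iSup₂_le fun s hs => (h s hs).memZygmund.2.2
  have hcb : MemCbTime a b v := by
    refine ⟨hv, lt_of_le_of_lt (iSup₂_le fun s hs => ?_) (ENNReal.ofReal_lt_top (r := M))⟩
    exact supNorm_le_ofReal fun x => by simpa using (h s hs).diff 0 (Nat.zero_le _) [] rfl x
  refine ⟨⟨hcb, fun s hs => (h s hs).memZygmund.1, hnorm.trans_lt ENNReal.ofReal_lt_top,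
    fun _ => ⟨hcb, fun s hs => (h s hs).memZygmund.1.1, ?_, fun j hj w => ?_⟩⟩, hnorm⟩
  · exact lt_of_le_of_lt (iSup₂_le fun s hs => (h s hs).memZygmund.2.1) ENNReal.ofReal_lt_top
  · exact continuousOn_iteratedFDeriv_apply hv h hj w

end Time

/-! ### Square roots of positive operators -/

section SquareRoot

variable {X : Type*} [NormedAddCommGroup X] [InnerProductSpace ℝ X]

lemma isPositive_iff_real {Q : X →L[ℝ] X} :
    Q.IsPositive ↔ (∀ x y, ⟪Q x, y⟫_ℝ = ⟪x, Q y⟫_ℝ) ∧ ∀ x, 0 ≤ ⟪Q x, x⟫_ℝ := by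
  rw [ContinuousLinearMap.isPositive_iff]; rfl

/-- The Visser iteration for `1 - (1 - A) ^ (1 / 2)`. -/
noncomputable def visserIter (A : X →L[ℝ] X) : ℕ → X →L[ℝ] X
  | 0 => 0
  | n + 1 => (2⁻¹ : ℝ) • (A + visserIter A n * visserIter A n)

/-- The Visser iteration for the scalar `1`. -/
noncomputable def visserScalar : ℕ → ℝ
  | 0 => 0
  | n + 1 => 2⁻¹ * (1 + visserScalar n * visserScalar n)

lemma visserScalar_mem (n : ℕ) : 0 ≤ visserScalar n ∧ visserScalar n ≤ 1 := by
  induction n with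
  | zero => simp [visserScalar]
  | succ n ih => simp only [visserScalar]; constructor <;> nlinarith [ih.1, ih.2]

lemma norm_visserIter_le {A : X →L[ℝ] X} (hA : ‖A‖ ≤ 1) (n : ℕ) :
    ‖visserIter A n‖ ≤ visserScalar n := by
  induction n with
  | zero => simp [visserScalar, visserIter]
  | succ n ih =>
    simp only [visserIter, visserScalar, norm_smul, norm_inv, Real.norm_ofNat]
    gcongr
    refine (norm_add_le _ _).trans (add_le_add hA ((norm_mul_le _ _).trans ?_))
    exact mul_le_mul ih ih (norm_nonneg _) (visserScalar_mem n).1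

/-- The scalar iteration is a bounded majorant whose increments telescope; this makes the operator
iteration Cauchy in norm. -/
lemma norm_visserIter_sub_le {A : X →L[ℝ] X} (hA : ‖A‖ ≤ 1) (n : ℕ) :
    ‖visserIter A (n + 1) - visserIter A n‖ ≤ visserScalar (n + 1) - visserScalar n := by
  induction n with
  | zero =>
    have := norm_visserIter_le hA 1
    simpa [visserIter, visserScalar] using this
  | succ n ih =>
    set Y := visserIter A
    set s := visserScalar
    -- The splitting `Y² - Z² = Y (Y - Z) + (Y - Z) Z` needs no commutation.
    have h1 : Y (n + 2) - Y (n + 1) = (2⁻¹ : ℝ) •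
        (Y (n + 1) * (Y (n + 1) - Y n) + (Y (n + 1) - Y n) * Y n) := by
      change (2⁻¹ : ℝ) • (A + Y (n + 1) * Y (n + 1)) - (2⁻¹ : ℝ) • (A + Y n * Y n) = _
      rw [← smul_sub]; congr 1; noncomm_ring
    have h2 : s (n + 2) - s (n + 1) = 2⁻¹ *
        (s (n + 1) * (s (n + 1) - s n) + (s (n + 1) - s n) * s n) := by
      change 2⁻¹ * (1 + s (n + 1) * s (n + 1)) - 2⁻¹ * (1 + s n * s n) = _
      ring
    rw [h1, h2, norm_smul, norm_inv, Real.norm_ofNat]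
    have h3 := (norm_nonneg _).trans ih
    gcongr
    refine (norm_add_le _ _).trans (add_le_add ((norm_mul_le _ _).trans ?_)
      ((norm_mul_le _ _).trans ?_))
    · exact mul_le_mul (norm_visserIter_le hA _) ih (norm_nonneg _) (visserScalar_mem _).1
    · exact mul_le_mul ih (norm_visserIter_le hA _) (norm_nonneg _) h3

lemma visserIter_symm {A : X →L[ℝ] X} (hA : ∀ x y, ⟪A x, y⟫_ℝ = ⟪x, A y⟫_ℝ) (n : ℕ) (x y : X) :
    ⟪visserIter A n x, y⟫_ℝ = ⟪x, visserIter A n y⟫_ℝ := by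
  induction n generalizing x y with
  | zero => simp [visserIter]
  | succ n ih =>
    simp only [visserIter, smul_apply, add_apply,
      mul_apply_eq_comp, inner_smul_left, inner_smul_right, inner_add_left,
      inner_add_right, hA, ih]
    simp

/-- Nonnegativity of the quadratic form of `Q` at the point `x - q⁻¹ Q x`. -/
lemma norm_sq_le_of_isPositive {Q : X →L[ℝ] X} (hQ : Q.IsPositive) {q : ℝ} (hq : 0 < q)
    (hQq : ‖Q‖ ≤ q) (x : X) : ‖Q x‖ ^ 2 ≤ q * ⟪Q x, x⟫_ℝ := by
  obtain ⟨hs, hp⟩ := isPositive_iff_real.1 hQ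
  have h1 := hp (x - q⁻¹ • Q x)
  have h2 : ⟪Q (Q x), Q x⟫_ℝ ≤ q * ‖Q x‖ ^ 2 := by
    refine (real_inner_le_norm _ _).trans ?_
    rw [sq, ← mul_assoc]
    gcongr
    exact (Q.le_opNorm _).trans (by gcongr)
  simp only [map_sub, map_smul, inner_sub_left, inner_sub_right, inner_smul_left,
    inner_smul_right, hs (Q x) x, real_inner_self_eq_norm_sq, RCLike.conj_to_real] at h1
  have h3 : q⁻¹ * (q⁻¹ * ⟪Q (Q x), Q x⟫_ℝ) ≤ q⁻¹ * ‖Q x‖ ^ 2 := by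
    calc q⁻¹ * (q⁻¹ * ⟪Q (Q x), Q x⟫_ℝ) ≤ q⁻¹ * (q⁻¹ * (q * ‖Q x‖ ^ 2)) := by gcongr
      _ = q⁻¹ * ‖Q x‖ ^ 2 := by field_simp
  have h4 : q⁻¹ * ‖Q x‖ ^ 2 ≤ ⟪Q x, x⟫_ℝ := by
    rw [hs (Q x) (Q x), ← hs] at h3
    linarith
  rwa [inv_mul_le_iff₀ hq] at h4

variable [CompleteSpace X]

/-- With `A = 1 - Q / q` the iteration tends to a solution of `2 Y = A + Y²`, that is, `(1 - Y)² = Q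
/ q`. The approximating sequence is kept in the conclusion because it makes the root a measurable
function of a parameter in `Q`. -/
lemma exists_sqrt_tendsto {Q : X →L[ℝ] X} (hQ : Q.IsPositive) {q : ℝ} (hq : 0 < q)
    (hQq : ‖Q‖ ≤ q) : ∃ S : X →L[ℝ] X, S.IsPositive ∧ S ∘L S = Q ∧
      ∀ x, Tendsto (fun n => √q • (x - visserIter (1 - q⁻¹ • Q) n x)) atTop (𝓝 (S x)) := by
  obtain ⟨hs, hp⟩ := isPositive_iff_real.1 hQ
  set A : X →L[ℝ] X := 1 - q⁻¹ • Q with hA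
  have hA1 : ‖A‖ ≤ 1 := by
    refine ContinuousLinearMap.opNorm_le_bound _ zero_le_one fun x => ?_
    rw [one_mul]
    refine le_of_sq_le_sq ?_ (norm_nonneg _)
    have h1 := norm_sq_le_of_isPositive hQ hq hQq x
    have h2 : ‖A x‖ ^ 2 = ‖x‖ ^ 2 - 2 * (q⁻¹ * ⟪Q x, x⟫_ℝ) + q⁻¹ * (q⁻¹ * ‖Q x‖ ^ 2) := by
      change ‖x - q⁻¹ • Q x‖ ^ 2 = _
      rw [norm_sub_sq_real, inner_smul_right, real_inner_comm, norm_smul, mul_pow,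
        Real.norm_of_nonneg (by positivity)]
      ring
    have h3 : q⁻¹ * (q⁻¹ * ‖Q x‖ ^ 2) ≤ q⁻¹ * ⟪Q x, x⟫_ℝ := by
      gcongr; rwa [inv_mul_le_iff₀ hq]
    have h4 : 0 ≤ q⁻¹ * ⟪Q x, x⟫_ℝ := mul_nonneg (by positivity) (hp x)
    linarith
  have hAs : ∀ x y, ⟪A x, y⟫_ℝ = ⟪x, A y⟫_ℝ := fun x y => by
    simp [hA, inner_sub_left, inner_sub_right, inner_smul_left, inner_smul_right, hs]
  have hsum : Summable fun n => visserScalar (n + 1) - visserScalar n := by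
    refine summable_of_sum_range_le (c := 1)
      (fun n => (norm_nonneg _).trans (norm_visserIter_sub_le hA1 n)) fun n => ?_
    rw [Finset.sum_range_sub]
    have := (visserScalar_mem n).2
    simpa [visserScalar] using this
  have hcauchy : CauchySeq (visserIter A) := by
    refine cauchySeq_of_dist_le_of_summable _ (fun n => ?_) hsum
    rw [dist_comm, dist_eq_norm]
    exact norm_visserIter_sub_le hA1 n
  obtain ⟨Y, hY⟩ := cauchySeq_tendsto_of_complete hcauchy
  have hfix : Y = (2⁻¹ : ℝ) • (A + Y * Y) := by
    refine tendsto_nhds_unique ((tendsto_add_atTop_iff_nat 1).2 hY) ?_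
    exact ((hY.mul hY).const_add A).const_smul _
  have hY1 : ‖Y‖ ≤ 1 := le_of_tendsto hY.norm
    (Eventually.of_forall fun n => (norm_visserIter_le hA1 n).trans (visserScalar_mem n).2)
  have hYx : ∀ x, Tendsto (fun n => visserIter A n x) atTop (𝓝 (Y x)) := fun x =>
    ((ContinuousLinearMap.apply ℝ X x).continuous.tendsto Y).comp hY
  have hYs : ∀ x y, ⟪Y x, y⟫_ℝ = ⟪x, Y y⟫_ℝ := fun x y => by
    refine tendsto_nhds_unique ((hYx x).inner tendsto_const_nhds) ?_
    simp_rw [visserIter_symm hAs]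
    exact tendsto_const_nhds.inner (hYx y)
  refine ⟨√q • (1 - Y), isPositive_iff_real.2 ⟨fun x y => ?_, fun x => ?_⟩, ?_, fun x => ?_⟩
  · simp [inner_sub_left, inner_sub_right, inner_smul_left, inner_smul_right, hYs]
  · change 0 ≤ ⟪√q • (x - Y x), x⟫_ℝ
    simp only [inner_smul_left, inner_sub_left, real_inner_self_eq_norm_sq, RCLike.conj_to_real]
    have h1 : ⟪Y x, x⟫_ℝ ≤ ‖x‖ ^ 2 := by
      refine (real_inner_le_norm _ _).trans ?_
      rw [sq]; gcongr
      simpa using (Y.le_opNorm x).trans (mul_le_mul_of_nonneg_right hY1 (norm_nonneg _))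
    have := Real.sqrt_nonneg q
    nlinarith
  · change (√q • (1 - Y)) * (√q • (1 - Y)) = Q
    have h1 : (1 - Y) * (1 - Y) = q⁻¹ • Q := by
      have h2 : (2 : ℝ) • Y = A + Y * Y := by
        conv_lhs => rw [hfix]
        rw [smul_smul]; norm_num
      have h3 : (1 - Y) * (1 - Y) = 1 - (2 : ℝ) • Y + Y * Y := by
        rw [two_smul]; noncomm_ring
      rw [h3, h2, hA]; abel
    rw [smul_mul_smul_comm, h1, Real.mul_self_sqrt hq.le, smul_smul, mul_inv_cancel₀ hq.ne',
      one_smul]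
  · exact (tendsto_const_nhds.sub (hYx x)).const_smul _

/-- These two properties are all that is used of the chosen root; its uniqueness plays no role. -/
lemma opSqrt_spec {Q : X →L[ℝ] X} (hQ : Q.IsPositive) :
    (opSqrt Q).IsPositive ∧ opSqrt Q ∘L opSqrt Q = Q := by
  have h : ∃ S : X →L[ℝ] X, S.IsPositive ∧ S ∘L S = Q := by
    obtain ⟨S, h1, h2, -⟩ := exists_sqrt_tendsto hQ (q := ‖Q‖ + 1) (by positivity) (by linarith)
    exact ⟨S, h1, h2⟩
  rw [opSqrt, dif_pos h]
  exact h.choose_spec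

lemma pseudoInverse_spec {S : X →L[ℝ] X} {y : X} (hy : y ∈ range S) :
    pseudoInverse S y ∈ (LinearMap.ker (S : X →ₗ[ℝ] X))ᗮ ∧ S (pseudoInverse S y) = y := by
  have h : ∃ x, x ∈ (LinearMap.ker (S : X →ₗ[ℝ] X))ᗮ ∧ S x = y := by
    obtain ⟨x, rfl⟩ := hy
    have hc : IsClosed (LinearMap.ker (S : X →ₗ[ℝ] X) : Set X) := S.isClosed_ker
    have : CompleteSpace (LinearMap.ker (S : X →ₗ[ℝ] X)) := hc.completeSpace_coe
    set K := LinearMap.ker (S : X →ₗ[ℝ] X)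
    refine ⟨x - K.starProjection x, K.sub_starProjection_mem_orthogonal x, ?_⟩
    have : S (K.starProjection x) = 0 := K.starProjection_apply_mem x
    rw [map_sub, this, sub_zero]
  rw [pseudoInverse, dif_pos h]
  exact h.choose_spec

/-- If `x ⊥ range S` then `0 = ⟪S (S x), x⟫ = ‖S x‖²`, so `(range S)ᗮ ≤ ker S`; taking complements,
`(ker S)ᗮ` lies in the closure of the range. -/
lemma exists_tendsto_of_mem_orthogonal_ker {S : X →L[ℝ] X} (hS : S.IsPositive) {a : X}
    (ha : a ∈ (LinearMap.ker (S : X →ₗ[ℝ] X))ᗮ) :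
    ∃ b : ℕ → X, Tendsto (fun n => S (b n)) atTop (𝓝 a) := by
  have hs := (isPositive_iff_real.1 hS).1
  have h1 : a ∈ closure (range S) := by
    have h2 : (LinearMap.range (S : X →ₗ[ℝ] X))ᗮ ≤ LinearMap.ker (S : X →ₗ[ℝ] X) := by
      intro x hx
      rw [Submodule.mem_orthogonal] at hx
      have := hx (S (S x)) ⟨S x, rfl⟩
      rw [hs, real_inner_self_eq_norm_sq] at this
      simpa using this
    have h3 : a ∈ (LinearMap.range (S : X →ₗ[ℝ] X))ᗮᗮ := Submodule.orthogonal_le h2 ha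
    rw [Submodule.orthogonal_orthogonal_eq_closure, ← SetLike.mem_coe,
      Submodule.topologicalClosure_coe] at h3
    exact h3
  obtain ⟨u, hu, hlim⟩ := mem_closure_iff_seq_limit.1 h1
  choose b hb using hu
  exact ⟨b, by simpa [hb] using hlim⟩

end SquareRoot

/-! ### Gaussian measures as laws of random series -/

section GaussianExistence

open ProbabilityTheory Complex

variable {X : Type*} [NormedAddCommGroup X] [InnerProductSpace ℝ X]
  [MeasurableSpace X] [BorelSpace X] [SecondCountableTopology X]

/-- The product of standard Gaussian measures on `ι → ℝ`. -/
noncomputable def stdProd (ι : Type*) : Measure (ι → ℝ) :=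
  Measure.infinitePi fun _ : ι => gaussianReal 0 1

instance (ι : Type*) : IsProbabilityMeasure (stdProd ι) := by unfold stdProd; infer_instance

lemma stdProd_map_eval {ι : Type*} (i : ι) :
    (stdProd ι).map (fun ω => ω i) = gaussianReal 0 1 :=
  (measurePreserving_eval_infinitePi (fun _ : ι => gaussianReal 0 1) i).map_eq

lemma charFun_map_sum_smul {ι : Type*} (v : ι → X) (s : Finset ι) (t : X) :
    charFun ((stdProd ι).map fun ω => ∑ i ∈ s, ω i • v i) t =
      exp (-(∑ i ∈ s, ⟪v i, t⟫_ℝ ^ 2 : ℝ) / 2) := by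
  have hind : iIndepFun (fun (i : ι) (ω : ι → ℝ) => ω i • v i) (stdProd ι) :=
    iIndepFun_infinitePi (X := fun i (r : ℝ) => r • v i) fun i => by fun_prop
  rw [iIndepFun.charFun_map_fun_finsetSum_eq_prod (fun i _ => Measurable.aemeasurable (by fun_prop)) (hind.restrict _)]
  rw [Finset.prod_apply]
  have h1 : ∀ i, charFun ((stdProd ι).map fun ω => ω i • v i) t =
      exp (-(⟪v i, t⟫_ℝ ^ 2 : ℝ) / 2) := by
    intro i
    have h2 : charFun ((stdProd ι).map fun ω => ω i • v i) t =
        charFun (gaussianReal 0 1) ⟪v i, t⟫_ℝ := by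
      rw [← stdProd_map_eval i, charFun_apply, charFun_apply_real,
        integral_map (Measurable.aemeasurable (by fun_prop)) (by fun_prop), integral_map (Measurable.aemeasurable (by fun_prop)) (by fun_prop)]
      refine integral_congr_ae (ae_of_all _ fun ω => ?_)
      simp only [inner_smul_left, RCLike.conj_to_real]
      push_cast; ring_nf
    rw [h2, charFun_gaussianReal]
    congr 1; push_cast; ring
  simp_rw [h1]
  rw [← Complex.exp_sum]
  congr 1
  push_cast
  rw [← Finset.sum_div, Finset.sum_neg_distrib]

variable [CompleteSpace X]

/-- For independent standard `ω i` the vectors `ω i • v i` are orthogonal in `L²`, so their series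
converges there, and `μ` is the law of its sum. Convergence in measure implies weak convergence of
the partial sums, hence the characteristic function; the last clause is recorded for measurability
in a parameter. -/
lemma exists_charFun_eq {ι : Type*} [Countable ι] (v : ι → X) (hv : Summable fun i => ‖v i‖ ^ 2)
    (Q : X →L[ℝ] X) (hQ : ∀ t, HasSum (fun i => ⟪v i, t⟫_ℝ ^ 2) ⟪Q t, t⟫_ℝ) :
    ∃ μ : Measure X, IsProbabilityMeasure μ ∧
      (∀ t, charFun μ t = exp (-(⟪Q t, t⟫_ℝ : ℝ) / 2)) ∧
      ∀ (φ : X → ℝ) (A : ℝ), Continuous φ → (∀ x, ‖φ x‖ ≤ A) →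
        Tendsto (fun s : Finset ι => ∫ ω, φ (∑ i ∈ s, ω i • v i) ∂(stdProd ι)) atTop
          (𝓝 (∫ y, φ y ∂μ)) := by
  have hmem : ∀ i, MemLp (fun ω : ι → ℝ => ω i • v i) 2 (stdProd ι) := by
    intro i
    have h1 : MemLp (fun ω : ι → ℝ => ω i) 2 (stdProd ι) := by
      have h0 : MemLp id 2 ((stdProd ι).map fun ω : ι → ℝ => ω i) := by
        rw [stdProd_map_eval i]; exact memLp_id_gaussianReal' 2 (by norm_num)
      exact h0.comp_of_map (Measurable.aemeasurable (by fun_prop))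
    have h2 := ((ContinuousLinearMap.id ℝ ℝ).smulRight (v i)).comp_memLp' h1
    exact h2
  let e : ι → Lp X 2 (stdProd ι) := fun i => (hmem i).toLp _
  have hinner : ∀ i j, ⟪e i, e j⟫_ℝ = ⟪v i, v j⟫_ℝ * ∫ ω, ω i * ω j ∂(stdProd ι) := by
    intro i j
    rw [L2.inner_def, ← integral_const_mul]
    refine integral_congr_ae ?_
    filter_upwards [(hmem i).coeFn_toLp, (hmem j).coeFn_toLp] with ω h1 h2
    simp only [e, h1, h2, inner_smul_left, inner_smul_right, RCLike.conj_to_real]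
    ring
  have hij : ∀ i j, i ≠ j → ∫ ω, ω i * ω j ∂(stdProd ι) = 0 := by
    intro i j hij
    have hind : iIndepFun (fun (i : ι) (ω : ι → ℝ) => ω i) (stdProd ι) :=
      iIndepFun_infinitePi (X := fun i (r : ℝ) => r) fun i => by fun_prop
    have h0 : ∀ i, ∫ ω, ω i ∂(stdProd ι) = 0 := by
      intro i
      have := integral_map (μ := stdProd ι) (φ := fun ω : ι → ℝ => ω i) (f := fun x : ℝ => x)
        (Measurable.aemeasurable (by fun_prop)) (by fun_prop)
      rw [← this, stdProd_map_eval, integral_id_gaussianReal]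
    have := (hind.indepFun hij).integral_fun_mul_eq_mul_integral
      (Measurable.aestronglyMeasurable (by fun_prop)) (Measurable.aestronglyMeasurable (by fun_prop))
    rw [this, h0, zero_mul]
  have hii : ∀ i, ∫ ω, ω i * ω i ∂(stdProd ι) = 1 := by
    intro i
    have h1 := integral_map (μ := stdProd ι) (φ := fun ω : ι → ℝ => ω i)
      (f := fun x : ℝ => x * x) (Measurable.aemeasurable (by fun_prop)) (by fun_prop)
    rw [← h1, stdProd_map_eval]
    have h2 := variance_fun_id_gaussianReal (μ := 0) (v := 1)
    rw [variance_eq_integral (by fun_prop), integral_id_gaussianReal] at h2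
    simpa [sq] using h2
  have hnorm : ∀ i, ‖e i‖ ^ 2 = ‖v i‖ ^ 2 := by
    intro i
    rw [← real_inner_self_eq_norm_sq, hinner, hii, mul_one, real_inner_self_eq_norm_sq]
  -- Passing to the spanned lines avoids normalising the `e i`, some of which may vanish.
  have horth : OrthogonalFamily ℝ (fun i => (Submodule.span ℝ {e i} : Submodule ℝ _))
      fun i => (Submodule.span ℝ {e i}).subtypeₗᵢ := by
    intro i j h x y
    obtain ⟨a, ha⟩ := Submodule.mem_span_singleton.1 x.2
    obtain ⟨b, hb⟩ := Submodule.mem_span_singleton.1 y.2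
    change ⟪(x : Lp X 2 (stdProd ι)), (y : Lp X 2 (stdProd ι))⟫_ℝ = 0
    rw [← ha, ← hb, inner_smul_left, inner_smul_right, hinner, hij i j h]
    simp
  have hsum : Summable e := by
    have := (horth.summable_iff_norm_sq_summable
      (fun i => ⟨e i, Submodule.mem_span_singleton_self _⟩)).2 ?_
    · exact this
    · refine hv.congr fun i => ?_
      rw [← hnorm]; rfl
  obtain ⟨Y, hY⟩ := hsum
  have hYm : TendstoInMeasure (stdProd ι) (fun (s : Finset ι) ω => ∑ i ∈ s, ω i • v i) atTop Y := by
    have h1 := tendstoInMeasure_of_tendsto_Lp hY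
    refine h1.congr_left fun s => ?_
    have h2 : ∀ s : Finset ι, ⇑(∑ i ∈ s, e i) =ᵐ[stdProd ι] fun ω => ∑ i ∈ s, e i ω := fun s => by
      filter_upwards [Lp.coeFn_finsetSum s e] with ω h
      rw [h, Finset.sum_apply]
    have h3 : ∀ᵐ ω ∂(stdProd ι), ∀ i ∈ s, e i ω = ω i • v i := by
      exact (ae_ball_iff s.countable_toSet).2 fun i _ => (hmem i).coeFn_toLp
    filter_upwards [h2 s, h3] with ω h4 h5
    rw [h4]; exact Finset.sum_congr rfl h5
  have hd := hYm.tendstoInDistribution fun s => Measurable.aemeasurable (by fun_prop)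
  have hprob : IsProbabilityMeasure ((stdProd ι).map Y) :=
    Measure.isProbabilityMeasure_map hd.aemeasurable_limit
  refine ⟨(stdProd ι).map Y, hprob, fun t => ?_, fun φ A hφ hA => ?_⟩
  swap
  · have h1 := (ProbabilityMeasure.tendsto_iff_forall_integral_tendsto).1 hd.tendsto
      (BoundedContinuousFunction.ofNormedAddCommGroup φ hφ A hA)
    refine h1.congr fun s => ?_
    exact integral_map (Measurable.aemeasurable (by fun_prop)) hφ.aestronglyMeasurable
  have h1 := (ProbabilityMeasure.tendsto_iff_forall_integral_rclike_tendsto ℂ).1 hd.tendsto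
    (BoundedContinuousFunction.innerProbChar t)
  have h2 : Tendsto (fun s : Finset ι =>
      charFun ((stdProd ι).map fun ω => ∑ i ∈ s, ω i • v i) t) atTop
      (𝓝 (charFun ((stdProd ι).map Y) t)) := by
    simp_rw [charFun_eq_integral_innerProbChar]; exact h1
  refine tendsto_nhds_unique h2 ?_
  simp_rw [charFun_map_sum_smul]
  have h3 : Continuous fun r : ℝ => exp (-(r : ℂ) / 2) := by fun_prop
  exact (h3.tendsto _).comp (hQ t)

end GaussianExistence

/-! ### Existence, uniqueness and translation of Gaussian measures -/

section GaussianBasic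

open ProbabilityTheory

variable {X : Type*} [NormedAddCommGroup X] [InnerProductSpace ℝ X] [CompleteSpace X]
  [MeasurableSpace X] [BorelSpace X] [SecondCountableTopology X]

/-- `μ` is a probability measure whose characteristic function is the one of `N_{0,Q}`. -/
structure HasGaussCharFun (Q : X →L[ℝ] X) (μ : Measure X) : Prop where
  prob : IsProbabilityMeasure μ
  charFun_eq : ∀ t, charFun μ t = Complex.exp (-(⟪Q t, t⟫_ℝ : ℝ) / 2)

lemma HasGaussCharFun.isGaussianWith {Q : X →L[ℝ] X} {μ : Measure X} (hQ : Q.IsPositive)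
    (h : HasGaussCharFun Q μ) (m : X) : IsGaussianWith m Q (μ.map (m + ·)) := by
  have := h.prob
  have hP : IsProbabilityMeasure (μ.map (m + ·)) :=
    Measure.isProbabilityMeasure_map (by fun_prop)
  let F : X →L[ℝ] X →L[ℝ] ℝ := (innerSL ℝ).comp Q
  have hF : ∀ x y, F x y = ⟪Q x, y⟫_ℝ := fun x y => rfl
  obtain ⟨hs, hp⟩ := isPositive_iff_real.1 hQ
  have hpos : F.toBilinForm.IsPosSemidef :=
    ⟨⟨fun x y => by
      simp only [ContinuousLinearMap.toBilinForm_apply, hF]; exact (hs x y).trans (real_inner_comm _ _)⟩, ⟨fun x => by simpa [hF] using hp x⟩⟩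
  have hc : ∀ t, charFun (μ.map (m + ·)) t =
      Complex.exp (⟪t, m⟫_ℝ * Complex.I - F t t / 2) := by
    intro t
    rw [charFun_map_const_add, h.charFun_eq, ← Complex.exp_add, hF, real_inner_comm m t]
    congr 1; ring
  refine ⟨isGaussian_iff_gaussian_charFun.2 ⟨m, F, hpos, hc⟩, ?_, fun x y => ?_⟩
  · exact (gaussian_charFun_congr m F hpos hc).1.symm
  · rw [← (gaussian_charFun_congr m F hpos hc).2, hF]

/-- Basis vectors are at mutual distance `√2`, so the balls of radius `1/2` around them are disjoint
open sets in a separable space. -/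
lemma _root_.HilbertBasis.countable_index {ι : Type*} (b : HilbertBasis ι ℝ X) :
    Countable ι := by
  have hd : Pairwise fun i j => Disjoint (Metric.ball (b i) (1 / 2)) (Metric.ball (b j) (1 / 2)) := by
    intro i j hij
    refine Metric.ball_disjoint_ball ?_
    have h1 : ‖b i - b j‖ ^ 2 = 2 := by
      rw [norm_sub_sq_real, b.orthonormal.1, b.orthonormal.1, b.orthonormal.2 hij]; norm_num
    rw [dist_eq_norm]
    nlinarith [norm_nonneg (b i - b j)]
  exact hd.countable_of_isOpen_disjoint (fun i => Metric.isOpen_ball)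
    fun i => ⟨b i, Metric.mem_ball_self (by norm_num)⟩

lemma norm_sq_of_comp_self {S Q : X →L[ℝ] X} (hS : S.IsPositive) (hSQ : S ∘L S = Q) (x : X) :
    ‖S x‖ ^ 2 = ⟪Q x, x⟫_ℝ := by
  rw [← hSQ, ← real_inner_self_eq_norm_sq, (isPositive_iff_real.1 hS).1]
  exact real_inner_comm _ _

lemma hasSum_inner_sq_of_comp_self {ι : Type*} (b : HilbertBasis ι ℝ X) {S Q : X →L[ℝ] X}
    (hS : S.IsPositive) (hSQ : S ∘L S = Q) (t : X) :
    HasSum (fun i => ⟪S (b i), t⟫_ℝ ^ 2) ⟪Q t, t⟫_ℝ := by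
  rw [← norm_sq_of_comp_self hS hSQ, ← real_inner_self_eq_norm_sq]
  refine (b.hasSum_inner_mul_inner (S t) (S t)).congr_fun ?_
  intro i
  rw [(isPositive_iff_real.1 hS).1, sq, real_inner_comm (b i) (S t)]

/-- The series is built on `v i = Q^{1/2} b i`: its squared norms sum to the trace and the squares
of its pairings with `t` to `⟪Q t, t⟫`. -/
lemma IsPositiveTraceClass.exists_hasGaussCharFun {Q : X →L[ℝ] X} (hQ : IsPositiveTraceClass Q) :
    ∃ μ, HasGaussCharFun Q μ := by
  obtain ⟨hQ, w, b, hb⟩ := hQ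
  have := b.countable_index
  obtain ⟨hS, hSQ⟩ := opSqrt_spec hQ
  obtain ⟨μ, h1, h2, -⟩ := exists_charFun_eq (fun i => opSqrt Q (b i))
    (hb.congr fun i => (norm_sq_of_comp_self hS hSQ _).symm) Q
    (hasSum_inner_sq_of_comp_self b hS hSQ)
  exact ⟨μ, h1, h2⟩

lemma IsGaussianWith.hasGaussCharFun {Q : X →L[ℝ] X} {μ : Measure X} (h : IsGaussianWith 0 Q μ) :
    HasGaussCharFun Q μ := by
  have := h.1
  refine ⟨inferInstance, fun t => ?_⟩
  rw [IsGaussian.charFun_eq', h.2.2]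
  have : μ[id] = 0 := h.2.1
  rw [this]; simp [neg_div]

lemma HasGaussCharFun.unique {Q : X →L[ℝ] X} {μ ν : Measure X} (h : HasGaussCharFun Q μ)
    (h' : HasGaussCharFun Q ν) : μ = ν := by
  have := h.prob
  have := h'.prob
  exact Measure.ext_of_charFun (funext fun t => by rw [h.charFun_eq, h'.charFun_eq])

lemma IsPositiveTraceClass.gaussian_spec {Q : X →L[ℝ] X} (hQ : IsPositiveTraceClass Q) (m : X) :
    IsGaussianWith m Q (gaussian m Q) := by
  obtain ⟨μ, hμ⟩ := hQ.exists_hasGaussCharFun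
  have h : ∃ μ : Measure X, IsGaussianWith m Q μ := ⟨_, hμ.isGaussianWith hQ.1 m⟩
  rw [gaussian, dif_pos h]
  exact h.choose_spec

lemma IsPositiveTraceClass.hasGaussCharFun {Q : X →L[ℝ] X} (hQ : IsPositiveTraceClass Q) :
    HasGaussCharFun Q (gaussian 0 Q) := (hQ.gaussian_spec 0).hasGaussCharFun

lemma IsPositiveTraceClass.gaussian_eq_map {Q : X →L[ℝ] X} (hQ : IsPositiveTraceClass Q) (m : X) :
    gaussian m Q = (gaussian 0 Q).map (m + ·) := by
  have h1 := hQ.gaussian_spec m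
  have h2 := hQ.hasGaussCharFun.isGaussianWith hQ.1 m
  have := h1.1
  have := h2.1
  refine IsGaussian.ext (h1.2.1.trans h2.2.1.symm) ?_
  ext x y
  rw [h1.2.2, h2.2.2]

lemma IsPositiveTraceClass.integral_gaussian {Q : X →L[ℝ] X} (hQ : IsPositiveTraceClass Q) (m : X)
    {φ : X → ℝ} (hφ : Continuous φ) :
    ∫ y, φ y ∂(gaussian m Q) = ∫ y, φ (m + y) ∂(gaussian 0 Q) := by
  rw [hQ.gaussian_eq_map m, integral_map (by fun_prop) hφ.aestronglyMeasurable]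

end GaussianBasic

/-! ### Gaussian shifts: reduction to one dimension -/

section Smoothing

open ProbabilityTheory

/-- The shifted law has density `e^{x - q/2}` with respect to `N(0, q)`, whose `L¹` distance to `1`
is at most `√(e^q - 1) ≤ 2 √q` when `q ≤ 1`. For `q > 1` the trivial bound `2 A` suffices. -/
lemma abs_integral_gaussianReal_shift_le {q : ℝ≥0} (hq : q ≠ 0) {f : ℝ → ℝ} (hf : Continuous f)
    {A : ℝ} (hA : ∀ x, |f x| ≤ A) :
    |∫ x, f (x + q) ∂(gaussianReal 0 q) - ∫ x, f x ∂(gaussianReal 0 q)| ≤ 2 * √q * A := by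
  have hq0 : (0 : ℝ) < q := by positivity
  have hA0 : 0 ≤ A := (abs_nonneg _).trans (hA 0)
  have hint : ∀ c : ℝ, Integrable (fun x => f (x + c)) (gaussianReal 0 q) := fun c =>
    Integrable.of_bound (by fun_prop) A (ae_of_all _ fun x => hA _)
  rcases le_or_gt (q : ℝ) 1 with h1 | h1
  swap
  · have h2 : 1 ≤ √(q : ℝ) := Real.one_le_sqrt.2 h1.le
    have h3 : ∀ c : ℝ, |∫ x, f (x + c) ∂(gaussianReal 0 q)| ≤ A := fun c => by
      simpa using norm_integral_le_of_norm_le_const (μ := gaussianReal 0 q)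
        (ae_of_all _ fun x => (Real.norm_eq_abs _).trans_le (hA (x + c)))
    have h4 := h3 q
    have h5 := h3 0
    simp only [add_zero] at h5
    refine (abs_sub _ _).trans ?_
    nlinarith
  set g : ℝ → ℝ := fun x => Real.exp (x - q / 2) - 1 with hg
  have hexp : ∀ t : ℝ, Integrable (fun x => Real.exp (t * x)) (gaussianReal 0 q) :=
    integrable_exp_mul_gaussianReal
  have hmgf : ∀ t : ℝ, ∫ x, Real.exp (t * x) ∂(gaussianReal 0 q) = Real.exp (q * t ^ 2 / 2) := by
    intro t
    have := congrFun (mgf_fun_id_gaussianReal (μ := 0) (v := q)) t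
    simpa [mgf] using this
  have hgsq : ∀ x, g x ^ 2 = Real.exp (-q) * Real.exp (2 * x) -
      2 * Real.exp (-(q / 2)) * Real.exp (1 * x) + 1 := by
    intro x
    have e1 : Real.exp (x - q / 2) = Real.exp (-(q / 2)) * Real.exp (1 * x) := by
      rw [← Real.exp_add]; congr 1; ring
    have e2 : Real.exp (x - q / 2) ^ 2 = Real.exp (-q) * Real.exp (2 * x) := by
      rw [← Real.exp_add, ← Real.exp_nat_mul]; congr 1; push_cast; ring
    simp only [hg]
    rw [sub_sq, e2, e1]; ring
  have hgsq_int : Integrable (fun x => g x ^ 2) (gaussianReal 0 q) := by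
    simp_rw [hgsq]
    exact (((hexp 2).const_mul _).sub ((hexp 1).const_mul _)).add (integrable_const _)
  have hgsq_val : ∫ x, g x ^ 2 ∂(gaussianReal 0 q) = Real.exp q - 1 := by
    simp_rw [hgsq]
    have e3 : Integrable (fun x => Real.exp (-q) * Real.exp (2 * x)) (gaussianReal 0 q) :=
      (hexp 2).const_mul _
    have e4 : Integrable (fun x => 2 * Real.exp (-(q / 2)) * Real.exp (1 * x))
      (gaussianReal 0 q) := (hexp 1).const_mul _
    have e5 : Integrable (fun x => Real.exp (-q) * Real.exp (2 * x) -
      2 * Real.exp (-(q / 2)) * Real.exp (1 * x)) (gaussianReal 0 q) := e3.sub e4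
    rw [integral_add e5 (integrable_const _), integral_sub e3 e4, integral_const_mul,
      integral_const_mul, hmgf, hmgf, ← Real.exp_add, mul_assoc, ← Real.exp_add]
    have e1 : -(q : ℝ) + q * 2 ^ 2 / 2 = q := by ring
    have e2 : -((q : ℝ) / 2) + q * 1 ^ 2 / 2 = 0 := by ring
    rw [e1, e2]; simp; ring
  have hgm : AEStronglyMeasurable g (gaussianReal 0 q) := by
    apply Continuous.aestronglyMeasurable; fun_prop
  have hg2 : MemLp g 2 (gaussianReal 0 q) := (memLp_two_iff_integrable_sq hgm).2 hgsq_int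
  have hg1 : Integrable g (gaussianReal 0 q) := hg2.integrable (by norm_num)
  have hl1 : ∫ x, |g x| ∂(gaussianReal 0 q) ≤ 2 * √q := by
    -- Nonnegativity of this variance is the Cauchy–Schwarz inequality `(∫ |g|)² ≤ ∫ g²`.
    have hv := variance_nonneg (fun x => |g x|) (gaussianReal 0 q)
    rw [variance_eq_sub (by simpa using hg2.norm)] at hv
    simp only [Pi.pow_apply, sq_abs, hgsq_val] at hv
    have he : Real.exp q - 1 ≤ 4 * q := by
      have := Real.abs_exp_sub_one_sub_id_le (x := (q : ℝ)) (by rw [abs_of_pos hq0]; exact h1)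
      have := (abs_le.1 this).2
      nlinarith
    have h5 : (∫ x, |g x| ∂(gaussianReal 0 q)) ^ 2 ≤ 4 * q := by linarith
    have h6 : (2 * √(q : ℝ)) ^ 2 = 4 * q := by rw [mul_pow, Real.sq_sqrt hq0.le]; norm_num
    rw [← h6] at h5
    exact le_of_sq_le_sq h5 (by positivity)
  have hshift : ∫ x, f (x + q) ∂(gaussianReal 0 q) =
      ∫ x, Real.exp (x - q / 2) * f x ∂(gaussianReal 0 q) := by
    have h2 := integral_map (μ := gaussianReal 0 q) (φ := fun x => x + (q : ℝ)) (f := f)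
      (by fun_prop) hf.aestronglyMeasurable
    rw [← h2, gaussianReal_map_add_const, integral_gaussianReal_eq_integral_smul hq,
      integral_gaussianReal_eq_integral_smul hq]
    refine integral_congr_ae (ae_of_all _ fun x => ?_)
    simp only [gaussianPDFReal, smul_eq_mul]
    rw [← mul_assoc, mul_assoc _ (Real.exp _) (Real.exp _), ← Real.exp_add]
    congr 3
    field_simp; ring
  have hint2 : Integrable (fun x => Real.exp (x - q / 2) * f x) (gaussianReal 0 q) := by
    have h2 : Integrable (fun x => Real.exp (x - q / 2)) (gaussianReal 0 q) := by
      refine (hg1.add (integrable_const 1)).congr (ae_of_all _ fun x => ?_)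
      simp [hg]
    exact h2.mul_bdd (c := A) hf.aestronglyMeasurable (ae_of_all _ hA)
  rw [hshift, ← integral_sub hint2 (by simpa using hint 0)]
  rw [← Real.norm_eq_abs]
  calc ‖∫ x, (Real.exp (x - q / 2) * f x - f x) ∂(gaussianReal 0 q)‖
      ≤ ∫ x, |g x| * A ∂(gaussianReal 0 q) := by
        refine norm_integral_le_of_norm_le (hg1.abs.mul_const A) (ae_of_all _ fun x => ?_)
        rw [← sub_one_mul, Real.norm_eq_abs, abs_mul]
        exact mul_le_mul_of_nonneg_left (hA x) (abs_nonneg _)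
    _ ≤ _ := by rw [integral_mul_const]; gcongr

variable {X : Type*} [NormedAddCommGroup X] [InnerProductSpace ℝ X] [CompleteSpace X]
  [MeasurableSpace X] [BorelSpace X] [SecondCountableTopology X]

/-- The coordinate `⟪b, y⟫` has variance `q` and is uncorrelated with `y - (⟪b, y⟫ / q) Q b`, so the
two parts are independent. On characteristic functions this is completing the square. -/
lemma HasGaussCharFun.conv_line {Q : X →L[ℝ] X} (hQ : Q.IsPositive) {μ : Measure X}
    (h : HasGaussCharFun Q μ) (b : X) (q : ℝ≥0) (hq : q ≠ 0) (hqb : (q : ℝ) = ⟪Q b, b⟫_ℝ) :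
    μ = (μ.map fun y => y - (⟪b, y⟫_ℝ / q) • Q b) ∗
      ((gaussianReal 0 q).map fun r : ℝ => (r / (q : ℝ)) • Q b) := by
  have := h.prob
  have hP : IsProbabilityMeasure (μ.map fun y => y - (⟪b, y⟫_ℝ / q) • Q b) :=
    Measure.isProbabilityMeasure_map (by fun_prop)
  have hP' : IsProbabilityMeasure ((gaussianReal 0 q).map fun r : ℝ => (r / (q : ℝ)) • Q b) :=
    Measure.isProbabilityMeasure_map (by fun_prop)
  have hq0 : (q : ℝ) ≠ 0 := by exact_mod_cast hq
  obtain ⟨hs, hp⟩ := isPositive_iff_real.1 hQ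
  refine Measure.ext_of_charFun (funext fun t => ?_)
  rw [charFun_conv]
  set c : ℝ := ⟪Q b, t⟫_ℝ / q with hc
  have h1 : charFun (μ.map fun y => y - (⟪b, y⟫_ℝ / q) • Q b) t = charFun μ (t - c • b) := by
    rw [charFun_apply, integral_map (by fun_prop) (by fun_prop), charFun_apply]
    refine integral_congr_ae (ae_of_all _ fun y => ?_)
    have : ⟪y - (⟪b, y⟫_ℝ / q) • Q b, t⟫_ℝ = ⟪y, t - c • b⟫_ℝ := by
      rw [inner_sub_left, inner_sub_right, inner_smul_left, inner_smul_right, hc,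
        real_inner_comm y b]
      simp; ring
    simp only [this]
  have h2 : charFun ((gaussianReal 0 q).map fun r : ℝ => (r / (q : ℝ)) • Q b) t =
      charFun (gaussianReal 0 q) c := by
    rw [charFun_apply, integral_map (by fun_prop) (by fun_prop), charFun_apply_real]
    refine integral_congr_ae (ae_of_all _ fun y => ?_)
    simp only [inner_smul_left, hc, RCLike.conj_to_real]
    push_cast
    congr 2; ring
  rw [h1, h2, h.charFun_eq, h.charFun_eq, charFun_gaussianReal, ← Complex.exp_add]
  congr 1
  have h3 : ⟪Q (t - c • b), t - c • b⟫_ℝ = ⟪Q t, t⟫_ℝ - q * c ^ 2 := by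
    have e1 : ⟪Q t, b⟫_ℝ = q * c := by
      rw [hs, real_inner_comm, hc]; field_simp
    have e2 : ⟪Q b, t⟫_ℝ = q * c := by rw [hc]; field_simp
    simp only [map_sub, map_smul, inner_sub_left, inner_sub_right, inner_smul_left,
      inner_smul_right, e1, e2, ← hqb, RCLike.conj_to_real]
    ring
  rw [h3]; push_cast; ring

/-- Translating the Gaussian measure `N_{0,Q}` in a direction in the range of `Q`. -/
lemma HasGaussCharFun.abs_integral_shift_le {Q : X →L[ℝ] X} (hQ : Q.IsPositive) {μ : Measure X}
    (h : HasGaussCharFun Q μ) (b : X) {φ : X → ℝ} (hφ : Continuous φ) {A : ℝ}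
    (hA : ∀ x, |φ x| ≤ A) :
    |∫ y, φ (y + Q b) ∂μ - ∫ y, φ y ∂μ| ≤ 2 * √⟪Q b, b⟫_ℝ * A := by
  have := h.prob
  have hp := (isPositive_iff_real.1 hQ).2
  have hA0 : 0 ≤ A := (abs_nonneg _).trans (hA 0)
  rcases (hp b).eq_or_lt with h0 | h0
  -- In the degenerate case `⟪Q b, b⟫ = 0` the shift `Q b` itself vanishes.
  · have h1 := norm_sq_le_of_isPositive hQ (q := ‖Q‖ + 1) (by positivity) (by linarith) b
    rw [← h0, mul_zero] at h1
    have : Q b = 0 := by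
      rw [← norm_eq_zero]; exact pow_eq_zero_iff (two_ne_zero) |>.1 (le_antisymm h1 (by positivity))
    simp [this]
  obtain ⟨q, hqb⟩ : ∃ q : ℝ≥0, (q : ℝ) = ⟪Q b, b⟫_ℝ := ⟨⟨_, hp b⟩, rfl⟩
  have hq : q ≠ 0 := by rintro rfl; simp at hqb; linarith
  have hq0 : (q : ℝ) ≠ 0 := by exact_mod_cast hq
  set ν := μ.map fun y => y - (⟪b, y⟫_ℝ / q) • Q b
  have hν : IsProbabilityMeasure ν := Measure.isProbabilityMeasure_map (by fun_prop)
  have hP' : IsProbabilityMeasure ((gaussianReal 0 q).map fun r : ℝ => (r / (q : ℝ)) • Q b) :=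
    Measure.isProbabilityMeasure_map (by fun_prop)
  have key : ∀ f : X → ℝ, Continuous f → (∀ x, |f x| ≤ A) →
      ∫ y, f y ∂μ = ∫ z, ∫ r, f (z + (r / q) • Q b) ∂(gaussianReal 0 q) ∂ν := by
    intro f hf hfA
    rw [h.conv_line hQ b q hq hqb, integral_conv
      (Integrable.of_bound hf.aestronglyMeasurable A (ae_of_all _ hfA))]
    refine integral_congr_ae (ae_of_all _ fun z => ?_)
    exact integral_map (by fun_prop) (by fun_prop)
  have hcont : ∀ f : X → ℝ, Continuous f → (∀ x, |f x| ≤ A) →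
      Integrable (fun z => ∫ r, f (z + (r / q) • Q b) ∂(gaussianReal 0 q)) ν := by
    intro f hf hfA
    have hm : StronglyMeasurable fun p : X × ℝ => f (p.1 + (p.2 / q) • Q b) := by
      apply Continuous.stronglyMeasurable; fun_prop
    refine Integrable.of_bound hm.integral_prod_right'.aestronglyMeasurable A
      (ae_of_all _ fun z => ?_)
    simpa using norm_integral_le_of_norm_le_const (μ := gaussianReal 0 q)
      (ae_of_all _ fun r => (Real.norm_eq_abs _).trans_le (hfA (z + (r / q) • Q b)))
  have hφ' : Continuous fun y => φ (y + Q b) := by fun_prop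
  rw [key _ hφ' (fun x => hA _), key φ hφ hA,
    ← integral_sub (hcont _ hφ' (fun x => hA _)) (hcont φ hφ hA)]
  rw [← Real.norm_eq_abs]
  refine (norm_integral_le_of_norm_le_const (C := 2 * √⟪Q b, b⟫_ℝ * A)
    (ae_of_all _ fun z => ?_)).trans_eq (by rw [probReal_univ, mul_one])
  have h2 := abs_integral_gaussianReal_shift_le hq (f := fun r => φ (z + (r / q) • Q b))
    (by fun_prop) (fun r => hA _)
  rw [← hqb]
  refine le_trans (le_of_eq ?_) h2
  rw [Real.norm_eq_abs]
  congr 2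
  refine integral_congr_ae (ae_of_all _ fun r => ?_)
  -- On this line, translation by `Q b` is translation of the real parameter by its variance `q`.
  have : ((r + (q : ℝ)) / q) • Q b = (r / q) • Q b + Q b := by
    rw [add_div, div_self hq0, add_smul, one_smul]
  simp only [this, add_assoc]

end Smoothing

/-! ### Gaussian smoothing of differences of any order -/

section Smoothing

open ProbabilityTheory

variable {X : Type*} [NormedAddCommGroup X] [InnerProductSpace ℝ X] [CompleteSpace X]
  [MeasurableSpace X] [BorelSpace X] [SecondCountableTopology X]

/-- Translating the Gaussian measure `N_{0,Q}` in a direction of its Cameron–Martin space. -/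
lemma HasGaussCharFun.abs_integral_shift_sqrt_le {S Q : X →L[ℝ] X} (hS : S.IsPositive)
    (hSQ : S ∘L S = Q) (hQ : Q.IsPositive) {μ : Measure X} (h : HasGaussCharFun Q μ) {a : X}
    (ha : a ∈ (LinearMap.ker (S : X →ₗ[ℝ] X))ᗮ) {φ : X → ℝ} (hφ : Continuous φ) {A : ℝ}
    (hA : ∀ x, |φ x| ≤ A) :
    |∫ y, φ (y + S a) ∂μ - ∫ y, φ y ∂μ| ≤ 2 * ‖a‖ * A := by
  have := h.prob
  -- For `a = S b` the shift is `Q b`, and `⟪Q b, b⟫^{1/2} = ‖S b‖`; such `a` are dense in `(ker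
  -- S)ᗮ`.
  obtain ⟨b, hb⟩ := exists_tendsto_of_mem_orthogonal_ker hS ha
  have h1 : ∀ n, |∫ y, φ (y + S (S (b n))) ∂μ - ∫ y, φ y ∂μ| ≤ 2 * ‖S (b n)‖ * A := by
    intro n
    have h2 := h.abs_integral_shift_le hQ (b n) hφ hA
    rw [← norm_sq_of_comp_self hS hSQ, Real.sqrt_sq (norm_nonneg _), ← hSQ] at h2
    exact h2
  refine le_of_tendsto_of_tendsto' (Tendsto.abs (Tendsto.sub_const ?_ _))
    ((hb.norm.const_mul 2).mul_const A) h1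
  refine tendsto_integral_of_dominated_convergence (fun _ => A)
    (fun n => Continuous.aestronglyMeasurable (by fun_prop)) (integrable_const _)
    (fun n => ae_of_all _ fun y => hA _) (ae_of_all _ fun y => ?_)
  exact (hφ.tendsto _).comp (tendsto_const_nhds.add ((S.continuous.tendsto a).comp hb))

/-- The average of the translates of `φ` by the points of `c • y`, `y` distributed by `μ`. -/
noncomputable def smear (μ : Measure X) (c : ℝ) (φ : X → ℝ) (z : X) : ℝ := ∫ y, φ (z + c • y) ∂μ

variable {μ : Measure X} {c A : ℝ} {φ : X → ℝ}

lemma integrable_smear [IsProbabilityMeasure μ] (hφ : Continuous φ) (hA : ∀ x, |φ x| ≤ A) (z : X) :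
    Integrable (fun y => φ (z + c • y)) μ :=
  Integrable.of_bound (Continuous.aestronglyMeasurable (by fun_prop)) A (ae_of_all _ fun x => hA _)

lemma abs_smear_le [IsProbabilityMeasure μ] (hA : ∀ x, |φ x| ≤ A) (z : X) :
    |smear μ c φ z| ≤ A := by
  simpa [smear] using norm_integral_le_of_norm_le_const (μ := μ)
    (ae_of_all _ fun y => (Real.norm_eq_abs _).trans_le (hA (z + c • y)))

lemma continuous_smear [IsProbabilityMeasure μ] (hφ : Continuous φ) (hA : ∀ x, |φ x| ≤ A) :
    Continuous (smear μ c φ) :=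
  continuous_of_dominated (fun z => (integrable_smear hφ hA z).aestronglyMeasurable)
    (fun z => ae_of_all _ fun y => hA _) (integrable_const A)
    (ae_of_all _ fun y => by fun_prop)

lemma iterDiff_smear [IsProbabilityMeasure μ] (hφ : Continuous φ) (hA : ∀ x, |φ x| ≤ A)
    (l : List X) : iterDiff l (smear μ c φ) = smear μ c (iterDiff l φ) := by
  have h := (iterDiff_integral (μ := μ) (F := fun y z => φ (z + c • y))
    (fun z => integrable_smear hφ hA z) l).2
  have h2 : ∀ y, iterDiff l (fun z => φ (z + c • y)) = fun z => iterDiff l φ (z + c • y) := by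
    intro y
    simpa using iterDiff_comp_add l (AddMonoidHom.id X) (c • y) φ
  simp only [h2] at h
  exact h

lemma iterate_smear_spec [IsProbabilityMeasure μ] (hφ : Continuous φ) (hA : ∀ x, |φ x| ≤ A)
    (n : ℕ) : Continuous ((smear μ c)^[n] φ) ∧ ∀ x, |(smear μ c)^[n] φ x| ≤ A := by
  induction n with
  | zero => exact ⟨hφ, hA⟩
  | succ n ih =>
    rw [Function.iterate_succ']
    exact ⟨continuous_smear ih.1 ih.2, abs_smear_le ih.2⟩

lemma HasGaussCharFun.map_smul {Q : X →L[ℝ] X} (h : HasGaussCharFun Q μ) (c : ℝ) :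
    HasGaussCharFun (c ^ 2 • Q) (μ.map (c • ·)) := by
  have := h.prob
  refine ⟨Measure.isProbabilityMeasure_map (by fun_prop), fun t => ?_⟩
  rw [charFun_map_smul, h.charFun_eq]
  congr 3
  simp [inner_smul_left, inner_smul_right]; ring

lemma HasGaussCharFun.conv {Q R : X →L[ℝ] X} {ν : Measure X} (h : HasGaussCharFun Q μ)
    (h' : HasGaussCharFun R ν) : HasGaussCharFun (Q + R) (μ ∗ ν) := by
  have := h.prob
  have := h'.prob
  refine ⟨inferInstance, fun t => ?_⟩
  rw [charFun_conv, h.charFun_eq, h'.charFun_eq, ← Complex.exp_add]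
  congr 1
  simp [inner_add_left]; ring

lemma HasGaussCharFun.iterate_smear {Q : X →L[ℝ] X} (h : HasGaussCharFun Q μ) (c : ℝ) (n : ℕ) :
    ∃ ν, HasGaussCharFun ((n * c ^ 2) • Q) ν ∧ ∀ φ : X → ℝ, Continuous φ → ∀ A, (∀ x, |φ x| ≤ A) →
      (smear μ c)^[n] φ = smear ν 1 φ := by
  have := h.prob
  induction n with
  | zero =>
    refine ⟨Measure.dirac 0, ⟨inferInstance, fun t => by simp⟩, fun φ hφ A hA => ?_⟩
    funext z
    simp [smear]
  | succ n ih =>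
    obtain ⟨ν, hν, h1⟩ := ih
    have := hν.prob
    have hc := h.map_smul c
    have hcp := hc.prob
    have h2 := (hν.conv hc)
    refine ⟨ν ∗ (μ.map (c • ·)), ?_, fun φ hφ A hA => ?_⟩
    · convert h2 using 1
      rw [← add_smul]; push_cast; ring_nf
    · have h3 := continuous_smear (μ := μ) (c := c) hφ hA
      rw [Function.iterate_succ, Function.comp_apply, h1 _ h3 A (abs_smear_le hA)]
      funext z
      have := h2.prob
      simp only [smear, one_smul]
      rw [integral_conv (Integrable.of_bound (by fun_prop) A (ae_of_all _ fun x => hA _))]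
      refine integral_congr_ae (ae_of_all _ fun y => ?_)
      simp only
      rw [integral_map (by fun_prop) (by fun_prop)]
      simp only [add_assoc]

lemma HasGaussCharFun.smear_one_eq_iterate {Q : X →L[ℝ] X} (h : HasGaussCharFun Q μ) {n : ℕ}
    (hn : n ≠ 0) (hφ : Continuous φ) (hA : ∀ x, |φ x| ≤ A) :
    smear μ 1 φ = (smear μ (√n)⁻¹)^[n] φ := by
  obtain ⟨ν, hν, h1⟩ := h.iterate_smear (√n)⁻¹ n
  have h2 : (n : ℝ) * ((√n)⁻¹) ^ 2 = 1 := by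
    rw [inv_pow, Real.sq_sqrt (by positivity)]; field_simp
  rw [h2, one_smul] at hν
  rw [h1 φ hφ A hA, h.unique hν]

/-- With `n` steps, averaging by `μ` is the `n`-fold iterate of averaging at scale `c = n^{-1/2}`,
and each iterate absorbs one step. At that scale the shift `S a` is `c • S (c⁻¹ • a)`, which costs
`2 √n ‖a‖`. -/
lemma HasGaussCharFun.abs_iterDiff_smear_le {S Q : X →L[ℝ] X} (hS : S.IsPositive)
    (hSQ : S ∘L S = Q) (hQ : Q.IsPositive) (h : HasGaussCharFun Q μ) (l : List X)
    (hl : ∀ a ∈ l, a ∈ (LinearMap.ker (S : X →ₗ[ℝ] X))ᗮ) (hφ : Continuous φ)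
    (hA : ∀ x, |φ x| ≤ A) (z : X) :
    |iterDiff (l.map S) (smear μ 1 φ) z| ≤ (2 * √l.length) ^ l.length * normProd l * A := by
  have := h.prob
  rcases Nat.eq_zero_or_pos l.length with h0 | h0
  · rw [List.length_eq_zero_iff] at h0
    subst h0
    simpa using abs_smear_le (μ := μ) (c := 1) hA z
  rw [h.smear_one_eq_iterate h0.ne' hφ hA]
  have hc : 0 < (√(l.length : ℝ))⁻¹ := by positivity
  set c := (√(l.length : ℝ))⁻¹ with hcdef
  have hci : √(l.length : ℝ) = c⁻¹ := by rw [hcdef, inv_inv]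
  rw [hci]
  -- The scale stays fixed while the list shrinks, so its link with the length is forgotten before
  -- the induction.
  clear_value c
  clear h0 hci hcdef
  induction l generalizing z with
  | nil => simpa using hA z
  | cons a l ih =>
    have ih := fun z => ih (fun a ha => hl a (List.mem_cons_of_mem _ ha)) z
    obtain ⟨h1, h2⟩ := iterate_smear_spec (μ := μ) (c := c) hφ hA l.length
    simp only [List.map_cons, iterDiff_cons, List.length_cons, Function.iterate_succ',
      Function.comp_apply]
    rw [iterDiff_smear h1 h2]
    have h3 := h.abs_integral_shift_sqrt_le hS hSQ hQ (a := c⁻¹ • a)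
      (Submodule.smul_mem _ _ (hl a List.mem_cons_self))
      (φ := fun y => iterDiff (l.map S) ((smear μ c)^[l.length] φ) (z + c • y))
      ((continuous_iterDiff h1 _).comp (by fun_prop)) (fun y => ih _)
    have h4 : ∀ y, z + c • (y + S (c⁻¹ • a)) = z + S a + c • y := by
      intro y
      rw [_root_.map_smul, smul_add, smul_inv_smul₀ hc.ne']; abel
    simp only [h4] at h3
    refine h3.trans_eq ?_
    rw [norm_smul, Real.norm_of_nonneg (inv_nonneg.2 hc.le), normProd_cons]
    ring

end Smoothing

/-! ### Tightness and weak convergence of Gaussian measures -/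

section Weak

open ProbabilityTheory

variable {X : Type*} [NormedAddCommGroup X] [InnerProductSpace ℝ X] [CompleteSpace X]
  [MeasurableSpace X] [BorelSpace X] [SecondCountableTopology X]

lemma IsPositiveTraceClass.sub {Q R : X →L[ℝ] X} (hQ : IsPositiveTraceClass Q)
    (hR : R.IsPositive) (hQR : (Q - R).IsPositive) : IsPositiveTraceClass (Q - R) := by
  obtain ⟨-, w, b, hb⟩ := hQ
  refine ⟨hQR, w, b, hb.of_nonneg_of_le (fun i => (isPositive_iff_real.1 hQR).2 _) fun i => ?_⟩
  have := (isPositive_iff_real.1 hR).2 (b i)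
  simp only [_root_.sub_apply, inner_sub_left]
  linarith

lemma HasGaussCharFun.map_neg {Q : X →L[ℝ] X} {μ : Measure X} (h : HasGaussCharFun Q μ) :
    μ.map (fun y => -y) = μ := by
  have h1 := h.map_smul (-1)
  simp only [neg_smul, one_smul, even_two, Even.neg_pow, one_pow] at h1
  exact h1.unique h

/-- The centered Gaussian measures with covariance dominated by `Q` are uniformly tight. -/
lemma IsPositiveTraceClass.exists_isCompact {Q : X →L[ℝ] X} (hQ : IsPositiveTraceClass Q)
    {ε : ℝ≥0∞} (hε : 0 < ε) :
    ∃ K : Set X, IsCompact K ∧ ∀ (R : X →L[ℝ] X) (μ : Measure X), R.IsPositive →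
      (Q - R).IsPositive → HasGaussCharFun R μ → μ Kᶜ ≤ ε := by
  have hp := hQ.hasGaussCharFun.prob
  obtain ⟨K, hK, hKε⟩ := isTightMeasureSet_iff_exists_isCompact_measure_compl_le.1
    (isTightMeasureSet_singleton (μ := gaussian 0 Q)) (ε / 2) (ENNReal.half_pos hε.ne')
  have hKε := hKε _ rfl
  -- Let `ξ` have law `N_{0,R}` and let `η`, independent of it, have law `N_{0,Q-R}`. By symmetry of
  -- `η`, both `ξ + η` and `ξ - η` have law `N_{0,Q}`, and `ξ` is half their sum.
  refine ⟨(fun p : X × X => (1 / 2 : ℝ) • (p.1 + p.2)) '' (K ×ˢ K),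
    (hK.prod hK).image (by fun_prop), fun R μ hR hQR hμ => ?_⟩
  obtain ⟨ν, hν⟩ := (hQ.sub hR hQR).exists_hasGaussCharFun
  have := hμ.prob
  have := hν.prob
  have e1 : (μ.prod ν).map (fun p => p.1 + p.2) = gaussian 0 Q := by
    have h1 := hμ.conv hν
    rw [add_sub_cancel] at h1
    exact h1.unique hQ.hasGaussCharFun
  have e2 : (μ.prod ν).map (fun p => p.1 - p.2) = gaussian 0 Q := by
    rw [← e1]
    conv_rhs => rw [← hν.map_neg, ← Measure.map_id (μ := μ)]
    rw [Measure.map_prod_map _ _ (by fun_prop) (by fun_prop), Measure.map_map (by fun_prop)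
      (by fun_prop)]
    congr 1
    funext p; simp [sub_eq_add_neg]
  have hKm := hK.measurableSet.compl
  calc μ ((fun p : X × X => (1 / 2 : ℝ) • (p.1 + p.2)) '' (K ×ˢ K))ᶜ
      = μ.prod ν (((fun p : X × X => (1 / 2 : ℝ) • (p.1 + p.2)) '' (K ×ˢ K))ᶜ ×ˢ univ) := by
        rw [Measure.prod_prod]; simp
    _ ≤ μ.prod ν ((fun p => p.1 + p.2) ⁻¹' Kᶜ ∪ (fun p => p.1 - p.2) ⁻¹' Kᶜ) := by
        refine measure_mono fun p hp => ?_
        by_contra hcon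
        simp only [mem_union, mem_preimage, mem_compl_iff, not_or, not_not] at hcon
        refine hp.1 ⟨(_, _), hcon, ?_⟩
        simp only [add_add_sub_cancel, ← two_smul ℝ p.1, smul_smul]
        norm_num
    _ ≤ ε / 2 + ε / 2 := by
        refine (measure_union_le _ _).trans (add_le_add ?_ ?_)
        · rwa [← Measure.map_apply (by fun_prop) hKm, e1]
        · rwa [← Measure.map_apply (by fun_prop) hKm, e2]
    _ = ε := ENNReal.add_halves ε

-- Convergence of characteristic functions alone does not give weak convergence in infinite
-- dimensions; the domination of all `R n` by `Q₀` supplies the missing tightness.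
open scoped Pointwise in
lemma tendsto_integral_gauss {Q₀ Q : X →L[ℝ] X} (hQ₀ : IsPositiveTraceClass Q₀)
    {R : ℕ → X →L[ℝ] X} {μ : ℕ → Measure X} {μ₀ : Measure X} (hR : ∀ n, (R n).IsPositive)
    (hR' : ∀ n, (Q₀ - R n).IsPositive) (hμ : ∀ n, HasGaussCharFun (R n) (μ n))
    (hμ₀ : HasGaussCharFun Q μ₀) (hlim : ∀ x, Tendsto (fun n => ⟪R n x, x⟫_ℝ) atTop (𝓝 ⟪Q x, x⟫_ℝ))
    {m : ℕ → X} {m₀ : X} (hm : Tendsto m atTop (𝓝 m₀)) {φ : X → ℝ} (hφ : Continuous φ) {A : ℝ}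
    (hA : ∀ x, |φ x| ≤ A) :
    Tendsto (fun n => ∫ y, φ (m n + y) ∂(μ n)) atTop (𝓝 (∫ y, φ (m₀ + y) ∂μ₀)) := by
  have h0 := hμ₀.prob
  have hn := fun n => (hμ n).prob
  let ν : ℕ → ProbabilityMeasure X := fun n =>
    ⟨(μ n).map (m n + ·), Measure.isProbabilityMeasure_map (by fun_prop)⟩
  let ν₀ : ProbabilityMeasure X :=
    ⟨μ₀.map (m₀ + ·), Measure.isProbabilityMeasure_map (by fun_prop)⟩
  have hchar : ∀ t, Tendsto (fun n => charFun (ν n : Measure X) t) atTop (𝓝 (charFun (ν₀ : Measure X) t)) := by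
    intro t
    simp only [ν, ν₀, ProbabilityMeasure.coe_mk, charFun_map_const_add, hμ₀.charFun_eq,
      (hμ _).charFun_eq]
    have h1 : Tendsto (fun n => ⟪m n, t⟫_ℝ) atTop (𝓝 ⟪m₀, t⟫_ℝ) := hm.inner tendsto_const_nhds
    have h2 := hlim t
    have h3 := (Complex.continuous_ofReal.tendsto _).comp h1
    have h4 := (Complex.continuous_ofReal.tendsto _).comp h2
    exact ((Complex.continuous_exp.tendsto _).comp (h4.neg.div_const 2)).mul
      ((Complex.continuous_exp.tendsto _).comp (h3.mul_const Complex.I))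
  have htight : IsTightMeasureSet {((ν n : ProbabilityMeasure X) : Measure X) | n} := by
    rw [isTightMeasureSet_iff_exists_isCompact_measure_compl_le]
    intro ε hε
    obtain ⟨K, hK, hKε⟩ := hQ₀.exists_isCompact hε
    refine ⟨insert m₀ (range m) + K, hm.isCompact_insert_range.add hK, ?_⟩
    rintro _ ⟨n, rfl⟩
    simp only [ν, ProbabilityMeasure.coe_mk]
    rw [Measure.map_apply (by fun_prop)
      (hm.isCompact_insert_range.add hK).measurableSet.compl]
    refine (measure_mono (t := Kᶜ) ?_).trans (hKε (R n) (μ n) (hR n) (hR' n) (hμ n))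
    exact fun y hy hyK => hy (Set.add_mem_add (Or.inr ⟨n, rfl⟩) hyK)
  have hw : Tendsto ν atTop (𝓝 ν₀) :=
    ProbabilityMeasure.tendsto_of_tight_of_separatesPoints ℂ htight
      (A := BoundedContinuousFunction.charPoly Real.continuous_probChar (L := innerₗ X)
        continuous_inner)
      (BoundedContinuousFunction.separatesPoints_charPoly Real.continuous_probChar Real.probChar_ne_one _ fun v hv =>
        DFunLike.ne_iff.mpr ⟨v, inner_self_ne_zero.mpr hv⟩)
      (fun g hg => ProbabilityMeasure.tendsto_charPoly_of_tendsto_charFun hchar hg)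
  rw [ProbabilityMeasure.tendsto_iff_forall_integral_tendsto] at hw
  have h := hw (BoundedContinuousFunction.ofNormedAddCommGroup φ hφ A hA)
  simpa [ν, ν₀, integral_map, hφ.aestronglyMeasurable, (measurable_const_add _).aemeasurable]
    using h

end Weak

/-! ### Measurable dependence on a parameter -/

section OperatorMeasurability

variable {X : Type*} [NormedAddCommGroup X] [InnerProductSpace ℝ X] [CompleteSpace X]
  [MeasurableSpace X] [BorelSpace X] [SecondCountableTopology X]
  {Ω : Type*} [MeasurableSpace Ω]

lemma measurable_of_hilbertBasis {ι : Type*} (b : HilbertBasis ι ℝ X) {g : Ω → X}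
    (hg : ∀ i, Measurable fun ω => ⟪b i, g ω⟫_ℝ) : Measurable g := by
  have := b.countable_index
  refine measurable_of_tendsto_metrizable' atTop
    (f := fun (s : Finset ι) ω => ∑ i ∈ s, ⟪b i, g ω⟫_ℝ • b i) (fun s => ?_) ?_
  · exact Finset.measurable_fun_sum s fun i _ => (hg i).smul_const _
  · refine tendsto_pi_nhds.2 fun ω => ?_
    have := b.hasSum_repr (g ω)
    simp only [b.repr_apply_apply] at this
    exact this

lemma measurable_of_inner {g : Ω → X} (hg : ∀ y, Measurable fun ω => ⟪y, g ω⟫_ℝ) :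
    Measurable g := by
  obtain ⟨w, b, -⟩ := exists_hilbertBasis ℝ X
  exact measurable_of_hilbertBasis b fun i => hg _

lemma measurable_apply_apply {A : Ω → X →L[ℝ] X} (hA : ∀ x, Measurable fun ω => A ω x) {g : Ω → X}
    (hg : Measurable g) : Measurable fun ω => A ω (g ω) := by
  have h := measurable_uncurry_of_continuous_of_measurable (u := fun (x : X) (ω : Ω) => A ω x)
    (fun ω => (A ω).continuous) hA
  exact h.comp (hg.prodMk measurable_id)

lemma measurable_adjoint_apply {A : Ω → X →L[ℝ] X} (hA : ∀ x, Measurable fun ω => A ω x) (x : X) :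
    Measurable fun ω => ContinuousLinearMap.adjoint (A ω) x := by
  refine measurable_of_inner fun y => ?_
  simp only [ContinuousLinearMap.adjoint_inner_right]
  exact (hA y).inner_const

lemma measurable_visserIter {A : Ω → X →L[ℝ] X} (hA : ∀ x, Measurable fun ω => A ω x) (n : ℕ)
    (x : X) : Measurable fun ω => visserIter (A ω) n x := by
  induction n generalizing x with
  | zero => simp [visserIter]
  | succ n ih =>
    have h1 := measurable_apply_apply ih (ih x)
    simp only [visserIter, smul_apply, add_apply, mul_apply_eq_comp]
    exact ((hA x).add h1).const_smul _

lemma ofReal_norm_sq_eq_tsum {κ : Type*} (e : HilbertBasis κ ℝ X) (x : X) :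
    ENNReal.ofReal (‖x‖ ^ 2) = ∑' j, ENNReal.ofReal (⟪x, e j⟫_ℝ ^ 2) := by
  have h1 := e.hasSum_inner_mul_inner x x
  rw [real_inner_self_eq_norm_sq] at h1
  have h2 : HasSum (fun j => ⟪x, e j⟫_ℝ ^ 2) (‖x‖ ^ 2) := by
    refine h1.congr_fun fun j => ?_
    rw [real_inner_comm x, sq]
  rw [← h2.tsum_eq, ENNReal.ofReal_tsum_of_nonneg (fun j => sq_nonneg _) h2.summable]

/-- Both sums equal the double sum of `⟪S (b i), e j⟫²`, as `S` is symmetric. The basis witnessing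
finite trace may vary with the parameter, whereas the random series needs a fixed one. -/
lemma summable_norm_sq_basis {ι κ : Type*} (b : HilbertBasis ι ℝ X) (e : HilbertBasis κ ℝ X)
    {S : X →L[ℝ] X} (hS : S.IsPositive) (h : Summable fun i => ‖S (b i)‖ ^ 2) :
    Summable fun j => ‖S (e j)‖ ^ 2 := by
  have h1 : ∑' j, ENNReal.ofReal (‖S (e j)‖ ^ 2) = ∑' i, ENNReal.ofReal (‖S (b i)‖ ^ 2) := by
    simp only [ofReal_norm_sq_eq_tsum b (S (e _)), ofReal_norm_sq_eq_tsum e (S (b _))]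
    rw [ENNReal.tsum_comm]
    refine tsum_congr fun i => tsum_congr fun j => ?_
    rw [(isPositive_iff_real.1 hS).1, real_inner_comm]
  have h2 := ENNReal.summable_toReal (h1.trans_ne h.tsum_ofReal_ne_top)
  simpa [ENNReal.toReal_ofReal] using h2

-- The Gaussian integral is a limit of integrals over finitely many standard normal coordinates with
-- coefficients `S ω (b i)`. Each of these is measurable by Fubini, since the root `S ω` is a
-- pointwise limit of polynomials in `Q ω`.
open ProbabilityTheory in
lemma measurable_integral_gauss {Q : Ω → X →L[ℝ] X} (hQ : ∀ ω, IsPositiveTraceClass (Q ω))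
    (hQm : ∀ x, Measurable fun ω => Q ω x) {q : ℝ} (hq : 0 < q) (hQq : ∀ ω, ‖Q ω‖ ≤ q)
    {m : Ω → X} (hm : Measurable m) {F : Ω → X → ℝ} (hF : Measurable (Function.uncurry F))
    (hFc : ∀ ω, Continuous (F ω)) {A : ℝ} (hA : ∀ ω x, |F ω x| ≤ A) :
    Measurable fun ω => ∫ y, F ω (m ω + y) ∂(gaussian 0 (Q ω)) := by
  choose S hS hSQ hSlim using fun ω => exists_sqrt_tendsto (hQ ω).1 hq (hQq ω)
  have hSm : ∀ x, Measurable fun ω => S ω x := by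
    intro x
    refine measurable_of_tendsto_metrizable
      (f := fun n ω => √q • (x - visserIter (1 - q⁻¹ • Q ω) n x)) (fun n => ?_)
      (tendsto_pi_nhds.2 fun ω => hSlim ω x)
    refine (measurable_const.sub (measurable_visserIter (fun x => ?_) n x)).const_smul _
    simp only [sub_apply, smul_apply, one_apply_eq_self]
    exact measurable_const.sub ((hQm x).const_smul _)
  obtain ⟨w, b, -⟩ := exists_hilbertBasis ℝ X
  have := b.countable_index
  refine measurable_of_tendsto_metrizable' atTop
    (f := fun (s : Finset w) ω => ∫ z, F ω (m ω + ∑ i ∈ s, z i • S ω (b i)) ∂(stdProd w))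
    (fun s => ?_) (tendsto_pi_nhds.2 fun ω => ?_)
  · refine StronglyMeasurable.measurable
      (StronglyMeasurable.integral_prod_right' (f := fun p : Ω × (w → ℝ) =>
        F p.1 (m p.1 + ∑ i ∈ s, p.2 i • S p.1 (b i))) ?_)
    refine Measurable.stronglyMeasurable ?_
    refine hF.comp (measurable_fst.prodMk ((hm.comp measurable_fst).add ?_))
    refine Finset.measurable_fun_sum s fun i _ => ?_
    exact ((measurable_pi_apply i).comp measurable_snd).smul ((hSm _).comp measurable_fst)
  · obtain ⟨-, w', b', hb'⟩ := hQ ω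
    have hsum : Summable fun i => ‖S ω (b i)‖ ^ 2 := by
      refine summable_norm_sq_basis b' b (hS ω) (hb'.congr fun i => ?_)
      exact (norm_sq_of_comp_self (hS ω) (hSQ ω) _).symm
    obtain ⟨μ, h1, h2, h3⟩ := exists_charFun_eq (fun i => S ω (b i)) hsum (Q ω)
      (hasSum_inner_sq_of_comp_self b (hS ω) (hSQ ω))
    have h4 : HasGaussCharFun (Q ω) μ := ⟨h1, h2⟩
    rw [(hQ ω).hasGaussCharFun.unique h4]
    exact h3 (fun y => F ω (m ω + y)) A ((hFc ω).comp (by fun_prop)) fun x => hA ω _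

end OperatorMeasurability

/-! ### The evolution operator and measurable kernels -/

section Evolution

variable {X : Type*} [NormedAddCommGroup X] [InnerProductSpace ℝ X] [CompleteSpace X]
  [MeasurableSpace X] [BorelSpace X] [SecondCountableTopology X]
  {T : ℝ} {U : ℝ → ℝ → X →L[ℝ] X} {B : ℝ → X →L[ℝ] X} {f : ℝ → X}

lemma isCompact_triangle (T : ℝ) : IsCompact {p : ℝ × ℝ | 0 ≤ p.1 ∧ p.1 ≤ p.2 ∧ p.2 ≤ T} := by
  refine (isCompact_Icc (a := ((0 : ℝ), (0 : ℝ))) (b := (T, T))).of_isClosed_subset ?_ ?_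
  · exact (isClosed_le continuous_const continuous_fst).inter
      ((isClosed_le continuous_fst continuous_snd).inter (isClosed_le continuous_snd continuous_const))
  · rintro ⟨s, t⟩ ⟨h1, h2, h3⟩
    exact ⟨⟨h1, h1.trans h2⟩, ⟨h2.trans h3, h3⟩⟩

lemma Standing.exists_norm_U_le (h : Standing T U B f) :
    ∃ M : ℝ, 1 ≤ M ∧ ∀ s t, 0 ≤ s → s ≤ t → t ≤ T → ‖U t s‖ ≤ M := by
  obtain ⟨C, hC⟩ := banach_steinhaus
    (g := fun p : {p : ℝ × ℝ | 0 ≤ p.1 ∧ p.1 ≤ p.2 ∧ p.2 ≤ T} => U p.1.2 p.1.1) (fun x => by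
      obtain ⟨C, hC⟩ := (isCompact_triangle T).exists_bound_of_continuousOn (h.continuousOn_U x)
      exact ⟨C, fun p => hC p.1 p.2⟩)
  exact ⟨max 1 C, le_max_left _ _, fun s t h1 h2 h3 =>
    (hC ⟨(s, t), h1, h2, h3⟩).trans (le_max_right _ _)⟩

lemma Standing.tendsto_U (h : Standing T U B f) {t : ℝ} (ht : t ≤ T) {s : ℕ → ℝ} {s₀ : ℝ}
    (hs : ∀ n, s n ∈ Icc 0 t) (hs₀ : s₀ ∈ Icc 0 t) (hlim : Tendsto s atTop (𝓝 s₀)) {x : ℕ → X}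
    {x₀ : X} (hx : Tendsto x atTop (𝓝 x₀)) :
    Tendsto (fun n => U t (s n) (x n)) atTop (𝓝 (U t s₀ x₀)) := by
  obtain ⟨M, hM1, hM⟩ := h.exists_norm_U_le
  have h1 : Tendsto (fun n => U t (s n) x₀) atTop (𝓝 (U t s₀ x₀)) := by
    have h2 := h.continuousOn_U x₀ (s₀, t) ⟨hs₀.1, hs₀.2, ht⟩
    refine h2.tendsto.comp (tendsto_nhdsWithin_iff.2
      ⟨(hlim.prodMk_nhds tendsto_const_nhds : Tendsto (fun n => (s n, t)) _ _), ?_⟩)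
    exact Eventually.of_forall fun n => ⟨(hs n).1, (hs n).2, ht⟩
  have h3 : Tendsto (fun n => U t (s n) (x n - x₀)) atTop (𝓝 0) := by
    refine squeeze_zero_norm (a := fun n => M * ‖x n - x₀‖) (fun n => ?_) ?_
    · exact (U t (s n)).le_of_opNorm_le (hM _ _ (hs n).1 (hs n).2 ht) _
    · simpa using (tendsto_iff_norm_sub_tendsto_zero.1 hx).const_mul M
  have h4 := h3.add h1
  simpa using h4

lemma exists_measurable_subset_eqOn {E : Type*} [NormedAddCommGroup E] [MeasurableSpace E]
    [BorelSpace E] [SecondCountableTopology E] {ι : Type*} [Countable ι] {s : Set ℝ}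
    (hs : MeasurableSet s) {F : ι → ℝ → E}
    (hF : ∀ i, AEStronglyMeasurable (F i) (volume.restrict s)) :
    ∃ G ⊆ s, MeasurableSet G ∧ (∀ᵐ r, r ∈ s → r ∈ G) ∧ ∀ i, Measurable (G.indicator (F i)) := by
  have h1 : ∀ᵐ r ∂(volume.restrict s), ∀ i, F i r = (hF i).mk (F i) r :=
    ae_all_iff.2 fun i => (hF i).ae_eq_mk
  rw [ae_restrict_iff' hs] at h1
  obtain ⟨N, hN1, hN2, hN3⟩ := exists_measurable_superset_of_null (ae_iff.1 h1)
  refine ⟨s \ N, sdiff_subset, hs.diff hN2, ?_, fun i => ?_⟩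
  · have : ∀ᵐ r, r ∉ N := measure_eq_zero_iff_ae_notMem.1 hN3
    filter_upwards [this] with r hr hrs using ⟨hrs, hr⟩
  · have : (s \ N).indicator (F i) = (s \ N).indicator ((hF i).mk (F i)) := by
      refine Set.indicator_congr fun r hr => ?_
      by_contra hcon
      exact hr.2 (hN1 fun h => hcon (h hr.1 i))
    rw [this]
    exact (hF i).stronglyMeasurable_mk.measurable.indicator (hs.diff hN2)

lemma Standing.exists_measurable_f (h : Standing T U B f) :
    ∃ f' : ℝ → X, Measurable f' ∧ (∃ K, ∀ r, ‖f' r‖ ≤ K) ∧ ∀ᵐ r, r ∈ Icc 0 T → f' r = f r := by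
  obtain ⟨G, hGs, hG, hGae, hGm⟩ := exists_measurable_subset_eqOn (ι := Unit) measurableSet_Icc
    fun _ => h.measurable_f
  obtain ⟨K, hK⟩ := h.bounded_f
  refine ⟨G.indicator f, hGm (), ⟨max K 0, fun r => ?_⟩, ?_⟩
  · by_cases hr : r ∈ G
    · rw [indicator_of_mem hr]; exact (hK r (hGs hr)).trans (le_max_left _ _)
    · rw [indicator_of_notMem hr]; simp
  · filter_upwards [hGae] with r hr hrT using indicator_of_mem (hr hrT) _

/-- A countable basis allows one null set to serve all vectors, so the representative agrees with
`B` as an operator, and adjoints may be taken. -/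
lemma Standing.exists_measurable_B (h : Standing T U B f) :
    ∃ B' : ℝ → X →L[ℝ] X, (∀ x, Measurable fun r => B' r x) ∧ (∃ K, ∀ r, ‖B' r‖ ≤ K) ∧
      ∀ᵐ r, r ∈ Icc 0 T → B' r = B r := by
  obtain ⟨w, b, -⟩ := exists_hilbertBasis ℝ X
  have := b.countable_index
  obtain ⟨G, hGs, hG, hGae, hGm⟩ := exists_measurable_subset_eqOn measurableSet_Icc
    fun i : w => h.measurable_B (b i)
  obtain ⟨K, hK⟩ := h.bounded_B
  have hind : ∀ r x, G.indicator B r x = G.indicator (fun r => B r x) r := by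
    intro r x
    by_cases hr : r ∈ G
    · simp [hr]
    · simp [hr]
  refine ⟨G.indicator B, fun x => ?_, ⟨max K 0, fun r => ?_⟩, ?_⟩
  · refine measurable_of_tendsto_metrizable' atTop
      (f := fun (s : Finset w) r => ∑ i ∈ s, ⟪b i, x⟫_ℝ • G.indicator B r (b i)) (fun s => ?_) ?_
    · refine Finset.measurable_fun_sum s fun i _ => Measurable.const_smul ?_ _
      simp only [hind]
      exact hGm i
    · refine tendsto_pi_nhds.2 fun r => ?_
      have h1 := (b.hasSum_repr x).mapL (G.indicator B r)
      simp only [b.repr_apply_apply, map_smul] at h1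
      exact h1
  · by_cases hr : r ∈ G
    · rw [indicator_of_mem hr]; exact (hK r (hGs hr)).trans (le_max_left _ _)
    · rw [indicator_of_notMem hr]; simp
  · filter_upwards [hGae] with r hr hrT using indicator_of_mem (hr hrT) _

open scoped Classical in
/-- `U` extended by zero outside of the triangle `0 ≤ s ≤ t ≤ T`. -/
noncomputable def extU (T : ℝ) (U : ℝ → ℝ → X →L[ℝ] X) (t s : ℝ) : X →L[ℝ] X :=
  if 0 ≤ s ∧ s ≤ t ∧ t ≤ T then U t s else 0

lemma extU_of_mem {s t : ℝ} (h1 : 0 ≤ s) (h2 : s ≤ t) (h3 : t ≤ T) : extU T U t s = U t s :=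
  if_pos ⟨h1, h2, h3⟩

lemma Standing.measurable_extU (h : Standing T U B f) (x : X) :
    Measurable fun p : ℝ × ℝ => extU T U p.1 p.2 x := by
  classical
  have h1 := (h.continuousOn_U x).measurable_piecewise (g := fun _ => (0 : X)) continuousOn_const
    (isCompact_triangle T).measurableSet
  have h2 := h1.comp measurable_swap
  convert h2 using 1
  funext p
  simp only [extU, Function.comp_apply, Set.piecewise, mem_ofPred_eq, Prod.fst_swap, Prod.snd_swap]
  split_ifs <;> rfl

/-- Measurable representatives `G(t,r)` of `U(t,r) B(r)` and `g(t,r)` of `U(t,r) f(r)`. -/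
structure IsKernel (T : ℝ) (U : ℝ → ℝ → X →L[ℝ] X) (B : ℝ → X →L[ℝ] X) (f : ℝ → X)
    (K : ℝ) (G : ℝ → ℝ → X →L[ℝ] X) (g : ℝ → ℝ → X) : Prop where
  measurable_G : ∀ x, Measurable fun p : ℝ × ℝ => G p.1 p.2 x
  norm_G_le : ∀ t r, ‖G t r‖ ≤ K
  measurable_g : Measurable fun p : ℝ × ℝ => g p.1 p.2
  norm_g_le : ∀ t r, ‖g t r‖ ≤ K
  inner_covOp : ∀ s t, 0 ≤ s → s ≤ t → t ≤ T → ∀ x y, ⟪covOp U B t s x, y⟫_ℝ =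
    ∫ r in s..t, ⟪ContinuousLinearMap.adjoint (G t r) x, ContinuousLinearMap.adjoint (G t r) y⟫_ℝ
  integral_mean : ∀ s t, 0 ≤ s → s ≤ t → t ≤ T →
    ∫ r in s..t, U t r (f r) = ∫ r in s..t, g t r

lemma isFiniteMeasure_restrict_uIoc (a b : ℝ) :
    IsFiniteMeasure (volume.restrict (uIoc a b)) :=
  ⟨by rw [Measure.restrict_apply_univ, uIoc]; exact measure_Ioc_lt_top⟩

/-- The bounded operator required in the definition exists here, so the default value `0` is not
taken. -/
lemma strongIntegral_apply {G : ℝ → X →L[ℝ] X} {a b K : ℝ}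
    (hG : ∀ x, AEStronglyMeasurable (fun r => G r x) (volume.restrict (uIoc a b)))
    (hK : ∀ᵐ r, r ∈ uIoc a b → ‖G r‖ ≤ K) (x : X) :
    strongIntegral G a b x = ∫ r in a..b, G r x := by
  have := isFiniteMeasure_restrict_uIoc a b
  have hint : ∀ x, IntervalIntegrable (fun r => G r x) volume a b := by
    intro x
    rw [intervalIntegrable_iff]
    refine Integrable.of_bound (hG x) (K * ‖x‖) ?_
    rw [ae_restrict_iff' measurableSet_uIoc]
    filter_upwards [hK] with r hr hrs using (G r).le_of_opNorm_le (hr hrs) x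
  let S : X →ₗ[ℝ] X :=
    { toFun := fun x => ∫ r in a..b, G r x
      map_add' := fun x y => by
        simp only [map_add]; exact intervalIntegral.integral_add (hint x) (hint y)
      map_smul' := fun c x => by
        simp only [map_smul, RingHom.id_apply]; exact intervalIntegral.integral_smul c _ }
  have hS : ∀ x, ‖S x‖ ≤ K * |b - a| * ‖x‖ := by
    intro x
    refine (intervalIntegral.norm_integral_le_of_norm_le_const_ae (C := K * ‖x‖) ?_).trans_eq
      (by ring)
    filter_upwards [hK] with r hr hrs using (G r).le_of_opNorm_le (hr hrs) x
  have h : ∃ S : X →L[ℝ] X, ∀ x, IntervalIntegrable (fun r => G r x) volume a b ∧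
      S x = ∫ r in a..b, G r x := ⟨S.mkContinuous _ hS, fun x => ⟨hint x, rfl⟩⟩
  rw [strongIntegral, dif_pos h]
  exact (h.choose_spec x).2

lemma Standing.exists_isKernel (h : Standing T U B f) : ∃ K G g, 0 ≤ K ∧ IsKernel T U B f K G g := by
  obtain ⟨M, hM1, hM⟩ := h.exists_norm_U_le
  obtain ⟨f', hf'm, ⟨Kf, hKf⟩, hf'⟩ := h.exists_measurable_f
  obtain ⟨B', hB'm, ⟨KB, hKB⟩, hB'⟩ := h.exists_measurable_B
  have hKf0 : 0 ≤ Kf := (norm_nonneg _).trans (hKf 0)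
  have hKB0 : 0 ≤ KB := (norm_nonneg _).trans (hKB 0)
  have hM0 : 0 ≤ M := zero_le_one.trans hM1
  have hext : ∀ t r, ‖extU T U t r‖ ≤ M := by
    intro t r
    rw [extU]
    split_ifs with hc
    · exact hM _ _ hc.1 hc.2.1 hc.2.2
    · simpa using hM0
  set K := max (M * KB) (M * Kf)
  set G : ℝ → ℝ → X →L[ℝ] X := fun t r => extU T U t r ∘L B' r with hGdef
  have hGm : ∀ x, Measurable fun p : ℝ × ℝ => G p.1 p.2 x := fun x =>
    measurable_apply_apply (A := fun p : ℝ × ℝ => extU T U p.1 p.2) h.measurable_extU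
      ((hB'm x).comp measurable_snd)
  have hGK : ∀ t r, ‖G t r‖ ≤ K := fun t r =>
    ((ContinuousLinearMap.opNorm_comp_le _ _).trans
      (mul_le_mul (hext t r) (hKB r) (norm_nonneg _) hM0)).trans (le_max_left _ _)
  have hGGm : ∀ t x, Measurable fun r => G t r (ContinuousLinearMap.adjoint (G t r) x) := by
    intro t x
    have h1 : ∀ x, Measurable fun r => G t r x := fun x =>
      (hGm x).comp (measurable_const.prodMk measurable_id)
    exact measurable_apply_apply h1 (measurable_adjoint_apply h1 x)
  have hK0 : 0 ≤ K := le_max_of_le_left (mul_nonneg hM0 hKB0)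
  have hadj : ∀ t r, ‖ContinuousLinearMap.adjoint (G t r)‖ ≤ K := fun t r => by
    rw [LinearIsometryEquiv.norm_map]; exact hGK t r
  have hGGK : ∀ t r x, ‖G t r (ContinuousLinearMap.adjoint (G t r) x)‖ ≤ K * (K * ‖x‖) :=
    fun t r x => ((G t r).le_of_opNorm_le (hGK t r) _).trans
      (mul_le_mul_of_nonneg_left (ContinuousLinearMap.le_of_opNorm_le _ (hadj t r) x) hK0)
  have hGe : ∀ s t, 0 ≤ s → s ≤ t → t ≤ T → ∀ᵐ r, r ∈ uIoc s t →
      U t r ∘L B r ∘L ContinuousLinearMap.adjoint (B r) ∘L ContinuousLinearMap.adjoint (U t r) =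
        G t r ∘L ContinuousLinearMap.adjoint (G t r) := by
    intro s t h0 hst htT
    filter_upwards [hB'] with r hr hrs
    rw [uIoc_of_le hst] at hrs
    rw [hGdef]
    simp only
    rw [hr ⟨h0.trans hrs.1.le, hrs.2.trans htT⟩, extU_of_mem (h0.trans hrs.1.le) hrs.2 htT,
      ContinuousLinearMap.adjoint_comp]
    rfl
  refine ⟨K, G, fun t r => extU T U t r (f' r), hK0, hGm, hGK,
    measurable_apply_apply (A := fun p : ℝ × ℝ => extU T U p.1 p.2) h.measurable_extU
      (hf'm.comp measurable_snd), fun t r => ?_, fun s t h0 hst htT x y => ?_,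
    fun s t h0 hst htT => ?_⟩
  · exact ((ContinuousLinearMap.le_of_opNorm_le _ (hext t r) _).trans
      (mul_le_mul_of_nonneg_left (hKf r) hM0)).trans (le_max_right _ _)
  · have hae := hGe s t h0 hst htT
    have h2 : ∀ x, (fun r => (U t r ∘L B r ∘L ContinuousLinearMap.adjoint (B r) ∘L
        ContinuousLinearMap.adjoint (U t r)) x) =ᵐ[volume.restrict (uIoc s t)]
        fun r => G t r (ContinuousLinearMap.adjoint (G t r) x) := by
      intro x
      rw [EventuallyEq, ae_restrict_iff' measurableSet_uIoc]
      filter_upwards [hae] with r hr hrs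
      rw [hr hrs]; rfl
    have h3 : covOp U B t s x =
        ∫ r in s..t, G t r (ContinuousLinearMap.adjoint (G t r) x) := by
      rw [covOp, strongIntegral_apply (K := K * K)]
      · rw [intervalIntegral.integral_congr_ae_restrict]
        exact h2 x
      · intro x
        exact (hGGm t x).aestronglyMeasurable.congr (h2 x).symm
      · filter_upwards [hae] with r hr hrs
        rw [hr hrs]
        exact (ContinuousLinearMap.opNorm_comp_le _ _).trans
          (mul_le_mul (hGK t r) (hadj t r) (norm_nonneg _) hK0)
    have := isFiniteMeasure_restrict_uIoc s t
    have h4 : IntervalIntegrable (fun r => G t r (ContinuousLinearMap.adjoint (G t r) x))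
        volume s t := by
      rw [intervalIntegrable_iff]
      exact Integrable.of_bound (hGGm t x).aestronglyMeasurable _ (ae_of_all _ fun r => hGGK t r x)
    rw [h3, real_inner_comm]
    have h5 := (innerSL ℝ y).intervalIntegral_comp_comm h4
    simp only [innerSL_apply_apply] at h5
    rw [← h5]
    refine intervalIntegral.integral_congr fun r _ => ?_
    rw [ContinuousLinearMap.adjoint_inner_right, real_inner_comm]
  · refine intervalIntegral.integral_congr_ae ?_
    filter_upwards [hf'] with r hr hrs
    rw [uIoc_of_le hst] at hrs
    rw [extU_of_mem (h0.trans hrs.1.le) hrs.2 htT, hr ⟨h0.trans hrs.1.le, hrs.2.trans htT⟩]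

end Evolution

/-! ### Continuity and measurability of the evolution family -/

section EvolutionEstimates

variable {X : Type*} [NormedAddCommGroup X] [InnerProductSpace ℝ X] [CompleteSpace X]
  [MeasurableSpace X] [BorelSpace X] [SecondCountableTopology X]
  {T K : ℝ} {U : ℝ → ℝ → X →L[ℝ] X} {B : ℝ → X →L[ℝ] X} {f : ℝ → X}
  {G : ℝ → ℝ → X →L[ℝ] X} {g : ℝ → ℝ → X}

lemma intervalIntegrable_of_bounded {E : Type*} [NormedAddCommGroup E] {φ : ℝ → E}
    (hm : AEStronglyMeasurable φ volume) (hK : ∀ r, ‖φ r‖ ≤ K) (a b : ℝ) :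
    IntervalIntegrable φ volume a b := by
  have := isFiniteMeasure_restrict_uIoc a b
  rw [intervalIntegrable_iff]
  exact Integrable.of_bound hm.restrict K (ae_of_all _ hK)

lemma IsKernel.measurable_adjoint (hG : IsKernel T U B f K G g) (x : X) :
    Measurable fun p : ℝ × ℝ => ContinuousLinearMap.adjoint (G p.1 p.2) x :=
  measurable_adjoint_apply (A := fun p : ℝ × ℝ => G p.1 p.2) hG.measurable_G x

lemma IsKernel.norm_adjoint_le (hG : IsKernel T U B f K G g) (t r : ℝ) (x : X) :
    ‖ContinuousLinearMap.adjoint (G t r) x‖ ≤ K * ‖x‖ := by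
  refine ContinuousLinearMap.le_of_opNorm_le _ ?_ x
  rw [LinearIsometryEquiv.norm_map]; exact hG.norm_G_le t r

lemma IsKernel.norm_inner_le (hG : IsKernel T U B f K G g) (t r : ℝ) (x y : X) :
    ‖⟪ContinuousLinearMap.adjoint (G t r) x, ContinuousLinearMap.adjoint (G t r) y⟫_ℝ‖ ≤
      (K * ‖x‖) * (K * ‖y‖) :=
  (norm_inner_le_norm _ _).trans (mul_le_mul (hG.norm_adjoint_le t r x) (hG.norm_adjoint_le t r y)
    (norm_nonneg _) ((norm_nonneg _).trans (hG.norm_adjoint_le t r x)))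

lemma IsKernel.intervalIntegrable_inner (hG : IsKernel T U B f K G g) (t : ℝ) (x y : X) (a b : ℝ) :
    IntervalIntegrable (fun r => ⟪ContinuousLinearMap.adjoint (G t r) x,
      ContinuousLinearMap.adjoint (G t r) y⟫_ℝ) volume a b :=
  intervalIntegrable_of_bounded (((hG.measurable_adjoint x).inner (hG.measurable_adjoint y)).comp
      (measurable_const.prodMk measurable_id)).aestronglyMeasurable
    (fun r => hG.norm_inner_le t r x y) a b

/-- The quadratic form of the difference is `∫_0^s ‖G(t,r)* x‖² dr`. This is the domination that
gives tightness for fixed `t`. -/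
lemma IsKernel.isPositive_sub (hG : IsKernel T U B f K G g) (h : Standing T U B f) {s t : ℝ}
    (h0 : 0 ≤ s) (hst : s ≤ t) (htT : t ≤ T) : (covOp U B t 0 - covOp U B t s).IsPositive := by
  rw [isPositive_iff_real]
  have h1 := isPositive_iff_real.1 (h.traceClass 0 t le_rfl (h0.trans hst) htT).1
  have h2 := isPositive_iff_real.1 (h.traceClass s t h0 hst htT).1
  refine ⟨fun x y => ?_, fun x => ?_⟩
  · simp only [_root_.sub_apply, inner_sub_left, inner_sub_right, h1.1, h2.1]
  · simp only [_root_.sub_apply, inner_sub_left]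
    rw [hG.inner_covOp 0 t le_rfl (h0.trans hst) htT, hG.inner_covOp s t h0 hst htT,
      ← intervalIntegral.integral_add_adjacent_intervals
        (hG.intervalIntegrable_inner t x x 0 s) (hG.intervalIntegrable_inner t x x s t),
      add_sub_cancel_right]
    exact intervalIntegral.integral_nonneg h0 fun r _ => real_inner_self_nonneg

lemma IsKernel.norm_covOp_le (hG : IsKernel T U B f K G g) {s t : ℝ}
    (h0 : 0 ≤ s) (hst : s ≤ t) (htT : t ≤ T) : ‖covOp U B t s‖ ≤ K ^ 2 * T := by
  have hT : 0 ≤ T := h0.trans (hst.trans htT)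
  refine ContinuousLinearMap.opNorm_le_bound _ (by positivity) fun x => ?_
  set y := covOp U B t s x with hy
  rcases eq_or_ne y 0 with h | h
  · rw [h, norm_zero]; positivity
  have h1 : ‖y‖ * ‖y‖ ≤ (K ^ 2 * T * ‖x‖) * ‖y‖ := by
    rw [← real_inner_self_eq_norm_mul_norm]
    conv_lhs => rw [hy, hG.inner_covOp s t h0 hst htT]
    refine (Real.le_norm_self _).trans ((intervalIntegral.norm_integral_le_of_norm_le_const
      (C := (K * ‖x‖) * (K * ‖y‖)) fun r _ => hG.norm_inner_le t r _ _).trans ?_)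
    rw [abs_of_nonneg (sub_nonneg.2 hst)]
    have : 0 ≤ (K * ‖x‖) * (K * ‖y‖) := (norm_nonneg _).trans (hG.norm_inner_le t 0 x y)
    calc _ ≤ (K * ‖x‖) * (K * ‖y‖) * T := by gcongr; linarith
      _ = _ := by ring
  exact le_of_mul_le_mul_right h1 (norm_pos_iff.2 h)

lemma tendsto_intervalIntegral_left {E : Type*} [NormedAddCommGroup E] [NormedSpace ℝ E]
    {φ : ℝ → E} (hφ : ∀ a b, IntervalIntegrable φ volume a b) (t : ℝ)
    {s : ℕ → ℝ} {s₀ : ℝ} (hs : Tendsto s atTop (𝓝 s₀)) :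
    Tendsto (fun n => ∫ r in s n..t, φ r) atTop (𝓝 (∫ r in s₀..t, φ r)) := by
  have h1 := (intervalIntegral.continuous_primitive hφ t).neg
  rw [intervalIntegral.integral_symm t s₀]
  exact ((h1.tendsto s₀).comp hs).congr fun n => (intervalIntegral.integral_symm t (s n)).symm

lemma IsKernel.tendsto_covOp (hG : IsKernel T U B f K G g) {t : ℝ} (ht : t ≤ T) {s : ℕ → ℝ}
    {s₀ : ℝ} (hs : ∀ n, s n ∈ Icc 0 t) (hs₀ : s₀ ∈ Icc 0 t) (hlim : Tendsto s atTop (𝓝 s₀)) (x : X) :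
    Tendsto (fun n => ⟪covOp U B t (s n) x, x⟫_ℝ) atTop (𝓝 ⟪covOp U B t s₀ x, x⟫_ℝ) := by
  simp only [hG.inner_covOp _ t (hs _).1 (hs _).2 ht, hG.inner_covOp _ t hs₀.1 hs₀.2 ht]
  exact tendsto_intervalIntegral_left (hG.intervalIntegrable_inner t x x) t hlim

lemma IsKernel.tendsto_meanVec (hG : IsKernel T U B f K G g) (h : Standing T U B f) {t : ℝ}
    (ht : t ≤ T) {s : ℕ → ℝ} {s₀ : ℝ} (hs : ∀ n, s n ∈ Icc 0 t) (hs₀ : s₀ ∈ Icc 0 t)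
    (hlim : Tendsto s atTop (𝓝 s₀)) {x : ℕ → X} {x₀ : X} (hx : Tendsto x atTop (𝓝 x₀)) :
    Tendsto (fun n => meanVec U f t (s n) (x n)) atTop (𝓝 (meanVec U f t s₀ x₀)) := by
  simp only [meanVec, hG.integral_mean _ t (hs _).1 (hs _).2 ht,
    hG.integral_mean _ t hs₀.1 hs₀.2 ht]
  refine (h.tendsto_U ht hs hs₀ hlim hx).add (tendsto_intervalIntegral_left
    (fun a b => intervalIntegrable_of_bounded ?_ (hG.norm_g_le t) a b) t hlim)
  exact (hG.measurable_g.comp (measurable_const.prodMk measurable_id)).aestronglyMeasurable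

lemma Standing.evol_eq (h : Standing T U B f) {s t : ℝ} (h0 : 0 ≤ s) (hst : s ≤ t) (htT : t ≤ T)
    {φ : X → ℝ} (hφ : Continuous φ) (x : X) :
    evol U B f s t φ x = ∫ y, φ (meanVec U f t s x + y) ∂(gaussian 0 (covOp U B t s)) :=
  (h.traceClass s t h0 hst htT).integral_gaussian _ hφ

lemma Standing.evol_eq_smear (h : Standing T U B f) {s t : ℝ} (h0 : 0 ≤ s) (hst : s ≤ t)
    (htT : t ≤ T) {φ : X → ℝ} (hφ : Continuous φ) :
    evol U B f s t φ = fun x => smear (gaussian 0 (covOp U B t s)) 1 φ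
      ((U t s : X →+ X) x + ∫ r in s..t, U t r (f r)) := by
  funext x
  simp only [h.evol_eq h0 hst htT hφ, smear, one_smul]
  rfl

lemma Standing.abs_evol_le (h : Standing T U B f) {s t : ℝ} (h0 : 0 ≤ s) (hst : s ≤ t)
    (htT : t ≤ T) {φ : X → ℝ} (hφ : Continuous φ) {A : ℝ} (hA : ∀ x, |φ x| ≤ A) (x : X) :
    |evol U B f s t φ x| ≤ A := by
  have := (h.traceClass s t h0 hst htT).hasGaussCharFun.prob
  rw [h.evol_eq_smear h0 hst htT hφ]
  exact abs_smear_le hA _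

lemma IsKernel.tendsto_evol (hG : IsKernel T U B f K G g) (h : Standing T U B f) {t : ℝ}
    (ht : t ≤ T) {s : ℕ → ℝ} {s₀ : ℝ} (hs : ∀ n, s n ∈ Icc 0 t) (hs₀ : s₀ ∈ Icc 0 t)
    (hlim : Tendsto s atTop (𝓝 s₀)) {x : ℕ → X} {x₀ : X} (hx : Tendsto x atTop (𝓝 x₀))
    {φ : X → ℝ} (hφ : Continuous φ) {A : ℝ} (hA : ∀ x, |φ x| ≤ A) :
    Tendsto (fun n => evol U B f (s n) t φ (x n)) atTop (𝓝 (evol U B f s₀ t φ x₀)) := by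
  simp only [h.evol_eq (hs _).1 (hs _).2 ht hφ, h.evol_eq hs₀.1 hs₀.2 ht hφ]
  have htr := fun n => h.traceClass (s n) t (hs n).1 (hs n).2 ht
  exact tendsto_integral_gauss (h.traceClass 0 t le_rfl (hs₀.1.trans hs₀.2) ht)
    (fun n => (htr n).1) (fun n => hG.isPositive_sub h (hs n).1 (hs n).2 ht)
    (fun n => (htr n).hasGaussCharFun) (h.traceClass s₀ t hs₀.1 hs₀.2 ht).hasGaussCharFun
    (hG.tendsto_covOp ht hs hs₀ hlim) (hG.tendsto_meanVec h ht hs hs₀ hlim hx) hφ hA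

/-- The moving endpoint is absorbed into indicators of measurable subsets of the plane, one for each
orientation, and Fubini applies. -/
lemma measurable_intervalIntegral_param {E : Type*} [NormedAddCommGroup E] [NormedSpace ℝ E]
    [MeasurableSpace E] [BorelSpace E] [SecondCountableTopology E]
    {F : ℝ → ℝ → E} (hF : Measurable fun p : ℝ × ℝ => F p.1 p.2) (s : ℝ) :
    Measurable fun τ => ∫ r in s..τ, F τ r := by
  classical
  have key : ∀ S : Set (ℝ × ℝ), MeasurableSet S →
      Measurable fun τ => ∫ r, S.indicator (fun p => F p.1 p.2) (τ, r) := fun S hS =>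
    (StronglyMeasurable.integral_prod_right'
      (hF.indicator hS).stronglyMeasurable).measurable
  have h1 := key {p | s < p.2 ∧ p.2 ≤ p.1} ((measurableSet_lt measurable_const measurable_snd).inter
    (measurableSet_le measurable_snd measurable_fst))
  have h2 := key {p | p.1 < p.2 ∧ p.2 ≤ s} ((measurableSet_lt measurable_fst measurable_snd).inter
    (measurableSet_le measurable_snd measurable_const))
  convert h1.sub h2 using 1
  funext τ
  rw [intervalIntegral, ← integral_indicator measurableSet_Ioc,
    ← integral_indicator measurableSet_Ioc]
  rfl

lemma IsKernel.aestronglyMeasurable_evol (hG : IsKernel T U B f K G g) (h : Standing T U B f)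
    {s t : ℝ} (h0 : 0 ≤ s) (hst : s ≤ t) (htT : t ≤ T) {ψ : ℝ → X → ℝ}
    (hψ : ContinuousOn (fun p : ℝ × X => ψ p.1 p.2) (Icc 0 t ×ˢ univ)) {A : ℝ}
    (hA : ∀ σ ∈ Icc 0 t, ∀ x, |ψ σ x| ≤ A) (x : X) :
    AEStronglyMeasurable (fun σ => evol U B f s σ (ψ σ) x) (volume.restrict (Ioc s t)) := by
  -- Clamping `σ` to `[s, t]` makes every hypothesis hold for all real `σ` and changes nothing on
  -- `(s, t]`.
  set c : ℝ → ℝ := fun σ => max s (min σ t) with hc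
  have hcc : Continuous c := by fun_prop
  have hcm : ∀ σ, c σ ∈ Icc s t := fun σ => ⟨le_max_left _ _, max_le hst (min_le_right _ _)⟩
  have hcm0 : ∀ σ, c σ ∈ Icc 0 t := fun σ => ⟨h0.trans (hcm σ).1, (hcm σ).2⟩
  have hcT : ∀ σ, c σ ≤ T := fun σ => (hcm σ).2.trans htT
  have hce : ∀ σ ∈ Ioc s t, c σ = σ := fun σ hσ => by
    simp only [hc]; rw [min_eq_left hσ.2, max_eq_right hσ.1.le]
  have hψc : Continuous fun p : ℝ × X => ψ (c p.1) p.2 :=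
    hψ.comp_continuous (f := fun p : ℝ × X => (c p.1, p.2)) (by fun_prop)
      fun p => ⟨hcm0 _, mem_univ _⟩
  have hQm : ∀ y, Measurable fun σ => covOp U B (c σ) s y := by
    intro y
    refine measurable_of_inner fun z => ?_
    have h1 := (measurable_intervalIntegral_param (F := fun t r =>
      ⟪ContinuousLinearMap.adjoint (G t r) y, ContinuousLinearMap.adjoint (G t r) z⟫_ℝ)
      ((hG.measurable_adjoint y).inner (hG.measurable_adjoint z)) s).comp hcc.measurable
    have h2 : (fun σ => ⟪z, covOp U B (c σ) s y⟫_ℝ) = (fun τ => ∫ r in s..τ,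
        ⟪ContinuousLinearMap.adjoint (G τ r) y, ContinuousLinearMap.adjoint (G τ r) z⟫_ℝ) ∘ c := by
      funext σ
      rw [real_inner_comm, hG.inner_covOp s _ h0 (hcm σ).1 (hcT σ)]
      rfl
    rw [h2]
    exact h1
  have hmm : Measurable fun σ => meanVec U f (c σ) s x := by
    have h1 := (measurable_intervalIntegral_param hG.measurable_g s).comp hcc.measurable
    have h2 : Continuous fun σ => U (c σ) s x :=
      (h.continuousOn_U x).comp_continuous (f := fun σ => (s, c σ)) (by fun_prop)
        fun σ => ⟨h0, (hcm σ).1, hcT σ⟩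
    convert h2.measurable.add h1 using 1
    funext σ
    rw [meanVec, hG.integral_mean s _ h0 (hcm σ).1 (hcT σ)]
    rfl
  have hT : 0 ≤ T := h0.trans (hst.trans htT)
  have hm := measurable_integral_gauss (Q := fun σ => covOp U B (c σ) s) (q := K ^ 2 * T + 1)
    (fun σ => h.traceClass s _ h0 (hcm σ).1 (hcT σ)) hQm (by positivity)
    (fun σ => (hG.norm_covOp_le h0 (hcm σ).1 (hcT σ)).trans (by linarith)) hmm
    (F := fun σ => ψ (c σ)) hψc.measurable (fun σ => hψc.comp (Continuous.prodMk_right σ)) (fun σ => hA _ (hcm0 σ))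
  refine hm.aestronglyMeasurable.congr ?_
  rw [EventuallyEq, ae_restrict_iff' measurableSet_Ioc]
  refine ae_of_all _ fun σ hσ => ?_
  have hψσ : Continuous (ψ (c σ)) := hψc.comp (Continuous.prodMk_right σ)
  simp only [hce σ hσ] at hψσ ⊢
  rw [h.evol_eq h0 hσ.1.le (hσ.2.trans htT) hψσ]

/-- The time integral in the mild solution. -/
noncomputable def duhamel (U : ℝ → ℝ → X →L[ℝ] X) (B : ℝ → X →L[ℝ] X) (f : ℝ → X) (t : ℝ)
    (ψ : ℝ → X → ℝ) (s : ℝ) (x : X) : ℝ :=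
  ∫ σ in s..t, evol U B f s σ (ψ σ) x

lemma continuous_slice {t : ℝ} {ψ : ℝ → X → ℝ}
    (hψ : ContinuousOn (fun p : ℝ × X => ψ p.1 p.2) (Icc 0 t ×ˢ univ)) {σ : ℝ} (hσ : σ ∈ Icc 0 t) :
    Continuous (ψ σ) :=
  hψ.comp_continuous (f := fun x => (σ, x)) (by fun_prop) fun x => ⟨hσ, mem_univ _⟩

lemma IsKernel.integrable_evol (hG : IsKernel T U B f K G g) (h : Standing T U B f)
    {s t : ℝ} (h0 : 0 ≤ s) (hst : s ≤ t) (htT : t ≤ T) {ψ : ℝ → X → ℝ}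
    (hψ : ContinuousOn (fun p : ℝ × X => ψ p.1 p.2) (Icc 0 t ×ˢ univ)) {A : ℝ}
    (hA : ∀ σ ∈ Icc 0 t, ∀ x, |ψ σ x| ≤ A) (x : X) :
    Integrable (fun σ => evol U B f s σ (ψ σ) x) (volume.restrict (Ioc s t)) := by
  refine Integrable.of_bound (hG.aestronglyMeasurable_evol h h0 hst htT hψ hA x) A ?_
  rw [ae_restrict_iff' measurableSet_Ioc]
  refine ae_of_all _ fun σ hσ => ?_
  have hσ' : σ ∈ Icc 0 t := ⟨h0.trans hσ.1.le, hσ.2⟩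
  exact h.abs_evol_le h0 hσ.1.le (hσ.2.trans htT) (continuous_slice hψ hσ') (hA σ hσ') x

lemma IsKernel.tendsto_duhamel (hG : IsKernel T U B f K G g) (h : Standing T U B f)
    {t : ℝ} (htT : t ≤ T) {ψ : ℝ → X → ℝ}
    (hψ : ContinuousOn (fun p : ℝ × X => ψ p.1 p.2) (Icc 0 t ×ˢ univ)) {A : ℝ}
    (hA : ∀ σ ∈ Icc 0 t, ∀ x, |ψ σ x| ≤ A) {s : ℕ → ℝ} {s₀ : ℝ} (hs : ∀ n, s n ∈ Icc 0 t)
    (hs₀ : s₀ ∈ Icc 0 t) (hlim : Tendsto s atTop (𝓝 s₀)) {x : ℕ → X} {x₀ : X}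
    (hx : Tendsto x atTop (𝓝 x₀)) :
    Tendsto (fun n => duhamel U B f t ψ (s n) (x n)) atTop (𝓝 (duhamel U B f t ψ s₀ x₀)) := by
  -- The variable lower limit is moved into an indicator, so that dominated convergence applies on a
  -- fixed interval.
  have heq : ∀ s ∈ Icc 0 t, ∀ x, duhamel U B f t ψ s x =
      ∫ σ in Ioc 0 t, (Ioc s t).indicator (fun σ => evol U B f s σ (ψ σ) x) σ := by
    intro s hs x
    rw [duhamel, intervalIntegral.integral_of_le hs.2, setIntegral_indicator measurableSet_Ioc,
      inter_eq_right.2 (Ioc_subset_Ioc_left hs.1)]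
  simp only [heq _ (hs _), heq _ hs₀]
  have hA0 : 0 ≤ A := (abs_nonneg _).trans (hA s₀ hs₀ 0)
  refine tendsto_integral_of_dominated_convergence (fun _ => A) (fun n => ?_)
    (integrable_const _) (fun n => ?_) ?_
  · have h1 := hG.aestronglyMeasurable_evol h (hs n).1 (hs n).2 htT hψ hA (x n)
    exact ((aestronglyMeasurable_indicator_iff measurableSet_Ioc).2 h1).restrict
  · refine ae_of_all _ fun σ => ?_
    by_cases hσ : σ ∈ Ioc (s n) t
    · have hσ' : σ ∈ Icc 0 t := ⟨(hs n).1.trans hσ.1.le, hσ.2⟩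
      rw [indicator_of_mem hσ]
      exact h.abs_evol_le (hs n).1 hσ.1.le (hσ.2.trans htT) (continuous_slice hψ hσ') (hA σ hσ') _
    · rw [indicator_of_notMem hσ]; simpa using hA0
  · rw [ae_restrict_iff' measurableSet_Ioc]
    -- Away from the null set `{s₀}` the indicator is eventually constant along the sequence.
    have hne : ∀ᵐ σ : ℝ, σ ≠ s₀ := by
      rw [ae_iff]; simp
    filter_upwards [hne] with σ hσ0 hσ
    have hσ' : σ ∈ Icc 0 t := ⟨hσ.1.le, hσ.2⟩
    rcases lt_or_gt_of_ne hσ0 with hlt | hgt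
    · rw [indicator_of_notMem (fun hm => hlt.not_gt hm.1)]
      refine tendsto_const_nhds.congr' ?_
      filter_upwards [hlim.eventually (lt_mem_nhds hlt)] with n hn
      rw [indicator_of_notMem (fun hm => hn.not_gt hm.1)]
    · rw [indicator_of_mem (show σ ∈ Ioc s₀ t from ⟨hgt, hσ.2⟩)]
      -- The minimum keeps every initial time at or below `σ`; eventually it is `s n`.
      have h2 := hG.tendsto_evol h (hσ.2.trans htT) (s := fun n => min (s n) σ) (s₀ := s₀)
        (fun n => ⟨le_min (hs n).1 hσ.1.le, min_le_right _ _⟩) ⟨hs₀.1, hgt.le⟩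
        (by simpa [min_eq_left hgt.le] using hlim.min (tendsto_const_nhds (x := σ)))
        hx (continuous_slice hψ hσ') (hA σ hσ')
      refine h2.congr' ?_
      filter_upwards [hlim.eventually (gt_mem_nhds hgt)] with n hn
      rw [indicator_of_mem (show σ ∈ Ioc (s n) t from ⟨hn, hσ.2⟩), min_eq_left hn.le]

lemma continuousOn_of_seq {t : ℝ} {v : ℝ → X → ℝ}
    (hv : ∀ (s : ℕ → ℝ) (s₀ : ℝ) (x : ℕ → X) (x₀ : X), (∀ n, s n ∈ Icc 0 t) → s₀ ∈ Icc 0 t →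
      Tendsto s atTop (𝓝 s₀) → Tendsto x atTop (𝓝 x₀) →
      Tendsto (fun n => v (s n) (x n)) atTop (𝓝 (v s₀ x₀))) :
    ContinuousOn (fun p : ℝ × X => v p.1 p.2) (Icc 0 t ×ˢ univ) := by
  rw [continuousOn_iff_continuous_domRestrict, continuous_iff_seqContinuous]
  intro p p₀ hp
  have h1 := (continuous_subtype_val.tendsto p₀).comp hp
  exact hv (fun n => (p n).1.1) p₀.1.1 (fun n => (p n).1.2) p₀.1.2 (fun n => (p n).2.1) p₀.2.1
    ((continuous_fst.tendsto _).comp h1) ((continuous_snd.tendsto _).comp h1)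

lemma Standing.continuousOn_mildSolution (h : Standing T U B f) {t : ℝ} (htT : t ≤ T)
    {φ : X → ℝ} (hφ : Continuous φ) {A' : ℝ} (hA' : ∀ x, |φ x| ≤ A') {ψ : ℝ → X → ℝ}
    (hψ : ContinuousOn (fun p : ℝ × X => ψ p.1 p.2) (Icc 0 t ×ˢ univ)) {A : ℝ}
    (hA : ∀ σ ∈ Icc 0 t, ∀ x, |ψ σ x| ≤ A) :
    ContinuousOn (fun p : ℝ × X => mildSolution U B f t φ ψ p.1 p.2) (Icc 0 t ×ˢ univ) := by
  obtain ⟨K, G, g, -, hG⟩ := h.exists_isKernel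
  refine continuousOn_of_seq fun s s₀ x x₀ hs hs₀ hlim hx => ?_
  exact (hG.tendsto_evol h htT hs hs₀ hlim hx hφ hA').sub
    (hG.tendsto_duhamel h htT hψ hA hs hs₀ hlim hx)

end EvolutionEstimates

/-! ### Balancing singular time integrals -/

section TimeIntegral

lemma abs_integral_le_rpow {F : ℝ → ℝ} {a b M p : ℝ} (hab : a ≤ b)
    (hp : -1 < p ∨ 0 < a) (hp1 : p ≠ -1) (hF : ∀ r ∈ Ioc a b, |F r| ≤ M * r ^ p) :
    |∫ r in a..b, F r| ≤ M * ((b ^ (p + 1) - a ^ (p + 1)) / (p + 1)) := by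
  have h0 : 0 < a → (0 : ℝ) ∉ uIcc a b := fun ha h => by
    rw [uIcc_of_le hab] at h; exact ha.not_ge h.1
  have hint : IntervalIntegrable (fun r : ℝ => M * r ^ p) volume a b := by
    refine IntervalIntegrable.const_mul ?_ M
    rcases hp with hp | ha
    · exact intervalIntegral.intervalIntegrable_rpow' hp
    · exact intervalIntegral.intervalIntegrable_rpow (Or.inr (h0 ha))
  refine (intervalIntegral.norm_integral_le_of_norm_le hab (ae_of_all _ fun r hr =>
    (Real.norm_eq_abs _).trans_le (hF r hr)) hint).trans_eq ?_
  rw [intervalIntegral.integral_const_mul, integral_rpow (hp.imp_right fun ha => ⟨hp1, h0 ha⟩)]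

/-- A time integral whose integrand satisfies one bound that is integrable at `0` and one that is
integrable at `∞`; the exponents balance at `r = L ^ (1 / θ)`. -/
lemma abs_integral_le_of_two_bounds {F : ℝ → ℝ} {R D L a p e q θ : ℝ} (hR : 0 ≤ R) (hD : 0 ≤ D)
    (hL : 0 < L) (hF : IntervalIntegrable F volume 0 R) (hp : p < 1) (hq : 1 < q)
    (hap : a + (1 - p) / θ = 1) (heq : e + (1 - q) / θ = 1)
    (h1 : ∀ r ∈ Ioc 0 R, |F r| ≤ D * (L ^ a * r ^ (-p)))
    (h2 : ∀ r ∈ Ioc 0 R, |F r| ≤ D * (L ^ e * r ^ (-q))) :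
    |∫ r in 0..R, F r| ≤ D * (1 / (1 - p) + 1 / (q - 1)) * L := by
  -- The two relations between the exponents say that `L^a ρ^{1-p}` and `L^e ρ^{1-q}` both equal
  -- `L`.
  set ρ := L ^ (1 / θ) with hρ
  have hρ0 : 0 < ρ := Real.rpow_pos_of_pos hL _
  have hp' : 0 < 1 - p := by linarith
  have hq' : 0 < q - 1 := by linarith
  have hLa : L ^ a * ρ ^ (1 - p) = L := by
    rw [hρ, ← Real.rpow_mul hL.le, ← Real.rpow_add hL]
    rw [show a + 1 / θ * (1 - p) = 1 by linear_combination hap, Real.rpow_one]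
  have hLe : L ^ e * ρ ^ (1 - q) = L := by
    rw [hρ, ← Real.rpow_mul hL.le, ← Real.rpow_add hL]
    rw [show e + 1 / θ * (1 - q) = 1 by linear_combination heq, Real.rpow_one]
  have hnear : ∀ R', 0 ≤ R' → R' ≤ R → R' ≤ ρ → |∫ r in 0..R', F r| ≤ D * (1 / (1 - p)) * L := by
    intro R' h0 hR' hRρ
    have h3 := abs_integral_le_rpow (F := F) (M := D * L ^ a) (p := -p) h0
      (Or.inl (by linarith)) (by linarith) (fun r hr => by
        rw [mul_assoc]; exact h1 r ⟨hr.1, hr.2.trans hR'⟩)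
    refine h3.trans ?_
    rw [show -p + 1 = 1 - p by ring, Real.zero_rpow hp'.ne', sub_zero]
    calc D * L ^ a * (R' ^ (1 - p) / (1 - p)) ≤ D * L ^ a * (ρ ^ (1 - p) / (1 - p)) := by gcongr
      _ = D * (1 / (1 - p)) * (L ^ a * ρ ^ (1 - p)) := by ring
      _ = _ := by rw [hLa]
  rcases le_total R ρ with hRρ | hRρ
  · refine (hnear R hR le_rfl hRρ).trans ?_
    have : 0 ≤ D * (1 / (q - 1)) * L := by positivity
    linarith
  · rw [← intervalIntegral.integral_add_adjacent_intervals (b := ρ)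
      (hF.mono_set (by rw [uIcc_of_le hρ0.le, uIcc_of_le hR]; exact Icc_subset_Icc_right hRρ))
      (hF.mono_set (by rw [uIcc_of_le hRρ, uIcc_of_le hR]; exact Icc_subset_Icc_left hρ0.le))]
    refine (abs_add_le _ _).trans ?_
    have h3 := hnear ρ hρ0.le hRρ le_rfl
    have h4 := abs_integral_le_rpow (F := F) (M := D * L ^ e) (p := -q) hRρ
      (Or.inr hρ0) (by linarith) (fun r hr => by
        rw [mul_assoc]; exact h2 r ⟨hρ0.trans hr.1, hr.2⟩)
    have h5 : (R ^ (-q + 1) - ρ ^ (-q + 1)) / (-q + 1) ≤ ρ ^ (1 - q) / (q - 1) := by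
      rw [show -q + 1 = -(q - 1) by ring, div_neg, ← neg_div, neg_sub,
        show 1 - q = -(q - 1) by ring]
      have : 0 ≤ R ^ (-(q - 1)) := Real.rpow_nonneg hR _
      gcongr
      linarith
    have h6 : D * L ^ e * (ρ ^ (1 - q) / (q - 1)) = D * (1 / (q - 1)) * L := by
      calc _ = D * (1 / (q - 1)) * (L ^ e * ρ ^ (1 - q)) := by ring
        _ = _ := by rw [hLe]
    have h7 := h4.trans (mul_le_mul_of_nonneg_left h5 (by positivity))
    rw [h6] at h7
    linarith

end TimeIntegral

/-! ### Difference estimates for the two terms of the mild solution -/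

section Estimates

variable {X : Type*} [NormedAddCommGroup X] [InnerProductSpace ℝ X] [CompleteSpace X]
  [MeasurableSpace X] [BorelSpace X] [SecondCountableTopology X]
  {T K θ c : ℝ} {U : ℝ → ℝ → X →L[ℝ] X} {B : ℝ → X →L[ℝ] X} {f : ℝ → X}

lemma normProd_append (l m : List X) : normProd (l ++ m) = normProd l * normProd m := by
  simp [normProd]

lemma normProd_map_le {A : X → X} {M : ℝ} (hM : 0 ≤ M) (hA : ∀ x, ‖A x‖ ≤ M * ‖x‖) (l : List X) :
    normProd (l.map A) ≤ M ^ l.length * normProd l := by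
  induction l with
  | nil => simp
  | cons a l ih =>
    rw [List.map_cons, normProd_cons, normProd_cons, List.length_cons, pow_succ]
    calc _ ≤ (M * ‖a‖) * (M ^ l.length * normProd l) :=
          mul_le_mul (hA a) ih (normProd_nonneg _) (by positivity)
      _ = _ := by ring

lemma Standing.iterDiff_evol (h : Standing T U B f) {s t : ℝ} (h0 : 0 ≤ s) (hst : s ≤ t)
    (htT : t ≤ T) {φ : X → ℝ} (hφ : Continuous φ) {A : ℝ} (hA : ∀ x, |φ x| ≤ A) (l : List X) :
    iterDiff l (evol U B f s t φ) = evol U B f s t (iterDiff (l.map (U t s)) φ) := by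
  have := (h.traceClass s t h0 hst htT).hasGaussCharFun.prob
  rw [h.evol_eq_smear h0 hst htT hφ, h.evol_eq_smear h0 hst htT (continuous_iterDiff hφ _),
    iterDiff_comp_add, iterDiff_smear hφ hA]
  rfl

/-- Each step `U(t,s) y` is `Q^{1/2} Λ y` with `Λ y ⊥ ker Q^{1/2}`, so Gaussian smoothing applies
with the steps `Λ y`, each costing a factor `c (t - s)^{-θ}`. -/
lemma Standing.abs_iterDiff_evol_le (h : Standing T U B f) (hR : RangeCondition T U B)
    (hc0 : 0 ≤ c) (hc : ∀ s t, 0 ≤ s → s < t → t ≤ T → ∀ x,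
      ‖Lam U B t s x‖ ≤ c * (t - s) ^ (-θ) * ‖x‖) {s t : ℝ} (h0 : 0 ≤ s) (hst : s < t)
    (htT : t ≤ T) {φ : X → ℝ} (hφ : Continuous φ) {A : ℝ} (hA : ∀ x, |φ x| ≤ A) (l : List X)
    (x : X) : |iterDiff l (evol U B f s t φ) x| ≤
      (2 * √l.length * c) ^ l.length * (t - s) ^ (-(θ * l.length)) * normProd l * A := by
  have htr := h.traceClass s t h0 hst.le htT
  obtain ⟨hS, hSQ⟩ := opSqrt_spec htr.1
  have hA0 : 0 ≤ A := (abs_nonneg _).trans (hA 0)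
  have hsp := fun y => pseudoInverse_spec (hR s t h0 hst htT ⟨y, rfl⟩)
  have hmap : l.map (U t s : X →+ X) = (l.map (Lam U B t s)).map (opSqrt (covOp U B t s)) := by
    rw [List.map_map]
    refine List.map_congr_left fun y _ => ?_
    exact ((hsp y).2).symm
  rw [h.evol_eq_smear h0 hst.le htT hφ, iterDiff_comp_add, hmap]
  refine (htr.hasGaussCharFun.abs_iterDiff_smear_le hS hSQ htr.1 _ (fun a ha => ?_) hφ hA _).trans ?_
  · obtain ⟨y, -, rfl⟩ := List.mem_map.1 ha
    exact (hsp y).1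
  · have hr : 0 ≤ t - s := by linarith
    have h1 := normProd_map_le (M := c * (t - s) ^ (-θ)) (by positivity)
      (hc s t h0 hst htT) l
    rw [List.length_map]
    have h2 : (c * (t - s) ^ (-θ)) ^ l.length = c ^ l.length * (t - s) ^ (-(θ * l.length)) := by
      rw [mul_pow, ← Real.rpow_mul_natCast hr, neg_mul]
    rw [h2] at h1
    calc _ ≤ (2 * √(l.length : ℝ)) ^ l.length *
          (c ^ l.length * (t - s) ^ (-(θ * l.length)) * normProd l) * A := by gcongr
      _ = _ := by rw [mul_pow _ c]; ring

/-- No smoothing is needed: Gaussian averaging does not increase the sup norm and `U(t,s)` stretches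
steps by at most `M`. The power `n + 1` accounts for `n` steps and the single factor `‖b‖`. -/
lemma Standing.zygBounds_evol (h : Standing T U B f) {M : ℝ} (hM1 : 1 ≤ M) {s t : ℝ}
    (hM : ‖U t s‖ ≤ M) (h0 : 0 ≤ s) (hst : s ≤ t) (htT : t ≤ T) {φ : X → ℝ} (hφ : Continuous φ)
    {n : ℕ} {N : ℝ} (hN : ZygBounds n N φ) :
    ZygBounds n (M ^ (n + 1) * N) (evol U B f s t φ) := by
  have hN0 := hN.nonneg
  have hM0 : 0 ≤ M := zero_le_one.trans hM1
  have hA : ∀ x, |φ x| ≤ N := fun x => by simpa using hN.diff 0 (Nat.zero_le _) [] rfl x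
  have hU : ∀ x, ‖U t s x‖ ≤ M * ‖x‖ := (U t s).le_of_opNorm_le hM
  refine ⟨fun j hj l hl x => ?_, fun l hl b x => ?_⟩
  · rw [h.iterDiff_evol h0 hst htT hφ hA]
    refine h.abs_evol_le h0 hst htT (continuous_iterDiff hφ _) (fun y => ?_) x
    refine (hN.diff j hj _ (by simpa using hl) y).trans ?_
    have h1 := normProd_map_le hM0 hU l
    have h2 : M ^ l.length ≤ M ^ (n + 1) := pow_le_pow_right₀ hM1 (by omega)
    have h3 := normProd_nonneg l
    calc N * normProd (l.map (U t s)) ≤ N * (M ^ (n + 1) * normProd l) := by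
          gcongr; exact h1.trans (by gcongr)
      _ = _ := by ring
  · rw [h.iterDiff_evol h0 hst htT hφ hA]
    refine h.abs_evol_le h0 hst htT (continuous_iterDiff hφ _) (fun y => ?_) x
    rw [List.map_append]
    refine (hN.zyg _ (by simpa using hl) (U t s b) y).trans ?_
    have h1 := normProd_map_le hM0 hU l
    have h3 := normProd_nonneg l
    have h4 := normProd_nonneg (l.map (U t s))
    rw [hl] at h1
    calc N * normProd (l.map (U t s)) * ‖U t s b‖ ≤ N * (M ^ n * normProd l) * (M * ‖b‖) := by
          gcongr; exact hU b
      _ = _ := by ring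

lemma ZygBounds.sub {n : ℕ} {M N : ℝ} {F G : X → ℝ} (hF : ZygBounds n M F)
    (hG : ZygBounds n N G) : ZygBounds n (M + N) (fun x => F x - G x) := by
  refine ⟨fun j hj l hl x => ?_, fun l hl b x => ?_⟩
  · rw [iterDiff_sub]
    refine (norm_sub_le _ _).trans ?_
    have h1 := hF.diff j hj l hl x
    have h2 := hG.diff j hj l hl x
    linarith
  · rw [iterDiff_sub]
    refine (norm_sub_le _ _).trans ?_
    have h1 := hF.zyg l hl b x
    have h2 := hG.zyg l hl b x
    linarith

lemma iterDiff_append_zero_zero (l : List X) (F : X → ℝ) (x : X) :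
    iterDiff (l ++ [0, 0]) F x = 0 := by
  have h1 : iterDiff [0, 0] F = fun _ => 0 := by
    funext x; simp [iterDiff_cons, fwdDiff]
  have h2 := norm_iterDiff_le (F := fun _ : X => (0 : ℝ)) (A := 0) (by simp) l x
  rw [iterDiff_append, h1]
  simpa using h2

/-- Bounds on the iterated differences of `P` which are singular in the parameter `r`. -/
structure SingularBounds (θ a p e q : ℝ) (n : ℕ) (D r : ℝ) (P : X → ℝ) : Prop where
  diff : ∀ l : List X, l.length ≤ n → ∀ x,
    |iterDiff l P x| ≤ D * r ^ (-(θ * l.length)) * normProd l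
  near : ∀ l : List X, l.length = n → ∀ b x,
    |iterDiff (l ++ [b, b]) P x| ≤ D * normProd l * (‖b‖ ^ a * r ^ (-p))
  far : ∀ l : List X, l.length = n → ∀ b x,
    |iterDiff (l ++ [b, b]) P x| ≤ D * normProd l * (‖b‖ ^ e * r ^ (-q))

lemma IsKernel.iterDiff_duhamel {G : ℝ → ℝ → X →L[ℝ] X} {g : ℝ → ℝ → X}
    (hG : IsKernel T U B f K G g) (h : Standing T U B f)
    {s t : ℝ} (h0 : 0 ≤ s) (hst : s ≤ t) (htT : t ≤ T) {ψ : ℝ → X → ℝ}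
    (hψ : ContinuousOn (fun p : ℝ × X => ψ p.1 p.2) (Icc 0 t ×ˢ univ)) {A : ℝ}
    (hA : ∀ σ ∈ Icc 0 t, ∀ x, |ψ σ x| ≤ A) (l : List X) (x : X) :
    IntervalIntegrable (fun r => iterDiff l (evol U B f s (r + s) (ψ (r + s))) x) volume 0 (t - s) ∧
      iterDiff l (duhamel U B f t ψ s) x =
        ∫ r in 0..t - s, iterDiff l (evol U B f s (r + s) (ψ (r + s))) x := by
  obtain ⟨h1, h2⟩ := iterDiff_integral (hG.integrable_evol h h0 hst htT hψ hA) l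
  have h3 : duhamel U B f t ψ s =
      fun x => ∫ σ, evol U B f s σ (ψ σ) x ∂(volume.restrict (Ioc s t)) := by
    funext x; rw [duhamel, intervalIntegral.integral_of_le hst]
  constructor
  · have h4 : IntervalIntegrable (fun σ => iterDiff l (evol U B f s σ (ψ σ)) x) volume s t :=
      (intervalIntegrable_iff_integrableOn_Ioc_of_le hst).2 (h1 x)
    have h5 := h4.comp_add_right s
    rwa [sub_self] at h5
  · rw [h3, h2, intervalIntegral.integral_comp_add_right
      (fun σ => iterDiff l (evol U B f s σ (ψ σ)) x), zero_add, sub_add_cancel,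
      intervalIntegral.integral_of_le hst]

/-- Differences of order at most `n` are integrated directly, as `θ n < 1`. For the Zygmund
difference the near and far bounds are balanced with `L = ‖b‖`. -/
lemma IsKernel.zygBounds_duhamel {G : ℝ → ℝ → X →L[ℝ] X} {g : ℝ → ℝ → X}
    (hG : IsKernel T U B f K G g) (h : Standing T U B f) (hθ : 0 < θ) {n : ℕ} {a p e q D : ℝ}
    (hn : θ * n < 1) (hp : p < 1) (hq : 1 < q) (hap : a + (1 - p) / θ = 1)
    (heq : e + (1 - q) / θ = 1) (hD : 0 ≤ D)
    {s t : ℝ} (h0 : 0 ≤ s) (hst : s ≤ t) (htT : t ≤ T) {ψ : ℝ → X → ℝ}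
    (hψ : ContinuousOn (fun p : ℝ × X => ψ p.1 p.2) (Icc 0 t ×ˢ univ)) {A : ℝ}
    (hA : ∀ σ ∈ Icc 0 t, ∀ x, |ψ σ x| ≤ A)
    (hS : ∀ σ ∈ Ioc s t, SingularBounds θ a p e q n D (σ - s) (evol U B f s σ (ψ σ))) :
    ZygBounds n ((max 1 T / (1 - θ * n) + (1 / (1 - p) + 1 / (q - 1))) * D)
      (duhamel U B f t ψ s) := by
  have hR : 0 ≤ t - s := sub_nonneg.2 hst
  have hn' : 0 < 1 - θ * n := by linarith
  have hp' : 0 < 1 - p := by linarith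
  have hq' : 0 < q - 1 := by linarith
  have hS' : ∀ r ∈ Ioc 0 (t - s),
      SingularBounds θ a p e q n D r (evol U B f s (r + s) (ψ (r + s))) := by
    intro r hr
    have := hS (r + s) ⟨by linarith [hr.1], by linarith [hr.2]⟩
    rwa [add_sub_cancel_right] at this
  refine ⟨fun j hj l hl x => ?_, fun l hl b x => ?_⟩
  · have hN := normProd_nonneg l
    rw [(hG.iterDiff_duhamel h h0 hst htT hψ hA l x).2]
    have hj1 : θ * l.length ≤ θ * n := by rw [hl]; gcongr
    have hj2 : 0 < 1 - θ * l.length := by linarith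
    have hj0 : 0 ≤ θ * l.length := by positivity
    have h1 := abs_integral_le_rpow (F := fun r => iterDiff l (evol U B f s (r + s) (ψ (r + s))) x)
      (M := D * normProd l) (p := -(θ * l.length)) hR (Or.inl (by linarith))
      (by linarith) (fun r hr => ((hS' r hr).diff l (hl.trans_le hj) x).trans_eq (by ring))
    rw [show -(θ * (l.length : ℝ)) + 1 = 1 - θ * l.length by ring, Real.zero_rpow hj2.ne',
      sub_zero] at h1
    have h2 : (t - s) ^ (1 - θ * (l.length : ℝ)) ≤ max 1 T := by
      calc (t - s) ^ (1 - θ * (l.length : ℝ)) ≤ (max 1 T) ^ (1 - θ * (l.length : ℝ)) :=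
            Real.rpow_le_rpow hR (le_max_of_le_right (by linarith)) hj2.le
        _ ≤ (max 1 T) ^ (1 : ℝ) := Real.rpow_le_rpow_of_exponent_le (le_max_left _ _) (by linarith)
        _ = _ := Real.rpow_one _
    have hT1 : (0 : ℝ) ≤ max 1 T := zero_le_one.trans (le_max_left _ _)
    refine h1.trans ?_
    calc D * normProd l * ((t - s) ^ (1 - θ * (l.length : ℝ)) / (1 - θ * l.length))
        ≤ D * normProd l * (max 1 T / (1 - θ * n)) := by gcongr
      _ ≤ D * normProd l * (max 1 T / (1 - θ * n) + (1 / (1 - p) + 1 / (q - 1))) := by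
          have : 0 ≤ 1 / (1 - p) + 1 / (q - 1) := by positivity
          exact mul_le_mul_of_nonneg_left (by linarith) (by positivity)
      _ = _ := by ring
  · have hN := normProd_nonneg l
    have hT1 : (0 : ℝ) ≤ max 1 T := zero_le_one.trans (le_max_left _ _)
    -- The balancing scale `‖b‖^{1/θ}` must be positive.
    rcases eq_or_ne b 0 with rfl | hb
    · rw [iterDiff_append_zero_zero]; simp
    obtain ⟨h1, h2⟩ := hG.iterDiff_duhamel h h0 hst htT hψ hA (l ++ [b, b]) x
    rw [h2]
    have h3 := abs_integral_le_of_two_bounds hR (D := D * normProd l) (by positivity)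
      (norm_pos_iff.2 hb) h1 hp hq hap heq (fun r hr => (hS' r hr).near l hl b x)
      (fun r hr => (hS' r hr).far l hl b x)
    refine h3.trans ?_
    calc D * normProd l * (1 / (1 - p) + 1 / (q - 1)) * ‖b‖
        ≤ D * normProd l * (max 1 T / (1 - θ * n) + (1 / (1 - p) + 1 / (q - 1))) * ‖b‖ := by
          have : 0 ≤ max 1 T / (1 - θ * n) := by positivity
          exact mul_le_mul_of_nonneg_right (mul_le_mul_of_nonneg_left (by linarith)
            (by positivity)) (norm_nonneg _)
      _ = _ := by ring

lemma Standing.exists_zygmund_const (h : Standing T U B f) (hθ : 0 < θ) {n : ℕ}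
    {a p e q C₀ : ℝ} (hn : θ * n < 1) (hp : p < 1) (hq : 1 < q) (hap : a + (1 - p) / θ = 1)
    (heq : e + (1 - q) / θ = 1) (hC₀ : 0 ≤ C₀) :
    ∃ C : ℝ≥0, ∀ t ∈ Icc 0 T, ∀ (φ : X → ℝ) (ψ : ℝ → X → ℝ) (A : ℝ), 0 ≤ A →
      MemZygmund (n + 1) φ → ContinuousOn (fun p : ℝ × X => ψ p.1 p.2) (Icc 0 t ×ˢ univ) →
      (∀ σ ∈ Icc 0 t, ∀ x, |ψ σ x| ≤ A) →
      (∀ s ∈ Icc 0 t, ∀ σ ∈ Ioc s t,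
        SingularBounds θ a p e q n (C₀ * A) (σ - s) (evol U B f s σ (ψ σ))) →
      MemZygmundTime 0 t (n + 1) (mildSolution U B f t φ ψ) ∧
        zygmundNormTime 0 t (n + 1) (mildSolution U B f t φ ψ) ≤
          C * (zygmundNorm (n + 1) φ + ENNReal.ofReal A) := by
  obtain ⟨M, hM1, hM⟩ := h.exists_norm_U_le
  obtain ⟨K, G, g, -, hG⟩ := h.exists_isKernel
  have hn' : 0 < 1 - θ * n := by linarith
  have hp' : 0 < 1 - p := by linarith
  have hq' : 0 < q - 1 := by linarith
  have hT1 : (0 : ℝ) ≤ max 1 T := zero_le_one.trans (le_max_left _ _)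
  have hM0 : 0 ≤ M := zero_le_one.trans hM1
  set C₁ := M ^ (n + 1) with hC₁
  set C₂ := (max 1 T / (1 - θ * n) + (1 / (1 - p) + 1 / (q - 1))) * C₀ with hC₂
  have hC₁0 : 0 ≤ C₁ := by positivity
  have hC₂0 : 0 ≤ C₂ := by positivity
  -- The factor `n + 2` counts the sup norms of orders `0, …, n` and the Zygmund seminorm.
  refine ⟨Real.toNNReal ((n + 2) * (C₁ + C₂)), fun t ht φ ψ A hA0 hφ hψ hA hS => ?_⟩
  have hZ := hφ.zygBounds
  set N := (zygmundNorm (n + 1) φ).toReal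
  have hN0 : 0 ≤ N := ENNReal.toReal_nonneg
  have hφc : Continuous φ := hφ.1.1.1
  have hφA : ∀ x, |φ x| ≤ N := fun x => by simpa using hZ.diff 0 (Nat.zero_le _) [] rfl x
  have hu : ∀ s ∈ Icc 0 t, ZygBounds n (C₁ * N + C₂ * A) (mildSolution U B f t φ ψ s) := by
    intro s hs
    have h1 := h.zygBounds_evol hM1 (hM s t hs.1 hs.2 ht.2) hs.1 hs.2 ht.2 hφc hZ
    have h2 := hG.zygBounds_duhamel h hθ hn hp hq hap heq (mul_nonneg hC₀ hA0) hs.1 hs.2 ht.2 hψ hA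
      (hS s hs)
    rw [← mul_assoc, ← hC₂] at h2
    exact h1.sub h2
  obtain ⟨h1, h2⟩ := memZygmundTime_of_zygBounds
    (h.continuousOn_mildSolution ht.2 hφc hφA hψ hA) hu
  refine ⟨h1, h2.trans ?_⟩
  have hNe : zygmundNorm (n + 1) φ = ENNReal.ofReal N :=
    (ENNReal.ofReal_toReal hφ.zygmundNorm_lt_top.ne).symm
  have hcoe : ∀ x : ℝ, ((Real.toNNReal x : ℝ≥0) : ℝ≥0∞) = ENNReal.ofReal x := fun _ => rfl
  rw [hNe, ← ENNReal.ofReal_add hN0 hA0, hcoe, ← ENNReal.ofReal_mul (by positivity)]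
  refine ENNReal.ofReal_le_ofReal ?_
  have h3 : C₁ * N + C₂ * A ≤ (C₁ + C₂) * (N + A) := by
    nlinarith [mul_nonneg hC₁0 hA0, mul_nonneg hC₂0 hN0]
  calc ((n : ℝ) + 2) * (C₁ * N + C₂ * A) ≤ (n + 2) * ((C₁ + C₂) * (N + A)) := by gcongr
    _ = _ := by ring

/-- The smoothing estimates for differences of order at most `m`, with one constant. -/
lemma Standing.exists_smoothing_const (h : Standing T U B f) (hR : RangeCondition T U B)
    (hL : LamBound T θ U B) (m : ℕ) :
    ∃ D : ℝ, 0 ≤ D ∧ ∀ s t, 0 ≤ s → s < t → t ≤ T → ∀ (φ : X → ℝ) (A : ℝ), Continuous φ →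
      (∀ x, |φ x| ≤ A) → ∀ l : List X, l.length ≤ m → ∀ x,
        |iterDiff l (evol U B f s t φ) x| ≤ D * (t - s) ^ (-(θ * l.length)) * normProd l * A := by
  obtain ⟨c, hc⟩ := hL
  -- The given constant may be negative; its positive part keeps the bound and has nonnegative
  -- powers.
  have hc' : ∀ s t, 0 ≤ s → s < t → t ≤ T → ∀ x,
      ‖Lam U B t s x‖ ≤ max c 0 * (t - s) ^ (-θ) * ‖x‖ := by
    intro s t h0 hst htT x
    have : 0 ≤ t - s := by linarith
    refine (hc s t h0 hst htT x).trans ?_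
    gcongr
    exact le_max_left _ _
  have hc0 : 0 ≤ max c 0 := le_max_right _ _
  set κ : ℕ → ℝ := fun j => (2 * √j * max c 0) ^ j with hκ
  have hκ0 : ∀ j, 0 ≤ κ j := fun j => by positivity
  refine ⟨∑ j ∈ Finset.range (m + 1), κ j, Finset.sum_nonneg fun j _ => hκ0 j,
    fun s t h0 hst htT φ A hφ hA l hl x => ?_⟩
  refine (h.abs_iterDiff_evol_le hR hc0 hc' h0 hst htT hφ hA l x).trans ?_
  have hA0 : 0 ≤ A := (abs_nonneg _).trans (hA 0)
  have hN := normProd_nonneg l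
  have hts : 0 ≤ t - s := by linarith
  have := Finset.single_le_sum (f := κ) (fun j _ => hκ0 j)
    (Finset.mem_range.2 (Nat.lt_succ_of_le hl))
  gcongr

lemma iterDiff_append_pair (l : List X) (b : X) (F : X → ℝ) :
    iterDiff (l ++ [b, b]) F = fwdDiff b (iterDiff l (fwdDiff b F)) := by
  rw [iterDiff_append]
  exact iterDiff_fwdDiff l b (fwdDiff b F)

end Estimates

/-! ### Pointwise bounds from the norms of `ψ` -/

section TimeNorms

variable {X : Type*} [NormedAddCommGroup X] [NormedSpace ℝ X]

lemma abs_le_of_supNormTime {t : ℝ} {ψ : ℝ → X → ℝ} (h : supNormTime 0 t ψ < ∞) {σ : ℝ}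
    (hσ : σ ∈ Icc 0 t) (x : X) : |ψ σ x| ≤ (supNormTime 0 t ψ).toReal := by
  have h1 : supNorm (ψ σ) ≤ supNormTime 0 t ψ := le_iSup₂ (f := fun s _ => supNorm (ψ s)) σ hσ
  exact (norm_le_of_supNorm (h1.trans_lt h) x).trans (ENNReal.toReal_mono h.ne h1)

lemma abs_le_of_holderNormTime {t α : ℝ} {ψ : ℝ → X → ℝ} (h : holderNormTime 0 t α ψ < ∞) {σ : ℝ}
    (hσ : σ ∈ Icc 0 t) (x : X) : |ψ σ x| ≤ (holderNormTime 0 t α ψ).toReal := by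
  have h1 : supNorm (ψ σ) ≤ holderNormTime 0 t α ψ :=
    le_self_add.trans (le_iSup₂ (f := fun s _ => holderNorm α (ψ s)) σ hσ)
  exact (norm_le_of_supNorm (h1.trans_lt h) x).trans (ENNReal.toReal_mono h.ne h1)

lemma abs_fwdDiff_le_of_holderNormTime {t α : ℝ} (hα : 0 < α) {ψ : ℝ → X → ℝ}
    (h : holderNormTime 0 t α ψ < ∞) {σ : ℝ} (hσ : σ ∈ Icc 0 t) (b x : X) :
    |fwdDiff b (ψ σ) x| ≤ (holderNormTime 0 t α ψ).toReal * ‖b‖ ^ α := by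
  rcases eq_or_ne b 0 with rfl | hb
  · simp [fwdDiff, Real.zero_rpow hα.ne']
  have h1 : ‖ψ σ (x + b) - ψ σ x‖ₑ / ENNReal.ofReal (‖b‖ ^ α) ≤ holderNormTime 0 t α ψ := by
    have h0 : ‖ψ σ (x + b) - ψ σ x‖ₑ / ENNReal.ofReal (‖b‖ ^ α) ≤ holderSeminorm α (ψ σ) :=
      le_iSup_of_le x (le_iSup_of_le b (le_iSup_of_le hb le_rfl))
    exact h0.trans (le_add_self.trans (le_iSup₂ (f := fun s _ => holderNorm α (ψ s)) σ hσ))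
  have h2 := ENNReal.toReal_mono h.ne h1
  have hb' : 0 < ‖b‖ ^ α := Real.rpow_pos_of_pos (norm_pos_iff.2 hb) _
  rwa [ENNReal.toReal_div, toReal_enorm, ENNReal.toReal_ofReal hb'.le, div_le_iff₀ hb'] at h2

end TimeNorms

/-! ### The bounded and the Hölder case -/

section MainTheorem

variable {X : Type*} [NormedAddCommGroup X] [InnerProductSpace ℝ X] [CompleteSpace X]
  [MeasurableSpace X] [BorelSpace X] [SecondCountableTopology X]
  {T θ : ℝ} {U : ℝ → ℝ → X →L[ℝ] X} {B : ℝ → X →L[ℝ] X} {f : ℝ → X}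

/-- Here `θ (n + 1) = 1`. Smoothing only `n` of the `n + 2` steps gives `r^{-(1-θ)}` with no power
of `‖b‖`; smoothing all of them gives `‖b‖² r^{-(1+θ)}`. -/
lemma Standing.exists_const_of_bounded (h : Standing T U B f) (hθ : 0 < θ)
    (hR : RangeCondition T U B) (hL : LamBound T θ U B) (n : ℕ) (hn : 1 / θ = (n + 1 : ℕ)) :
    ∃ C : ℝ≥0, ∀ t ∈ Icc 0 T, ∀ (φ : X → ℝ) (ψ : ℝ → X → ℝ),
      MemZygmund (n + 1) φ → MemCbTime 0 t ψ →
        MemZygmundTime 0 t (n + 1) (mildSolution U B f t φ ψ) ∧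
        zygmundNormTime 0 t (n + 1) (mildSolution U B f t φ ψ) ≤
          C * (zygmundNorm (n + 1) φ + supNormTime 0 t ψ) := by
  obtain ⟨D, hD0, hD⟩ := h.exists_smoothing_const hR hL (n + 2)
  have hn1 : θ * (n + 1) = 1 := by
    push_cast at hn; rw [← hn]; field_simp
  obtain ⟨C, hC⟩ := h.exists_zygmund_const hθ (n := n) (a := 0) (p := θ * n) (e := 2)
    (q := θ * (n + 2)) (C₀ := 4 * D) (by linarith) (by linarith) (by linarith)
    (by rw [show 1 - θ * n = θ by linarith]; field_simp; ring)
    (by rw [show 1 - θ * (n + 2) = -θ by linarith]; field_simp; ring) (by positivity)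
  refine ⟨C, fun t ht φ ψ hφ hψ => ?_⟩
  have hA := fun σ hσ x => abs_le_of_supNormTime hψ.2 (σ := σ) hσ x
  rw [← ENNReal.ofReal_toReal hψ.2.ne]
  set A := (supNormTime 0 t ψ).toReal
  have hA0 : 0 ≤ A := ENNReal.toReal_nonneg
  refine hC t ht φ ψ A hA0 hφ hψ.1 hA fun s hs σ hσ => ?_
  have hσ' : σ ∈ Icc 0 t := ⟨hs.1.trans hσ.1.le, hσ.2⟩
  have hr : 0 < σ - s := sub_pos.2 hσ.1
  have hS := hD s σ hs.1 hσ.1 (hσ.2.trans ht.2) (ψ σ) A (continuous_slice hψ.1 hσ') (hA σ hσ')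
  refine ⟨fun l hl x => ?_, fun l hl b x => ?_, fun l hl b x => ?_⟩
  · have hN := normProd_nonneg l
    refine (hS l (by omega) x).trans ?_
    have h1 : 0 ≤ D * (σ - s) ^ (-(θ * l.length)) * normProd l * A := by positivity
    linarith
  · rw [iterDiff_append_pair, iterDiff_fwdDiff]
    -- The two unsmoothed steps cost the factor `4`, which is where `C₀ = 4 * D` comes from.
    have h1 := norm_iterDiff_le
      (fun x => (Real.norm_eq_abs _).trans_le (hS l (by omega) x)) [b, b] x
    refine h1.trans_eq ?_
    rw [hl, Real.rpow_zero]
    norm_num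
    ring
  · have hN := normProd_nonneg l
    refine (hS (l ++ [b, b]) (by simp [hl]) x).trans ?_
    rw [normProd_append, normProd_cons, normProd_cons, normProd_nil, List.length_append, hl,
      Real.rpow_two]
    have e1 : ((n + [b, b].length : ℕ) : ℝ) = n + 2 := by simp
    rw [e1]
    have h1 : 0 ≤ D * A * normProd l * (‖b‖ ^ 2 * (σ - s) ^ (-(θ * (n + 2)))) := by positivity
    linarith

/-- Here `θ (n + 1 - α) = 1`. One step `b` is carried through the evolution onto `ψ`, where Hölder
continuity yields `‖b‖^α`. Smoothing `n` of the remaining steps gives `‖b‖^α r^{-(1-θ(1-α))}`, and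
smoothing all `n + 1` gives `‖b‖^{1+α} r^{-(1+θα)}`. -/
lemma Standing.exists_const_of_holder (h : Standing T U B f) (hθ : 0 < θ)
    (hR : RangeCondition T U B) (hL : LamBound T θ U B) {α : ℝ} (hα : α ∈ Ioo (0 : ℝ) 1) (n : ℕ)
    (hn : α + 1 / θ = (n + 1 : ℕ)) :
    ∃ C : ℝ≥0, ∀ t ∈ Icc 0 T, ∀ (φ : X → ℝ) (ψ : ℝ → X → ℝ),
      MemZygmund (n + 1) φ → MemHolderTime 0 t α ψ →
        MemZygmundTime 0 t (n + 1) (mildSolution U B f t φ ψ) ∧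
        zygmundNormTime 0 t (n + 1) (mildSolution U B f t φ ψ) ≤
          C * (zygmundNorm (n + 1) φ + holderNormTime 0 t α ψ) := by
  obtain ⟨hα0, hα1⟩ := hα
  obtain ⟨D, hD0, hD⟩ := h.exists_smoothing_const hR hL (n + 1)
  obtain ⟨M, hM1, hM⟩ := h.exists_norm_U_le
  have hM0 : 0 ≤ M := zero_le_one.trans hM1
  have hn1 : θ * (n + 1 - α) = 1 := by
    push_cast at hn; rw [← hn]; field_simp; ring
  have hαθ := mul_pos hα0 hθ
  have hαθ' := mul_lt_mul_of_pos_right hα1 hθ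
  obtain ⟨C, hC⟩ := h.exists_zygmund_const hθ (n := n) (a := α) (p := θ * n) (e := 1 + α)
    (q := θ * (n + 1)) (C₀ := 2 * D * M) (by linarith) (by linarith) (by linarith)
    (by rw [show 1 - θ * n = θ * (1 - α) by linarith]; field_simp; ring)
    (by rw [show 1 - θ * (n + 1) = -(θ * α) by linarith]; field_simp; ring) (by positivity)
  refine ⟨C, fun t ht φ ψ hφ hψ => ?_⟩
  have hA := fun σ hσ x => abs_le_of_holderNormTime hψ.2.2 (σ := σ) hσ x
  have hH := fun σ hσ b x => abs_fwdDiff_le_of_holderNormTime hα0 hψ.2.2 (σ := σ) hσ b x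
  rw [← ENNReal.ofReal_toReal hψ.2.2.ne]
  set A := (holderNormTime 0 t α ψ).toReal
  have hA0 : 0 ≤ A := ENNReal.toReal_nonneg
  refine hC t ht φ ψ A hA0 hφ hψ.1.1 hA fun s hs σ hσ => ?_
  have hσ' : σ ∈ Icc 0 t := ⟨hs.1.trans hσ.1.le, hσ.2⟩
  have hr : 0 < σ - s := sub_pos.2 hσ.1
  have hψσ := continuous_slice hψ.1.1 hσ'
  have hS := hD s σ hs.1 hσ.1 (hσ.2.trans ht.2)
  have hdiff : ∀ b, fwdDiff b (evol U B f s σ (ψ σ)) =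
      evol U B f s σ (fwdDiff (U σ s b) (ψ σ)) := fun b =>
    h.iterDiff_evol hs.1 hσ.1.le (hσ.2.trans ht.2) hψσ (hA σ hσ') [b]
  have hUb : ∀ b x, |fwdDiff (U σ s b) (ψ σ) x| ≤ A * (M * ‖b‖ ^ α) := by
    intro b x
    refine (hH σ hσ' _ x).trans (mul_le_mul_of_nonneg_left ?_ hA0)
    calc ‖U σ s b‖ ^ α ≤ (M * ‖b‖) ^ α := Real.rpow_le_rpow (norm_nonneg _)
          ((U σ s).le_of_opNorm_le (hM s σ hs.1 hσ.1.le (hσ.2.trans ht.2)) b) hα0.le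
      _ = M ^ α * ‖b‖ ^ α := Real.mul_rpow hM0 (norm_nonneg _)
      _ ≤ M ^ (1 : ℝ) * ‖b‖ ^ α := by
          gcongr
      _ = M * ‖b‖ ^ α := by rw [Real.rpow_one]
  have hS' := fun b => hS _ _ (continuous_iterDiff hψσ [U σ s b]) (hUb b)
  refine ⟨fun l hl x => ?_, fun l hl b x => ?_, fun l hl b x => ?_⟩
  · have hN := normProd_nonneg l
    refine (hS (ψ σ) A hψσ (hA σ hσ') l (by omega) x).trans ?_
    -- The plain bounds do not need the factor `2 M ≥ 1`; it is inserted to share one constant with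
    -- the other two.
    calc D * (σ - s) ^ (-(θ * l.length)) * normProd l * A
        = 1 * (D * (σ - s) ^ (-(θ * l.length)) * normProd l * A) := (one_mul _).symm
      _ ≤ (2 * M) * (D * (σ - s) ^ (-(θ * l.length)) * normProd l * A) := by
          gcongr; linarith
      _ = _ := by ring
  · rw [iterDiff_append_pair, hdiff]
    have h1 := norm_iterDiff_le
      (fun x => (Real.norm_eq_abs _).trans_le (hS' b l (by omega) x)) [b] x
    refine h1.trans_eq ?_
    rw [hl]
    simp only [List.length_singleton]
    ring
  · have hN := normProd_nonneg l
    rw [show l ++ [b, b] = (l ++ [b]) ++ [b] by simp, iterDiff_append,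
      show iterDiff [b] (evol U B f s σ (ψ σ)) = _ from hdiff b]
    refine (hS' b (l ++ [b]) (by simp [hl]) x).trans ?_
    rw [normProd_append, normProd_cons, normProd_nil, List.length_append, hl,
      Real.rpow_add' (norm_nonneg _) (by linarith), Real.rpow_one]
    have e1 : ((n + [b].length : ℕ) : ℝ) = n + 1 := by simp
    rw [e1]
    have h1 : 0 ≤ D * A * M * normProd l * (‖b‖ * ‖b‖ ^ α * (σ - s) ^ (-(θ * (n + 1)))) := by
      positivity
    linarith

end MainTheorem

end OU

theorem mainTheorem2 {X : Type*} [NormedAddCommGroup X] [InnerProductSpace ℝ X]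
    [CompleteSpace X] [TopologicalSpace.SeparableSpace X] [MeasurableSpace X] [BorelSpace X]
    (T θ : ℝ) (hT : 0 < T) (hθ : 0 < θ)
    (U : ℝ → ℝ → X →L[ℝ] X) (B : ℝ → X →L[ℝ] X) (f : ℝ → X)
    (h1 : OU.Standing T U B f) (h2 : OU.RangeCondition T U B) (h3 : OU.LamBound T θ U B) :
    (∀ k : ℕ, 1 / θ = k →
      ∃ C : ℝ≥0, ∀ t ∈ Icc 0 T, ∀ (φ : X → ℝ) (ψ : ℝ → X → ℝ),
        OU.MemZygmund k φ → OU.MemCbTime 0 t ψ →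
          OU.MemZygmundTime 0 t k (OU.mildSolution U B f t φ ψ) ∧
          OU.zygmundNormTime 0 t k (OU.mildSolution U B f t φ ψ) ≤
            C * (OU.zygmundNorm k φ + OU.supNormTime 0 t ψ)) ∧
    (∀ α ∈ Ioo (0 : ℝ) 1, ∀ k : ℕ, α + 1 / θ = k →
      ∃ C : ℝ≥0, ∀ t ∈ Icc 0 T, ∀ (φ : X → ℝ) (ψ : ℝ → X → ℝ),
        OU.MemZygmund k φ → OU.MemHolderTime 0 t α ψ →
          OU.MemZygmundTime 0 t k (OU.mildSolution U B f t φ ψ) ∧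
          OU.zygmundNormTime 0 t k (OU.mildSolution U B f t φ ψ) ≤
            C * (OU.zygmundNorm k φ + OU.holderNormTime 0 t α ψ)) := by
  have := UniformSpace.secondCountable_of_separable X
  -- Positivity of `1 / θ` excludes `k = 0` in both parts, so that `k = n + 1`.
  have hθ' : 0 < 1 / θ := one_div_pos.2 hθ
  refine ⟨fun k hk => ?_, fun α hα k hk => ?_⟩
  · obtain ⟨n, rfl⟩ : ∃ n, k = n + 1 := Nat.exists_eq_succ_of_ne_zero (by
      rintro rfl; rw [hk] at hθ'; simp at hθ')
    exact h1.exists_const_of_bounded hθ h2 h3 n hk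
  · obtain ⟨n, rfl⟩ : ∃ n, k = n + 1 := Nat.exists_eq_succ_of_ne_zero (by
      rintro rfl; have := hα.1; rw [Nat.cast_zero] at hk; linarith)
    exact h1.exists_const_of_holder hθ h2 h3 hα n hk
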